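/- Let $d=n_0+n_1+\dots+n_\kappa$ and split $z\in\mathbb R^d$ into blocks of sizes $n_\kappa,\dots,n_1,n_0$; a hat denotes the part of a vector (or of $\nabla$) in the last block, of size $n_0$. Let $W:\mathbb R^d\to\mathbb R$ be differentiable with $W(z)\to\infty$ as $|z|\to\infty$ and $W(z)\ge c_1|z|^q-c_2$ for some $q>1$, $c_1,c_2>0$. Let $\widehat{\mathbf A}(z)$ be a bounded, Hölder continuous, uniformly elliptic (not necessarily symmetric) $n_0\times n_0$ matrix field, let $b(z)=(0,\widehat b(z))$ with $\widehat b:\mathbb R^d\to\mathbb R^{n_0}$ continuous, and let $\mathbf B$ be the constant matrix that maps the block $j-1$ of $z$ into the block $j$ by a matrix $\mathbf B_j\in\mathbb R^{n_j\times n_{j-1}}$ of rank $n_j$, $1\le j\le\kappa$, and whose other blocks vanish. Fix $\varepsilon>0$, put $Z_\varepsilon=\int e^{-W/\varepsilon}dz$, $\rho_\varepsilon(dz)=Z_\varepsilon^{-1}e^{-W/\varepsilon}dz$, and assume that $\nabla\cdot\big((b+\mathbf Bz)e^{-W/\varepsilon}\big)=0$ in $\mathbb R^d$ (weakly) and that $b\in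 L^2(\rho_\varepsilon)$. Consider $$\mathscr L_\varepsilon f=\varepsilon e^{W/\varepsilon}\widehat\nabla\cdot\big[e^{-W/\varepsilon}\widehat{\mathbf A}\widehat\nabla f\big]+(b+\mathbf Bz)\cdot\nabla f$$ and its adjoint $\mathscr L_\varepsilon^\dagger$ with respect to $\rho_\varepsilon$, obtained by replacing $(\widehat{\mathbf A},b,\mathbf B)$ by $(\widehat{\mathbf A}^{T},-b,-\mathbf B)$. Let $\mathcal A,\mathcal B\subset\mathbb R^d$ be bounded open sets with $C^{2,\alpha}$ boundaries, $0<\alpha<1$, at positive distance from each other, let $\Omega=(\overline{\mathcal A\cup\mathcal B})^c$, let $n_\Omega$ be its unit outward normal and $\sigma$ the surface measure. Let $$\Gamma=\{z\in\partial\Omega:\ \widehat n_\Omega(z)\ne0\ \text{or}\ \mathbf Bz\cdot n_\Omega(z)>0\},\qquad \Gamma^\dagger=\{z\in\partial\Omega:\ \widehat n_\Omega(z)\ne0\ \text{or}\ \mathbf Bz\cdot n_\Omega(z)<0\}$$ be the regular parts of $\partial\Omega$ for the two operators. Let $h_\varepsilon\in C(\overline\Omega)\cap C^1(\Omega)$ be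 a weak solution of $\mathscr L_\varepsilon h_\varepsilon=0$ in $\Omega$, that is, $h_\varepsilon,\widehat\nabla h_\varepsilon\in L^2(\Omega,\rho_\varepsilon)$ and $$\int_\Omega\big(\varepsilon\widehat{\mathbf A}\widehat\nabla h_\varepsilon\cdot\widehat\nabla\varphi+h_\varepsilon(b+\mathbf Bz)\cdot\nabla\varphi\big)\rho_\varepsilon(dz)=0\qquad\text{for all }\varphi\in C^1_c(\Omega),$$ with $h_\varepsilon=1$ on $\Gamma\cap\partial\mathcal A$ and $h_\varepsilon=0$ on $\Gamma\cap\partial\mathcal B$. Assume that the $\widehat{\mathbf A}$-normal derivative $$\widehat{\mathbf A}\widehat\nabla h_\varepsilon\cdot\widehat n_\Omega\,(z_0):=\lim_{\delta\downarrow0}\,(\widehat{\mathbf A}\widehat\nabla h_\varepsilon)(z_0-\delta n_\Omega(z_0))\cdot\widehat n_\Omega(z_0)$$ exists at every $z_0\in\partial\Omega$, the quantities under the limit being bounded uniformly in $z_0\in\partial\Omega$ and in all sufficiently small $\delta>0$. Let $h_\varepsilon^\dagger$ have the same properties with respect to $\mathscr L_\varepsilon^\dagger$, $\widehat{\mathbf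 A}^T$ and $\Gamma^\dagger$. Then the integrands below are $\sigma$-integrable on $\partial\mathcal A$, and with $$\mathrm{cap}_\varepsilon(\mathcal A,\mathcal B)=\frac1{Z_\varepsilon}\int_{\partial\mathcal A}\Big(\varepsilon\,\widehat{\mathbf A}\widehat\nabla h_\varepsilon\cdot\widehat n_\Omega+(h_\varepsilon-1)(b+\mathbf Bz)\cdot n_\Omega\Big)e^{-W/\varepsilon}\,\sigma(dz),$$ $$\mathrm{cap}^\dagger_\varepsilon(\mathcal A,\mathcal B)=\frac1{Z_\varepsilon}\int_{\partial\mathcal A}\Big(\varepsilon\,\widehat{\mathbf A}^T\widehat\nabla h^\dagger_\varepsilon\cdot\widehat n_\Omega+(1-h^\dagger_\varepsilon)(b+\mathbf Bz)\cdot n_\Omega\Big)e^{-W/\varepsilon}\,\sigma(dz)$$ one has $\mathrm{cap}_\varepsilon(\mathcal A,\mathcal B)=\mathrm{cap}^\dagger_\varepsilon(\mathcal A,\mathcal B)$. -/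

import Mathlib

open MeasureTheory Filter Topology Set
open scoped Gradient Matrix

noncomputable section

namespace FokkerPlanck

/-- The space `ℝ^d`, `d = n₀ + n₁ + ⋯ + n_κ`, with its Euclidean norm and with its coordinates
grouped into blocks of sizes `n₀, …, n_κ`. Block `0` is the block of the diffusive coordinates
(those carrying a hat). -/
abbrev Space {κ : ℕ} (n : Fin (κ + 1) → ℕ) : Type :=
  EuclideanSpace ℝ (Σ j : Fin (κ + 1), Fin (n j))

/-- The block of size `n₀` of a vector, e.g. `hat (∇ f z)` and `hat ν` for a normal vector `ν`. -/
def hat {κ : ℕ} {n : Fin (κ + 1) → ℕ} (v : Space n) : EuclideanSpace ℝ (Fin (n 0)) :=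
  WithLp.toLp 2 fun i => v ⟨0, i⟩

/-- The coefficients of `L_ε f = ε e^{W/ε} ∇·[e^{-W/ε} A ∇f] + (b + B z)·∇f`:
`Ahat` is the only non-zero block of `A`, `bhat` the only non-zero block of `b`, and
`Bblock j` is the `n_{j+1} × n_j` block of the constant matrix `B` that sends the block `j` of `z`
to the block `j + 1`; all the other blocks of `B` vanish. -/
structure Coefficients (κ : ℕ) (n : Fin (κ + 1) → ℕ) where
  Ahat : Space n → Matrix (Fin (n 0)) (Fin (n 0)) ℝ
  bhat : Space n → EuclideanSpace ℝ (Fin (n 0))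
  Bblock : (j : Fin κ) → Matrix (Fin (n j.succ)) (Fin (n j.castSucc)) ℝ
  W : Space n → ℝ

namespace Coefficients

variable {κ : ℕ} {n : Fin (κ + 1) → ℕ}

/-- The vector `B z`. -/
def Bmul (c : Coefficients κ n) (z : Space n) : Space n :=
  WithLp.toLp 2 fun p =>
    Fin.cases (motive := fun j => Fin (n j) → ℝ) (fun _ => 0)
      (fun j => c.Bblock j *ᵥ fun k => z ⟨j.castSucc, k⟩) p.1 p.2

/-- The vector `b(z)`, with all the blocks but the block `0` equal to zero. -/
def b (c : Coefficients κ n) (z : Space n) : Space n :=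
  WithLp.toLp 2 fun p =>
    Fin.cases (motive := fun j => Fin (n j) → ℝ) (fun i => c.bhat z i) (fun _ _ => 0) p.1 p.2

/-- The drift `b(z) + B z`. -/
def drift (c : Coefficients κ n) (z : Space n) : Space n := c.b z + c.Bmul z

/-- The vector `Â(z) u`. -/
def Amul (c : Coefficients κ n) (z : Space n) (u : EuclideanSpace ℝ (Fin (n 0))) :
    EuclideanSpace ℝ (Fin (n 0)) :=
  WithLp.toLp 2 (c.Ahat z *ᵥ fun i => u i)

/-- The coefficients of the adjoint operator
`L_ε† f = ε e^{W/ε} ∇·[e^{-W/ε} Aᵀ ∇f] - (b + B z)·∇f`. -/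
def adjoint (c : Coefficients κ n) : Coefficients κ n where
  Ahat z := (c.Ahat z)ᵀ
  bhat z := - c.bhat z
  Bblock j := - c.Bblock j
  W := c.W

/-- Structural assumptions on the coefficients. -/
structure Admissible (c : Coefficients κ n) : Prop where
  A_bounded : ∃ M : ℝ, ∀ z i j, |c.Ahat z i j| ≤ M
  A_holder : ∃ α : ℝ, 0 < α ∧ α < 1 ∧ ∃ M : ℝ, ∀ z z' i j,
    |c.Ahat z i j - c.Ahat z' i j| ≤ M * ‖z - z'‖ ^ α
  A_elliptic : ∃ l : ℝ, 0 < l ∧ ∀ z (ξ : EuclideanSpace ℝ (Fin (n 0))),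
    l * ‖ξ‖ ^ 2 ≤ inner ℝ ξ (c.Amul z ξ)
  b_continuous : Continuous c.bhat
  B_rank : ∀ j, (c.Bblock j).rank = n j.succ
  W_differentiable : Differentiable ℝ c.W
  W_confining : Tendsto c.W (cocompact (Space n)) atTop
  W_growth : ∃ q c₁ c₂ : ℝ, 1 < q ∧ 0 < c₁ ∧ 0 < c₂ ∧ ∀ z, c₁ * ‖z‖ ^ q - c₂ ≤ c.W z

/-- The normalization `Z_ε = ∫ e^{-W/ε} dz`. -/
def Z (c : Coefficients κ n) (ε : ℝ) : ℝ := ∫ z, Real.exp (-(c.W z) / ε)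

/-- The measure `ρ_ε(dz) = Z_ε⁻¹ e^{-W/ε} dz`. -/
def rho (c : Coefficients κ n) (ε : ℝ) : Measure (Space n) :=
  volume.withDensity fun z => ENNReal.ofReal (Real.exp (-(c.W z) / ε) / c.Z ε)

/-- `∇·((b + B z) e^{-W/ε}) = 0` on `ℝ^d`, in the weak sense (`b` is only continuous). -/
def WeightedDivFree (c : Coefficients κ n) (ε : ℝ) : Prop :=
  ∀ φ : Space n → ℝ, ContDiff ℝ 1 φ → HasCompactSupport φ →
    ∫ z, inner ℝ (c.drift z) (∇ φ z) ∂(c.rho ε) = 0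

/-- A function `u`, continuously differentiable in the open set `D`, is a weak solution of
`L_ε u = 0` in `D`: `u` and the hat-part of `∇u` lie in `L²(D, ρ_ε)`, and the equation holds
against all `C¹` functions with compact support in `D`. -/
structure IsWeakSolution (c : Coefficients κ n) (ε : ℝ) (D : Set (Space n)) (u : Space n → ℝ) :
    Prop where
  contDiffOn : ContDiffOn ℝ 1 u D
  memLp : MemLp u 2 ((c.rho ε).restrict D)
  memLp_grad : MemLp (fun z => hat (∇ u z)) 2 ((c.rho ε).restrict D)
  eqn : ∀ φ : Space n → ℝ, ContDiff ℝ 1 φ → HasCompactSupport φ → tsupport φ ⊆ D →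
    ∫ z in D, (ε * inner ℝ (c.Amul z (hat (∇ u z))) (hat (∇ φ z))
      + u z * inner ℝ (c.drift z) (∇ φ z)) ∂(c.rho ε) = 0

end Coefficients

variable {κ : ℕ} {n : Fin (κ + 1) → ℕ}

/-- The set `D` has a `C^{2,α}` boundary: near each boundary point it is the sublevel set of a
`C^{2,α}` function whose gradient does not vanish there. -/
def HasC2HolderBoundary (α : ℝ) (D : Set (Space n)) : Prop :=
  ∀ z₀ ∈ frontier D, ∃ U : Set (Space n), IsOpen U ∧ z₀ ∈ U ∧ ∃ ψ : Space n → ℝ,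
    ContDiffOn ℝ 2 ψ U ∧
    (∃ M : ℝ, ∀ x ∈ U, ∀ y ∈ U,
      ‖iteratedFDeriv ℝ 2 ψ x - iteratedFDeriv ℝ 2 ψ y‖ ≤ M * ‖x - y‖ ^ α) ∧
    ∇ ψ z₀ ≠ 0 ∧ ∀ z ∈ U, z ∈ D ↔ ψ z < 0

/-- `ν` is the unit outward normal to `D` at the boundary point `z`. -/
def IsOutwardNormal (D : Set (Space n)) (z ν : Space n) : Prop :=
  z ∈ frontier D ∧ ‖ν‖ = 1 ∧ ∃ U : Set (Space n), IsOpen U ∧ z ∈ U ∧ ∃ ψ : Space n → ℝ,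
    ContDiffOn ℝ 1 ψ U ∧ (∀ y ∈ U, y ∈ D ↔ ψ y < 0) ∧ ∃ t : ℝ, 0 < t ∧ ∇ ψ z = t • ν

open Classical in
/-- The unit outward normal `n_D(z)` (and `0` where there is none). -/
def outwardNormal (D : Set (Space n)) (z : Space n) : Space n :=
  if h : ∃ ν, IsOutwardNormal D z ν then h.choose else 0

/-- The surface measure: the `(d-1)`-dimensional Hausdorff measure, normalized so that it agrees
with Lebesgue measure on hyperplanes. -/
def surfaceMeasure (n : Fin (κ + 1) → ℕ) : Measure (Space n) := μHE[(∑ j, n j) - 1]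

/-- Assumptions on the two sets. -/
structure AdmissiblePair (A B : Set (Space n)) : Prop where
  isOpen_left : IsOpen A
  isOpen_right : IsOpen B
  bounded_left : Bornology.IsBounded A
  bounded_right : Bornology.IsBounded B
  boundary : ∃ α : ℝ, 0 < α ∧ α < 1 ∧ HasC2HolderBoundary α A ∧ HasC2HolderBoundary α B
  separated : ∃ r : ℝ, 0 < r ∧ ∀ x ∈ A, ∀ y ∈ B, r ≤ dist x y

/-- The domain `Ω`, the complement of the closure of `A ∪ B`. -/
def outerDomain (A B : Set (Space n)) : Set (Space n) := (closure (A ∪ B))ᶜ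

namespace Coefficients

/-- The regular part `Γ(D)` of the boundary, in the sense of Fichera: the points that are
non-characteristic for the diffusion, and the characteristic ones at which the drift points
strictly out of `D` (at a characteristic point the drift has normal component `B z · n_D`).
For `c.adjoint` this is the regular part for the adjoint problem. -/
def regularBoundary (c : Coefficients κ n) (D : Set (Space n)) : Set (Space n) :=
  {z ∈ frontier D | hat (outwardNormal D z) ≠ 0 ∨ 0 < inner ℝ (c.Bmul z) (outwardNormal D z)}

/-- The quantity `Â ∇̂f · n̂_D(z₀)`, with `Â ∇̂f` taken at the distance `δ` from the boundary
point `z₀` along the inner normal. -/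
def conormalQuotient (c : Coefficients κ n) (D : Set (Space n)) (f : Space n → ℝ)
    (z₀ : Space n) (δ : ℝ) : ℝ :=
  inner ℝ (c.Amul (z₀ - δ • outwardNormal D z₀) (hat (∇ f (z₀ - δ • outwardNormal D z₀))))
    (hat (outwardNormal D z₀))

/-- The `Â`-normal derivative of `f` at a boundary point `z₀` of `D`. -/
def conormalDeriv (c : Coefficients κ n) (D : Set (Space n)) (f : Space n → ℝ)
    (z₀ : Space n) : ℝ :=
  limUnder (𝓝[>] (0 : ℝ)) (c.conormalQuotient D f z₀)

/-- The `Â`-normal derivative of `f` exists on the boundary of `D` and is uniformly bounded. -/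
def HasBoundedConormalDeriv (c : Coefficients κ n) (D : Set (Space n)) (f : Space n → ℝ) : Prop :=
  (∀ z ∈ frontier D, ∃ l : ℝ, Tendsto (c.conormalQuotient D f z) (𝓝[>] (0 : ℝ)) (𝓝 l)) ∧
  ∃ M δ₀ : ℝ, 0 < δ₀ ∧ ∀ z ∈ frontier D, ∀ δ : ℝ, 0 < δ → δ < δ₀ →
    |c.conormalQuotient D f z δ| ≤ M

/-- `h` is an equilibrium potential of the pair `A, B` for the operator with coefficients `c`. -/
structure IsEquilibriumPotential (c : Coefficients κ n) (ε : ℝ) (A B : Set (Space n))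
    (h : Space n → ℝ) : Prop where
  continuousOn : ContinuousOn h (closure (outerDomain A B))
  weakSolution : c.IsWeakSolution ε (outerDomain A B) h
  eq_one : ∀ z ∈ c.regularBoundary (outerDomain A B) ∩ frontier A, h z = 1
  eq_zero : ∀ z ∈ c.regularBoundary (outerDomain A B) ∩ frontier B, h z = 0
  conormal : c.HasBoundedConormalDeriv (outerDomain A B) h

/-- The density of the capacity with respect to the surface measure, without the factor `1/Z_ε`. -/
def capIntegrand (c : Coefficients κ n) (ε : ℝ) (A B : Set (Space n)) (h : Space n → ℝ)
    (z : Space n) : ℝ :=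
  (ε * c.conormalDeriv (outerDomain A B) h z
    + (h z - 1) * inner ℝ (c.drift z) (outwardNormal (outerDomain A B) z))
    * Real.exp (-(c.W z) / ε)

/-- The capacity `cap_ε(A, B)` computed from the equilibrium potential `h`. The adjoint capacity
is the same expression for the coefficients `c.adjoint` and the adjoint equilibrium potential. -/
def cap (c : Coefficients κ n) (ε : ℝ) (A B : Set (Space n)) (h : Space n → ℝ) : ℝ :=
  (1 / c.Z ε) * ∫ z in frontier A, c.capIntegrand ε A B h z ∂(surfaceMeasure n)

end Coefficients

end FokkerPlanck

end

/-!
Write `w = h†` and `n` for the outward normal of `Ω`. Testing the equation of `h` with `w` and the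
equation of `w` with `h`, the two diffusive terms cancel because the diffusion matrices of the two
operators are transposes of each other, and Green's second identity says that
`ε (w Â∇̂h - h Âᵀ∇̂w)·n̂ + h w (b + Bz)·n`, weighted by `e^{-W/ε}`, has integral zero over `∂Ω`.
At a point of `∂A` each of `(w - 1) Â∇̂h·n̂`, `(h - 1) Âᵀ∇̂w·n̂` and `(h - 1)(w - 1) (b + Bz)·n`
vanishes: a point with `n̂ ≠ 0` is regular for both problems; at a point with `n̂ = 0` the normal
derivatives vanish and the sign of `Bz·n`, unless it is zero, makes the point regular for one of the
two problems. So on `∂A` the integrand is the difference of the two capacity densities plus the flux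
of `(b + Bz) e^{-W/ε}`, and in the same way it vanishes on `∂B`. The flux through `∂A` is zero
because the field is divergence free on the whole space.

Two points need care. As `h` and `w` are not bounded in `Ω`, they are tested with truncations, whose
defects converge to zero. And a field which only has bounded limits along the normals is not covered
by the usual divergence theorem. It is cut off by a function of the distance to `∂Ω` taken in local
normal coordinates; in a thin enough collar these distort lengths, and hence surface measure, by a
factor arbitrarily close to one.
-/

noncomputable section

namespace FokkerPlanck

section MeasureComparison

lemma euclideanHausdorffMeasure_image_le_mul_image {ι X Y : Type*} [EMetricSpace X]
    [MeasurableSpace X] [BorelSpace X] [EMetricSpace Y] [MeasurableSpace Y] [BorelSpace Y]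
    {f : ι → Y} {g : ι → X} {s : Set ι} {K : NNReal}
    (hfg : ∀ x ∈ s, ∀ y ∈ s, edist (f x) (f y) ≤ K * edist (g x) (g y)) (d : ℕ) :
    (μHE[d] : Measure Y) (f '' s) ≤ (K : ENNReal) ^ d * (μHE[d] : Measure X) (g '' s) := by
  rcases s.eq_empty_or_nonempty with rfl | ⟨x₀, -⟩
  · simp
  have : Nonempty ι := ⟨x₀⟩
  set k : X → ι := Function.invFunOn g s
  have hks : ∀ x ∈ s, k (g x) ∈ s := fun x hx => Function.invFunOn_mem ⟨x, hx, rfl⟩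
  have hgk : ∀ x ∈ s, g (k (g x)) = g x := fun x hx => Function.invFunOn_eq ⟨x, hx, rfl⟩
  have hfk : ∀ x ∈ s, f (k (g x)) = f x := fun x hx => by
    have h := hfg _ (hks x hx) x hx
    rwa [hgk x hx, edist_self, mul_zero, nonpos_iff_eq_zero, edist_eq_zero] at h
  have hlip : LipschitzOnWith K (f ∘ k) (g '' s) := by
    rintro _ ⟨x, hx, rfl⟩ _ ⟨y, hy, rfl⟩
    simpa only [Function.comp_apply, hfk x hx, hfk y hy] using hfg x hx y hy
  have himage : f ∘ k '' (g '' s) = f '' s := by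
    rw [image_image]
    exact image_congr hfk
  have h := hlip.hausdorffMeasure_image_le (d := (d : ℝ)) (Nat.cast_nonneg d)
  rw [himage, ENNReal.rpow_natCast] at h
  simp only [Measure.euclideanHausdorffMeasure_def, Measure.smul_apply, ENNReal.smul_def,
    smul_eq_mul]
  rw [mul_left_comm]
  gcongr

variable {X : Type*} [MeasurableSpace X] {α β : Measure X} {η : ℝ}

lemma integral_le_of_le_smul (hη : 0 ≤ η) (hαβ : α ≤ ENNReal.ofReal (1 + η) • β) {G : X → ℝ}
    (hG : Integrable G β) (h0 : ∀ x, 0 ≤ G x) : ∫ x, G x ∂α ≤ (1 + η) * ∫ x, G x ∂β := by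
  have h := integral_mono_measure hαβ (ae_of_all _ h0) (hG.smul_measure ENNReal.ofReal_ne_top)
  rwa [integral_smul_measure, ENNReal.toReal_ofReal (by linarith), smul_eq_mul] at h

lemma abs_integral_sub_integral_le_of_nonneg (hη : 0 ≤ η)
    (hαβ : α ≤ ENNReal.ofReal (1 + η) • β) (hβα : β ≤ ENNReal.ofReal (1 + η) • α) {G : X → ℝ}
    (hG : Integrable G β) (h0 : ∀ x, 0 ≤ G x) :
    |∫ x, G x ∂α - ∫ x, G x ∂β| ≤ η * ∫ x, G x ∂β := by
  have hGα : Integrable G α := (hG.smul_measure ENNReal.ofReal_ne_top).mono_measure hαβ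
  have hle := integral_le_of_le_smul hη hαβ hG h0
  have hge := integral_le_of_le_smul hη hβα hGα h0
  have hnn : 0 ≤ ∫ x, G x ∂β := integral_nonneg h0
  rw [abs_le]
  constructor <;> nlinarith [mul_nonneg (mul_nonneg hη hη) hnn]

lemma abs_integral_sub_integral_le (hη : 0 ≤ η) (hαβ : α ≤ ENNReal.ofReal (1 + η) • β)
    (hβα : β ≤ ENNReal.ofReal (1 + η) • α) {F : X → ℝ} (hF : Integrable F β) :
    |∫ x, F x ∂α - ∫ x, F x ∂β| ≤ η * ∫ x, |F x| ∂β := by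
  have hFα : Integrable F α := (hF.smul_measure ENNReal.ofReal_ne_top).mono_measure hαβ
  have hpos := abs_integral_sub_integral_le_of_nonneg hη hαβ hβα hF.pos_part
    fun _ => le_max_right _ _
  have hneg := abs_integral_sub_integral_le_of_nonneg hη hαβ hβα hF.neg_part
    fun _ => le_max_right _ _
  have hsplit {μ : Measure X} (hμ : Integrable F μ) :
      ∫ x, F x ∂μ = ∫ x, max (F x) 0 ∂μ - ∫ x, max (-F x) 0 ∂μ := by
    rw [← integral_sub hμ.pos_part hμ.neg_part]
    exact integral_congr_ae (ae_of_all _ fun x => (max_zero_sub_eq_self (F x)).symm)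
  have habs : ∫ x, |F x| ∂β = ∫ x, max (F x) 0 ∂β + ∫ x, max (-F x) 0 ∂β := by
    rw [← integral_add hF.pos_part hF.neg_part]
    exact integral_congr_ae
      (ae_of_all _ fun x => (max_zero_add_max_neg_zero_eq_abs_self (F x)).symm)
  rw [hsplit hFα, hsplit hF, habs]
  rw [abs_le] at hpos hneg ⊢
  constructor <;> linarith [hpos.1, hpos.2, hneg.1, hneg.2]

end MeasureComparison

section NormalCoordinates

variable {E : Type*} [NormedAddCommGroup E] [InnerProductSpace ℝ E] [CompleteSpace E]
  {ψ : E → ℝ} {x z₀ : E}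

/-- The normalized gradient `∇ψ / |∇ψ|`: the unit normal to the level sets of `ψ`, pointing out of
the sublevel sets. It is `0` at the critical points of `ψ`. -/
def unitGrad (ψ : E → ℝ) (x : E) : E := ‖∇ ψ x‖⁻¹ • ∇ ψ x

lemma norm_unitGrad (h : ∇ ψ x ≠ 0) : ‖unitGrad ψ x‖ = 1 := by
  rw [unitGrad, norm_smul, norm_inv, norm_norm, inv_mul_cancel₀ (norm_ne_zero_iff.2 h)]

lemma unitGrad_ne_zero (h : ∇ ψ x ≠ 0) : unitGrad ψ x ≠ 0 :=
  norm_ne_zero_iff.1 ((norm_unitGrad h).symm ▸ one_ne_zero)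

lemma inner_unitGrad_self (h : ∇ ψ x ≠ 0) : inner ℝ (unitGrad ψ x) (unitGrad ψ x) = 1 := by
  rw [real_inner_self_eq_norm_sq, norm_unitGrad h, one_pow]

lemma norm_smul_unitGrad (h : ∇ ψ x ≠ 0) : ‖∇ ψ x‖ • unitGrad ψ x = ∇ ψ x := by
  rw [unitGrad, smul_smul, mul_inv_cancel₀ (norm_ne_zero_iff.2 h), one_smul]

lemma inner_gradient_unitGrad (h : ∇ ψ x ≠ 0) : inner ℝ (∇ ψ x) (unitGrad ψ x) = ‖∇ ψ x‖ := by
  nth_rw 1 [← norm_smul_unitGrad h]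
  rw [inner_smul_left, inner_unitGrad_self h, mul_one]
  rfl

lemma contDiffAt_gradient {m k : WithTop ℕ∞} (h : ContDiffAt ℝ k ψ x) (hmk : m + 1 ≤ k) :
    ContDiffAt ℝ m (∇ ψ) x :=
  (InnerProductSpace.toDual ℝ E).symm.contDiff.contDiffAt.comp x (h.fderiv_right hmk)

lemma contDiffAt_unitGrad {m k : WithTop ℕ∞} (h : ContDiffAt ℝ k ψ x) (hmk : m + 1 ≤ k)
    (h0 : ∇ ψ x ≠ 0) : ContDiffAt ℝ m (unitGrad ψ) x :=
  have hg := contDiffAt_gradient h hmk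
  ((hg.norm ℝ h0).inv (norm_ne_zero_iff.2 h0)).smul hg

lemma exists_implicitFunction_hasFDerivAt_zero {X Y F : Type*} [NormedAddCommGroup X]
    [NormedSpace ℝ X] [CompleteSpace X] [NormedAddCommGroup Y] [NormedSpace ℝ Y] [CompleteSpace Y]
    [NormedAddCommGroup F] [NormedSpace ℝ F] [CompleteSpace F] {k : WithTop ℕ∞} (hk : k ≠ 0)
    {f : X × Y → F} (hf : ContDiffAt ℝ k f 0) (hinl : fderiv ℝ f 0 ∘L .inl ℝ X Y = 0)
    (hinr : (fderiv ℝ f 0 ∘L .inr ℝ X Y).IsInvertible) :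
    ∃ s : X → Y, ContDiffAt ℝ k s 0 ∧ s 0 = 0 ∧ HasFDerivAt s (0 : X →L[ℝ] Y) 0 ∧
      ∀ᶠ y in 𝓝 0, f (y, s y) = f 0 := by
  refine ⟨hf.implicitFunction hk hinr, hf.contDiffAt_implicitFunction hk hinr,
    hf.implicitFunction_apply_self hk hinr, ?_, hf.eventually_apply_implicitFunction hk hinr⟩
  have hderiv := (hf.hasStrictFDerivAt_implicitFunction hk hinr).hasFDerivAt
  rwa [hinl, ContinuousLinearMap.comp_zero, neg_zero] at hderiv

lemma exists_levelSet_parametrization {k : WithTop ℕ∞} (hk : k ≠ 0) (hψ : ContDiffAt ℝ k ψ z₀)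
    (h0 : ∇ ψ z₀ ≠ 0) :
    ∃ γ : (ℝ ∙ unitGrad ψ z₀)ᗮ → E, ContDiffAt ℝ k γ 0 ∧ γ 0 = z₀ ∧
      HasFDerivAt γ (ℝ ∙ unitGrad ψ z₀)ᗮ.subtypeL 0 ∧ ∀ᶠ y in 𝓝 0, ψ (γ y) = ψ z₀ := by
  set e := unitGrad ψ z₀
  set T : Submodule ℝ E := (ℝ ∙ e)ᗮ
  let A : T × ℝ →L[ℝ] E := T.subtypeL.coprod (.toSpanSingleton ℝ e)
  have hA : ∀ p, A p = p.1 + p.2 • e := fun p => by simp [A]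
  let f : T × ℝ → ℝ := fun p => ψ (z₀ + A p)
  have hz : z₀ + A 0 = z₀ := by simp
  have hf : ContDiffAt ℝ k f 0 := by
    refine ContDiffAt.comp (g := ψ) 0 ?_ (by fun_prop)
    rwa [hz]
  have hf' : HasFDerivAt f (innerSL ℝ (∇ ψ z₀) ∘L A) 0 := by
    have hψ' : HasFDerivAt ψ (innerSL ℝ (∇ ψ z₀)) (z₀ + A 0) := by
      rw [hz]
      exact (hψ.differentiableAt hk).hasGradientAt.hasFDerivAt
    exact hψ'.comp 0 (A.hasFDerivAt.const_add z₀)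
  have hinr : fderiv ℝ f 0 ∘L .inr ℝ T ℝ = ‖∇ ψ z₀‖ • ContinuousLinearMap.id ℝ ℝ := by
    ext
    simp [hf'.fderiv, hA, e, inner_gradient_unitGrad h0, -inner_gradient_left]
  have hinl : fderiv ℝ f 0 ∘L .inl ℝ T ℝ = 0 := by
    ext y
    have hy : inner ℝ e (y : E) = 0 :=
      Submodule.mem_orthogonal_singleton_iff_inner_right.1 y.2
    simp only [hf'.fderiv, ContinuousLinearMap.comp_apply, ContinuousLinearMap.inl_apply, hA,
      zero_smul, add_zero, innerSL_apply_apply, zero_apply]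
    rw [← norm_smul_unitGrad h0, inner_smul_left, hy, mul_zero]
  have hinv : (fderiv ℝ f 0 ∘L .inr ℝ T ℝ).IsInvertible := by
    rw [hinr]
    exact ⟨ContinuousLinearEquiv.smulLeft (Units.mk0 _ (norm_ne_zero_iff.2 h0)), by ext; simp⟩
  obtain ⟨s, hsk, hs0, hs', hs⟩ :=
    exists_implicitFunction_hasFDerivAt_zero hk hf hinl hinv
  refine ⟨fun y => z₀ + A (y, s y), ?_, by simp [hA, hs0], ?_, ?_⟩
  · exact contDiffAt_const.add (A.contDiff.contDiffAt.comp 0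
      (contDiffAt_id.prodMk hsk))
  · have hgraph : HasFDerivAt (fun y => (y, s y)) ((ContinuousLinearMap.id ℝ T).prod 0) 0 :=
      HasFDerivAt.prodMk (hasFDerivAt_id 0) hs'
    refine ((HasFDerivAt.comp (g := A) 0 A.hasFDerivAt hgraph).const_add z₀).congr_fderiv ?_
    ext y
    simp [hA]
  · simpa only [f, hz] using hs

lemma eventually_sub_smul_unitGrad_lt_iff (hψ : ContDiffAt ℝ 2 ψ z₀) (h0 : ∇ ψ z₀ ≠ 0) :
    ∀ᶠ p in 𝓝 (z₀, (0 : ℝ)), ψ (p.1 - p.2 • unitGrad ψ p.1) < ψ p.1 ↔ 0 < p.2 := by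
  have hn : 0 < ‖∇ ψ z₀‖ := norm_pos_iff.2 h0
  have hu : ContinuousAt (unitGrad ψ) z₀ := (contDiffAt_unitGrad (m := 1) hψ le_rfl h0).continuousAt
  have hfst : Tendsto Prod.fst (𝓝 (z₀, (0 : ℝ))) (𝓝 z₀) := continuousAt_fst
  have hstrict : HasStrictFDerivAt ψ (innerSL ℝ (∇ ψ z₀)) z₀ :=
    hψ.hasStrictFDerivAt' (hψ.differentiableAt two_ne_zero).hasGradientAt.hasFDerivAt two_ne_zero
  have hshift : Tendsto (fun p : E × ℝ => (p.1 - p.2 • unitGrad ψ p.1, p.1)) (𝓝 (z₀, 0))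
      (𝓝 (z₀, z₀)) := by
    refine Tendsto.prodMk_nhds ?_ hfst
    simpa using hfst.sub (continuousAt_snd.tendsto.smul (hu.tendsto.comp hfst))
  have hslope : ∀ᶠ p in 𝓝 (z₀, (0 : ℝ)), ‖∇ ψ z₀‖ / 2 < inner ℝ (∇ ψ z₀) (unitGrad ψ p.1) := by
    refine (tendsto_const_nhds.inner (hu.tendsto.comp hfst)).eventually_const_lt ?_
    rw [inner_gradient_unitGrad h0]
    exact half_lt_self hn
  filter_upwards [hshift.eventually (hstrict.isLittleO.def (by positivity : 0 < ‖∇ ψ z₀‖ / 4)),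
    hslope, hfst.eventually
      ((contDiffAt_gradient (m := 1) hψ le_rfl).continuousAt.eventually_ne h0)]
    with ⟨x, t⟩ happrox hslope hx
  rw [sub_sub_cancel_left, norm_neg, norm_smul, norm_unitGrad hx, mul_one, innerSL_apply_apply,
    inner_neg_right, inner_smul_right, sub_neg_eq_add, Real.norm_eq_abs, Real.norm_eq_abs,
    abs_le] at happrox
  rcases le_or_gt t 0 with ht | ht
  · rw [abs_of_nonpos ht] at happrox
    exact ⟨fun h => by nlinarith [happrox.1], fun h => absurd h ht.not_gt⟩
  · rw [abs_of_pos ht] at happrox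
    exact ⟨fun _ => ht, fun _ => by nlinarith [happrox.2]⟩

variable {F : Type*} [NormedAddCommGroup F] [NormedSpace ℝ F] {γ : F → E} {y : F} {t : ℝ}

/-- The normal coordinates `(y, t) ↦ γ(y) - t n(γ(y))`, `n = ∇ψ / |∇ψ|`, along a parametrization
`γ` of a level set of `ψ`; positive `t` lie on the side where `ψ` is smaller. -/
def normalMap (ψ : E → ℝ) (γ : F → E) (p : F × ℝ) : E := γ p.1 - p.2 • unitGrad ψ (γ p.1)

lemma contDiffAt_normalMap (hγ : ContDiffAt ℝ 1 γ y) (hψ : ContDiffAt ℝ 2 ψ (γ y))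
    (h0 : ∇ ψ (γ y) ≠ 0) : ContDiffAt ℝ 1 (normalMap ψ γ) (y, t) := by
  have hN : ContDiffAt ℝ 1 (fun y => unitGrad ψ (γ y)) y :=
    (contDiffAt_unitGrad hψ le_rfl h0).comp y hγ
  exact hγ.fst'.sub (contDiffAt_snd.smul hN.fst')

lemma hasFDerivAt_normalMap {γ' M' : F →L[ℝ] E} (hγ : HasFDerivAt γ γ' y)
    (hM : HasFDerivAt (fun y => unitGrad ψ (γ y)) M' y) :
    HasFDerivAt (normalMap ψ γ) ((γ' - t • M').coprod (.toSpanSingleton ℝ (-unitGrad ψ (γ y))))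
      (y, t) := by
  have hfst : HasFDerivAt Prod.fst (.fst ℝ F ℝ) (y, t) := hasFDerivAt_fst
  refine ((HasFDerivAt.comp (y, t) hγ hfst).sub
    (hasFDerivAt_snd.smul (HasFDerivAt.comp (y, t) hM hfst))).congr_fderiv ?_
  ext <;> simp [sub_eq_add_neg]

lemma inner_unitGrad_fderiv_eq_zero {γ' : F →L[ℝ] E} (hψ : DifferentiableAt ℝ ψ (γ y))
    (hγ : HasFDerivAt γ γ' y) {c : ℝ} (hconst : ∀ᶠ y' in 𝓝 y, ψ (γ y') = c) (v : F) :
    inner ℝ (unitGrad ψ (γ y)) (γ' v) = 0 := by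
  have hcomp : HasFDerivAt (ψ ∘ γ) (innerSL ℝ (∇ ψ (γ y)) ∘L γ') y :=
    hψ.hasGradientAt.hasFDerivAt.comp y hγ
  have hzero := hcomp.unique ((hasFDerivAt_const c y).congr_of_eventuallyEq hconst)
  have hv : inner ℝ (∇ ψ (γ y)) (γ' v) = 0 := by
    simpa [-inner_gradient_left] using congrArg (· v) hzero
  rw [unitGrad, inner_smul_left, hv, mul_zero]

omit [CompleteSpace E] in
lemma inner_fderiv_eq_zero_of_norm_eq_one {u : F → E} {u' : F →L[ℝ] E} (hu : HasFDerivAt u u' y)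
    (hnorm : ∀ᶠ y' in 𝓝 y, ‖u y'‖ = 1) (v : F) : inner ℝ (u y) (u' v) = 0 := by
  have hone : (fun y' => inner ℝ (u y') (u y')) =ᶠ[𝓝 y] fun _ => (1 : ℝ) := by
    filter_upwards [hnorm] with y' hy'
    rw [real_inner_self_eq_norm_sq, hy', one_pow]
  have hzero := (hu.inner ℝ hu).unique ((hasFDerivAt_const (1 : ℝ) y).congr_of_eventuallyEq hone)
  simpa [real_inner_comm] using congrArg (· v) hzero

lemma hasGradientAt_snd_symm_normalMap {Ψ : OpenPartialHomeomorph (F × ℝ) E}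
    (hΨ : ∀ p ∈ Ψ.source, Ψ p = normalMap ψ γ p) (hp : (y, t) ∈ Ψ.source)
    (hsymm : ContDiffAt ℝ 1 Ψ.symm (Ψ (y, t))) (hγ : ContDiffAt ℝ 1 γ y)
    (hψ : ContDiffAt ℝ 2 ψ (γ y)) (h0 : ∇ ψ (γ y) ≠ 0) {c : ℝ}
    (hconst : ∀ᶠ y' in 𝓝 y, ψ (γ y') = c) :
    HasGradientAt (fun x => (Ψ.symm x).2) (-unitGrad ψ (γ y)) (Ψ (y, t)) := by
  set N := unitGrad ψ (γ y)
  have hγ' := (hγ.differentiableAt one_ne_zero).hasFDerivAt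
  have hN' := (((contDiffAt_unitGrad hψ le_rfl h0).comp y hγ).differentiableAt
    one_ne_zero).hasFDerivAt
  have hunit : ∀ᶠ y' in 𝓝 y, ‖unitGrad ψ (γ y')‖ = 1 :=
    (hγ.continuousAt.eventually
      ((contDiffAt_gradient (m := 1) hψ le_rfl).continuousAt.eventually_ne h0)).mono
      fun _ => norm_unitGrad
  have hnormal : ∀ v, inner ℝ N (fderiv ℝ Ψ (y, t) v) = -v.2 := fun v => by
    have hΨ' := (hasFDerivAt_normalMap (t := t) hγ' hN').congr_of_eventuallyEq
      (eventually_of_mem (Ψ.open_source.mem_nhds hp) hΨ)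
    have htangent := inner_unitGrad_fderiv_eq_zero (hψ.differentiableAt two_ne_zero) hγ' hconst v.1
    have hcurvature := inner_fderiv_eq_zero_of_norm_eq_one hN' hunit v.1
    simp only [Function.comp_apply] at hcurvature
    rw [hΨ'.fderiv]
    simp [inner_add_right, inner_sub_right, inner_smul_right, N, htangent, hcurvature,
      norm_unitGrad h0]
  have hS := (hsymm.differentiableAt one_ne_zero).hasFDerivAt
  have hΨd : HasFDerivAt Ψ (fderiv ℝ Ψ (y, t)) (Ψ.symm (Ψ (y, t))) := by
    rw [Ψ.left_inv hp]
    exact ((hasFDerivAt_normalMap hγ' hN').congr_of_eventuallyEq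
      (eventually_of_mem (Ψ.open_source.mem_nhds hp) hΨ)).differentiableAt.hasFDerivAt
  have hid := (hΨd.comp _ hS).unique ((hasFDerivAt_id _).congr_of_eventuallyEq
    (eventually_of_mem (Ψ.open_target.mem_nhds (Ψ.map_source hp)) fun x hx => Ψ.right_inv hx))
  rw [hasGradientAt_iff_hasFDerivAt]
  refine (hasFDerivAt_snd.comp _ hS).congr_fderiv ?_
  ext v
  have hv := hnormal (fderiv ℝ Ψ.symm (Ψ (y, t)) v)
  rw [← ContinuousLinearMap.comp_apply, hid] at hv
  simpa [neg_eq_iff_eq_neg, eq_comm] using hv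

end NormalCoordinates

section Hyperplane

variable {E : Type*} [NormedAddCommGroup E] [InnerProductSpace ℝ E] {e : E}

/-- The splitting `(y, t) ↦ y - t e` of a Euclidean space along the unit vector `e`; the sign is
that of `normalMap`, of which it is the derivative when `e` is the normal. -/
def hyperplaneIsometry (he : ‖e‖ = 1) : WithLp 2 ((ℝ ∙ e)ᗮ × ℝ) →ₗᵢ[ℝ] E where
  toFun p := (p.fst : E) - p.snd • e
  map_add' p q := by simp [add_smul]; abel
  map_smul' a p := by simp [mul_smul, smul_sub]
  norm_map' p := by
    have hperp : inner ℝ (p.fst : E) (p.snd • e) = 0 := by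
      rw [inner_smul_right, Submodule.mem_orthogonal_singleton_iff_inner_left.1 p.fst.2, mul_zero]
    have hsq : ‖(p.fst : E) - p.snd • e‖ ^ 2 = ‖p‖ ^ 2 := by
      rw [WithLp.prod_norm_sq_eq_of_L2, norm_sub_sq_real, hperp, norm_smul, he]
      simp
    exact (sq_eq_sq₀ (norm_nonneg _) (norm_nonneg _)).1 hsq

lemma hyperplaneIsometry_surjective (he : ‖e‖ = 1) :
    Function.Surjective (hyperplaneIsometry he) := fun x => by
  have hee : inner ℝ e e = 1 := by rw [real_inner_self_eq_norm_sq, he, one_pow]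
  have hperp : x - inner ℝ e x • e ∈ (ℝ ∙ e)ᗮ := by
    rw [Submodule.mem_orthogonal_singleton_iff_inner_right, inner_sub_right, inner_smul_right, hee,
      mul_one, sub_self]
  refine ⟨WithLp.toLp 2 (⟨_, hperp⟩, -inner ℝ e x), ?_⟩
  change (x - inner ℝ e x • e) - (-inner ℝ e x) • e = x
  rw [neg_smul, sub_neg_eq_add, sub_add_cancel]

/-- `hyperplaneIsometry` as an isomorphism from the product with the sup norm, which is the
parameter space of the charts below. -/
def hyperplaneEquiv (he : ‖e‖ = 1) : ((ℝ ∙ e)ᗮ × ℝ) ≃L[ℝ] E :=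
  (WithLp.prodContinuousLinearEquiv 2 ℝ (ℝ ∙ e)ᗮ ℝ).symm.trans
    (LinearIsometryEquiv.ofSurjective _ (hyperplaneIsometry_surjective he)).toContinuousLinearEquiv

lemma hyperplaneEquiv_apply (he : ‖e‖ = 1) (p : (ℝ ∙ e)ᗮ × ℝ) :
    hyperplaneEquiv he p = p.1 - p.2 • e := rfl

lemma norm_le_norm_hyperplaneEquiv (he : ‖e‖ = 1) (p : (ℝ ∙ e)ᗮ × ℝ) :
    ‖p‖ ≤ ‖hyperplaneEquiv he p‖ := by
  have hnorm : ‖hyperplaneEquiv he p‖ = ‖WithLp.toLp 2 p‖ :=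
    (hyperplaneIsometry he).norm_map (WithLp.toLp 2 p)
  rw [hnorm, Prod.norm_def]
  exact max_le (WithLp.norm_fst_le _ (WithLp.toLp 2 p)) (WithLp.norm_snd_le _ (WithLp.toLp 2 p))

lemma volume_image_hyperplaneEquiv [FiniteDimensional ℝ E] [MeasurableSpace E] [BorelSpace E]
    (he : ‖e‖ = 1) (s : Set ((ℝ ∙ e)ᗮ × ℝ)) : volume (hyperplaneEquiv he '' s) = volume s := by
  let L := LinearIsometryEquiv.ofSurjective _ (hyperplaneIsometry_surjective he)
  let M : ((ℝ ∙ e)ᗮ × ℝ) ≃ᵐ E :=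
    (MeasurableEquiv.toLp 2 _).trans L.toHomeomorph.toMeasurableEquiv
  have hM : MeasurePreserving M volume volume :=
    (WithLp.volume_preserving_toLp _ _).trans L.measurePreserving
  change volume (M '' s) = volume s
  rw [← hM.measure_preimage_equiv, M.injective.preimage_image]

lemma finrank_orthogonal_singleton [FiniteDimensional ℝ E] (he : e ≠ 0) :
    Module.finrank ℝ (ℝ ∙ e)ᗮ = Module.finrank ℝ E - 1 := by
  rw [← (ℝ ∙ e).finrank_add_finrank_orthogonal, finrank_span_singleton he,
    Nat.add_sub_cancel_left]

lemma euclideanHausdorffMeasure_orthogonal_singleton [FiniteDimensional ℝ E] [MeasurableSpace E]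
    [BorelSpace E] (he : e ≠ 0) :
    (μHE[Module.finrank ℝ E - 1] : Measure (ℝ ∙ e)ᗮ) = volume := by
  rw [← finrank_orthogonal_singleton he]
  exact InnerProductSpace.euclideanHausdorffMeasure_eq_volume

end Hyperplane

section Frontier

variable {X : Type*} [TopologicalSpace X] {Ω : Set X}

lemma eq_zero_of_mem_frontier {ψ : X → ℝ} {z₀ : X} (hψ : ContinuousAt ψ z₀)
    (hΩ : ∀ᶠ z in 𝓝 z₀, z ∈ Ω ↔ ψ z < 0) (hz₀ : z₀ ∈ frontier Ω) : ψ z₀ = 0 := by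
  rcases lt_trichotomy (ψ z₀) 0 with hneg | hzero | hpos
  · refine absurd (mem_interior_iff_mem_nhds.2 ?_) hz₀.2
    filter_upwards [hψ.eventually_lt_const hneg, hΩ] with z hz hmem using hmem.2 hz
  · exact hzero
  · obtain ⟨z, hzΩ, hz, hmem⟩ := ((mem_closure_iff_frequently.1 hz₀.1).and_eventually
      ((hψ.eventually_const_lt hpos).and hΩ)).exists
    exact absurd (hmem.1 hzΩ) hz.not_gt

lemma mem_frontier_iff_snd_eq_zero {F : Type*} [TopologicalSpace F]
    {Ψ : OpenPartialHomeomorph (F × ℝ) X} (hΨ : ∀ p ∈ Ψ.source, Ψ p ∈ Ω ↔ 0 < p.2)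
    {p : F × ℝ} (hp : p ∈ Ψ.source) : Ψ p ∈ frontier Ω ↔ p.2 = 0 := by
  have himage : Ψ.IsImage (Prod.snd ⁻¹' Ioi 0) Ω := fun p hp => hΨ p hp
  rw [himage.frontier hp, ← isOpenMap_snd.preimage_frontier_eq_frontier_preimage continuous_snd,
    frontier_Ioi]
  rfl

end Frontier

section NormalChart

variable {E : Type*} [NormedAddCommGroup E] [InnerProductSpace ℝ E] [CompleteSpace E]
  {ψ : E → ℝ} {z₀ : E} {U : Set E} {c : NNReal}

/-- Normal coordinates near the point `z₀` of a level set of `ψ`, on a box with image in `U`, which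
differ by at most the factor `c` from the splitting of the space along the normal at `z₀`. -/
structure NormalChart (ψ : E → ℝ) (z₀ : E) (h0 : ∇ ψ z₀ ≠ 0) (U : Set E) (c : NNReal) where
  γ : (ℝ ∙ unitGrad ψ z₀)ᗮ → E
  Ψ : OpenPartialHomeomorph ((ℝ ∙ unitGrad ψ z₀)ᗮ × ℝ) E
  r : ℝ
  r_pos : 0 < r
  source_eq : Ψ.source = Metric.ball 0 r ×ˢ Ioo (-r) r
  apply_eq : ∀ p ∈ Ψ.source, Ψ p = normalMap ψ γ p
  γ_zero : γ 0 = z₀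
  contDiffAt_γ : ∀ p ∈ Ψ.source, ContDiffAt ℝ 1 γ p.1
  γ_mem : ∀ p ∈ Ψ.source, γ p.1 ∈ U
  apply_γ : ∀ p ∈ Ψ.source, ψ (γ p.1) = ψ z₀
  mem : ∀ p ∈ Ψ.source, Ψ p ∈ U
  lt_iff : ∀ p ∈ Ψ.source, ψ (Ψ p) < ψ z₀ ↔ 0 < p.2
  contDiffAt_symm : ∀ p ∈ Ψ.source, ContDiffAt ℝ 1 Ψ.symm (Ψ p)
  approximatesLinearOn : ApproximatesLinearOn Ψ
    (hyperplaneEquiv (norm_unitGrad h0) : _ →L[ℝ] E) Ψ.source c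

lemma exists_box_subset {F : Type*} [SeminormedAddCommGroup F] {s : Set (F × ℝ)} (hs : s ∈ 𝓝 0)
    {δ : ℝ} (hδ : 0 < δ) : ∃ r, 0 < r ∧ r ≤ δ ∧ Metric.ball 0 r ×ˢ Ioo (-r) r ⊆ s := by
  obtain ⟨ρ, hρ, hball⟩ := Metric.mem_nhds_iff.1 hs
  refine ⟨min ρ δ, lt_min hρ hδ, min_le_right _ _, ?_⟩
  rw [← Real.ball_zero_eq_Ioo, ball_prod_same]
  exact (Metric.ball_subset_ball (min_le_left _ _)).trans hball

lemma hasFDerivAt_normalMap_zero (h0 : ∇ ψ z₀ ≠ 0) {γ : (ℝ ∙ unitGrad ψ z₀)ᗮ → E}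
    (hψ : ContDiffAt ℝ 2 ψ z₀) (hγ : HasFDerivAt γ (ℝ ∙ unitGrad ψ z₀)ᗮ.subtypeL 0)
    (hγ0 : γ 0 = z₀) :
    HasFDerivAt (normalMap ψ γ) (hyperplaneEquiv (norm_unitGrad h0) : _ →L[ℝ] E) 0 := by
  have hN : DifferentiableAt ℝ (fun y => unitGrad ψ (γ y)) 0 := by
    refine DifferentiableAt.comp (g := unitGrad ψ) 0 ?_ hγ.differentiableAt
    rw [hγ0]
    exact (contDiffAt_unitGrad (m := 1) hψ le_rfl h0).differentiableAt one_ne_zero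
  refine (hasFDerivAt_normalMap (t := 0) hγ hN.hasFDerivAt).congr_fderiv ?_
  ext <;> simp [hyperplaneEquiv_apply, hγ0]

lemma exists_normal_openPartialHomeomorph (hψ : ContDiffAt ℝ 2 ψ z₀) (h0 : ∇ ψ z₀ ≠ 0) :
    ∃ (γ : (ℝ ∙ unitGrad ψ z₀)ᗮ → E)
      (Ψ : OpenPartialHomeomorph ((ℝ ∙ unitGrad ψ z₀)ᗮ × ℝ) E),
      ContDiffAt ℝ 1 γ 0 ∧ γ 0 = z₀ ∧ (∀ᶠ y in 𝓝 0, ψ (γ y) = ψ z₀) ∧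
      (∀ p, Ψ p = normalMap ψ γ p) ∧ 0 ∈ Ψ.source ∧ Ψ 0 = z₀ ∧
      HasStrictFDerivAt Ψ (hyperplaneEquiv (norm_unitGrad h0) : _ →L[ℝ] E) 0 ∧
      ContDiffAt ℝ 1 Ψ.symm z₀ := by
  obtain ⟨γ, hγ, hγ0, hγ', hlevel⟩ := exists_levelSet_parametrization two_ne_zero hψ h0
  have hγ1 : ContDiffAt ℝ 1 γ 0 := hγ.of_le one_le_two
  have hΦ : ContDiffAt ℝ 1 (normalMap ψ γ) 0 :=
    contDiffAt_normalMap hγ1 (by rwa [hγ0]) (by rwa [hγ0])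
  have hΦ' := hasFDerivAt_normalMap_zero h0 hψ hγ' hγ0
  have hΦ0 : normalMap ψ γ 0 = z₀ := by simp [normalMap, hγ0]
  have hsymm := hΦ.to_localInverse hΦ' one_ne_zero
  rw [hΦ0] at hsymm
  exact ⟨γ, hΦ.toOpenPartialHomeomorph _ hΦ' one_ne_zero, hγ1, hγ0, hlevel, fun _ => rfl,
    hΦ.mem_toOpenPartialHomeomorph_source hΦ' one_ne_zero, hΦ0,
    hΦ.hasStrictFDerivAt' hΦ' one_ne_zero, hsymm⟩

theorem exists_normalChart (hψ : ContDiffAt ℝ 2 ψ z₀) (h0 : ∇ ψ z₀ ≠ 0) (hU : U ∈ 𝓝 z₀)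
    (hc : 0 < c) {δ : ℝ} (hδ : 0 < δ) : ∃ C : NormalChart ψ z₀ h0 U c, C.r ≤ δ := by
  obtain ⟨γ, Ψ, hγ, hγ0, hlevel, hΨ, hmem, hΨ0, hΨ', hsymm⟩ :=
    exists_normal_openPartialHomeomorph hψ h0
  have hfst : Tendsto Prod.fst (𝓝 (0 : (ℝ ∙ unitGrad ψ z₀)ᗮ × ℝ)) (𝓝 0) := continuousAt_fst
  have hγt : Tendsto (fun p : (ℝ ∙ unitGrad ψ z₀)ᗮ × ℝ => γ p.1) (𝓝 0) (𝓝 z₀) := by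
    simpa only [hγ0, Function.comp_def] using hγ.continuousAt.tendsto.comp hfst
  have hΨt : Tendsto Ψ (𝓝 0) (𝓝 z₀) := by simpa only [hΨ0] using (Ψ.continuousAt hmem).tendsto
  have hside : ∀ᶠ p in 𝓝 (0 : (ℝ ∙ unitGrad ψ z₀)ᗮ × ℝ), ψ (Ψ p) < ψ (γ p.1) ↔ 0 < p.2 := by
    simpa only [hΨ, normalMap] using
      (hγt.prodMk_nhds continuousAt_snd).eventually (eventually_sub_smul_unitGrad_lt_iff hψ h0)
  obtain ⟨s, hs, happrox⟩ := hΨ'.approximates_deriv_on_nhds (.inr hc)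
  have hall : ∀ᶠ p in 𝓝 0, p ∈ Ψ.source ∧ p ∈ s ∧ ContDiffAt ℝ 1 γ p.1 ∧ γ p.1 ∈ U ∧
      ψ (γ p.1) = ψ z₀ ∧ Ψ p ∈ U ∧ ContDiffAt ℝ 1 Ψ.symm (Ψ p) ∧
      (ψ (Ψ p) < ψ (γ p.1) ↔ 0 < p.2) := by
    filter_upwards [Ψ.open_source.eventually_mem hmem, hs,
      hfst.eventually (hγ.eventually (by simp)), hγt.eventually hU, hfst.eventually hlevel,
      hΨt.eventually hU, hΨt.eventually (hsymm.eventually (by simp)), hside]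
      with p h₁ h₂ h₃ h₄ h₅ h₆ h₇ h₈ using ⟨h₁, h₂, h₃, h₄, h₅, h₆, h₇, h₈⟩
  obtain ⟨r, hr, hrδ, hbox⟩ := exists_box_subset hall hδ
  let Ψ' := Ψ.restrOpen (Metric.ball 0 r ×ˢ Ioo (-r) r) (Metric.isOpen_ball.prod isOpen_Ioo)
  have hsrc : Ψ'.source = Metric.ball 0 r ×ˢ Ioo (-r) r :=
    inter_eq_right.2 fun p hp => (hbox hp).1
  choose _ hs hγ hγU hγψ hU hsymm hside using fun p (hp : p ∈ Ψ'.source) => hbox hp.2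
  exact ⟨⟨γ, Ψ', r, hr, hsrc, fun p _ => hΨ p, hγ0, hγ, hγU, hγψ, hU,
    fun p hp => hγψ p hp ▸ hside p hp, hsymm, happrox.mono_set hs⟩, hrδ⟩

lemma edist_le_mul_edist_of_approximatesLinearOn {F G : Type*} [NormedAddCommGroup F]
    [NormedSpace ℝ F] [NormedAddCommGroup G] [NormedSpace ℝ G] {f : F → G} {L : F →L[ℝ] G}
    {s : Set F} {c K : NNReal} (hf : ApproximatesLinearOn f L s c) (hL : ∀ v, ‖v‖ ≤ ‖L v‖)
    (hK : 1 ≤ (K : ℝ) * (1 - c)) {x y : F} (hx : x ∈ s) (hy : y ∈ s) :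
    edist (f x) (f y) ≤ K * edist (L x) (L y) ∧ edist (L x) (L y) ≤ K * edist (f x) (f y) := by
  have hc : (c : ℝ) < 1 := by
    by_contra! hc
    nlinarith [K.coe_nonneg]
  have hcK : (1 : ℝ) + c ≤ K := by nlinarith [hK, hc, sq_nonneg (c : ℝ)]
  have hfL : ‖f x - f y - (L x - L y)‖ ≤ c * ‖L x - L y‖ := by
    rw [← map_sub]
    exact (hf x hx y hy).trans (by gcongr; exact hL _)
  have hupper : dist (f x) (f y) ≤ K * dist (L x) (L y) := by
    rw [dist_eq_norm, dist_eq_norm]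
    nlinarith [norm_sub_norm_le (f x - f y) (L x - L y), norm_nonneg (L x - L y)]
  have hlower : dist (L x) (L y) ≤ K * dist (f x) (f y) := by
    rw [dist_eq_norm, dist_eq_norm]
    have hrev := norm_sub_norm_le (L x - L y) (f x - f y)
    rw [norm_sub_rev (L x - L y)] at hrev
    calc ‖L x - L y‖ ≤ K * (1 - c) * ‖L x - L y‖ := le_mul_of_one_le_left (norm_nonneg _) hK
      _ = K * ((1 - c) * ‖L x - L y‖) := mul_assoc _ _ _
      _ ≤ K * ‖f x - f y‖ := by gcongr; linarith
  simp only [edist_nndist]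
  exact ⟨mod_cast hupper, mod_cast hlower⟩

namespace NormalChart

variable {h0 : ∇ ψ z₀ ≠ 0} (C : NormalChart ψ z₀ h0 U c)

lemma mk_zero_mem {p : (ℝ ∙ unitGrad ψ z₀)ᗮ × ℝ} (hp : p ∈ C.Ψ.source) :
    (p.1, (0 : ℝ)) ∈ C.Ψ.source := by
  rw [C.source_eq] at hp ⊢
  exact ⟨hp.1, by simp [C.r_pos]⟩

lemma apply_mk_zero {p : (ℝ ∙ unitGrad ψ z₀)ᗮ × ℝ} (hp : p ∈ C.Ψ.source) :
    C.Ψ (p.1, 0) = C.γ p.1 := by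
  rw [C.apply_eq _ (C.mk_zero_mem hp), normalMap, zero_smul, sub_zero]

lemma map_zero : C.Ψ 0 = z₀ := by
  have h0mem : (0 : (ℝ ∙ unitGrad ψ z₀)ᗮ × ℝ) ∈ C.Ψ.source := by
    simp [C.source_eq, C.r_pos]
  exact (C.apply_mk_zero h0mem).trans C.γ_zero

lemma contDiffOn_symm : ContDiffOn ℝ 1 C.Ψ.symm C.Ψ.target := fun z hz => by
  have hsymm := C.contDiffAt_symm _ (C.Ψ.map_target hz)
  rw [C.Ψ.right_inv hz] at hsymm
  exact hsymm.contDiffWithinAt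

lemma hasGradientAt_snd_symm (hU : ∀ z ∈ U, ContDiffAt ℝ 2 ψ z ∧ ∇ ψ z ≠ 0)
    {p : (ℝ ∙ unitGrad ψ z₀)ᗮ × ℝ} (hp : p ∈ C.Ψ.source) :
    HasGradientAt (fun x => (C.Ψ.symm x).2) (-unitGrad ψ (C.γ p.1)) (C.Ψ p) := by
  have hsource : ∀ᶠ y in 𝓝 p.1, (y, p.2) ∈ C.Ψ.source :=
    (show Continuous fun y => (y, p.2) by fun_prop).continuousAt.eventually_mem
      (C.Ψ.open_source.mem_nhds hp)
  exact hasGradientAt_snd_symm_normalMap C.apply_eq hp (C.contDiffAt_symm p hp)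
    (C.contDiffAt_γ p hp) (hU _ (C.γ_mem p hp)).1 (hU _ (C.γ_mem p hp)).2
    (hsource.mono fun y hy => C.apply_γ _ hy)

variable {K : NNReal}

lemma edist_le (hK : 1 ≤ (K : ℝ) * (1 - c)) {p q : (ℝ ∙ unitGrad ψ z₀)ᗮ × ℝ}
    (hp : p ∈ C.Ψ.source) (hq : q ∈ C.Ψ.source) :
    edist (C.Ψ p) (C.Ψ q) ≤ K * edist (hyperplaneEquiv (norm_unitGrad h0) p)
        (hyperplaneEquiv (norm_unitGrad h0) q) ∧
      edist (hyperplaneEquiv (norm_unitGrad h0) p) (hyperplaneEquiv (norm_unitGrad h0) q)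
        ≤ K * edist (C.Ψ p) (C.Ψ q) :=
  edist_le_mul_edist_of_approximatesLinearOn C.approximatesLinearOn
    (norm_le_norm_hyperplaneEquiv _) hK hp hq

lemma edist_apply_mk_zero_le (hK : 1 ≤ (K : ℝ) * (1 - c)) {y y' : (ℝ ∙ unitGrad ψ z₀)ᗮ}
    (hy : y ∈ Metric.ball 0 C.r) (hy' : y' ∈ Metric.ball 0 C.r) :
    edist (C.Ψ (y, 0)) (C.Ψ (y', 0)) ≤ K * edist y y' ∧
      edist y y' ≤ K * edist (C.Ψ (y, 0)) (C.Ψ (y', 0)) := by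
  have hmem : ∀ y ∈ Metric.ball 0 C.r, (y, (0 : ℝ)) ∈ C.Ψ.source := fun y hy => by
    rw [C.source_eq]
    exact ⟨hy, by simp [C.r_pos]⟩
  have hle := C.edist_le hK (hmem y hy) (hmem y' hy')
  simp only [hyperplaneEquiv_apply, zero_smul, sub_zero] at hle
  exact hle

variable [FiniteDimensional ℝ E] [MeasurableSpace E] [BorelSpace E]

lemma volume_image_le (hK : 1 ≤ (K : ℝ) * (1 - c)) {s : Set ((ℝ ∙ unitGrad ψ z₀)ᗮ × ℝ)}
    (hs : s ⊆ C.Ψ.source) : volume (C.Ψ '' s) ≤ K ^ Module.finrank ℝ E * volume s := by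
  rw [← volume_image_hyperplaneEquiv (norm_unitGrad h0) s,
    ← InnerProductSpace.euclideanHausdorffMeasure_eq_volume (V := E)]
  exact euclideanHausdorffMeasure_image_le_mul_image
    (fun _ hp _ hq => (C.edist_le hK (hs hp) (hs hq)).1) _

lemma volume_le_image (hK : 1 ≤ (K : ℝ) * (1 - c)) {s : Set ((ℝ ∙ unitGrad ψ z₀)ᗮ × ℝ)}
    (hs : s ⊆ C.Ψ.source) : volume s ≤ K ^ Module.finrank ℝ E * volume (C.Ψ '' s) := by
  rw [← volume_image_hyperplaneEquiv (norm_unitGrad h0) s,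
    ← InnerProductSpace.euclideanHausdorffMeasure_eq_volume (V := E)]
  exact euclideanHausdorffMeasure_image_le_mul_image
    (fun _ hp _ hq => (C.edist_le hK (hs hp) (hs hq)).2) _

lemma surface_image_le (hK : 1 ≤ (K : ℝ) * (1 - c)) {s : Set (ℝ ∙ unitGrad ψ z₀)ᗮ}
    (hs : s ⊆ Metric.ball 0 C.r) :
    (μHE[Module.finrank ℝ E - 1] : Measure E) ((fun y => C.Ψ (y, 0)) '' s)
      ≤ K ^ (Module.finrank ℝ E - 1) * volume s := by
  rw [← euclideanHausdorffMeasure_orthogonal_singleton (unitGrad_ne_zero h0), ← image_id s,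
    image_image]
  exact euclideanHausdorffMeasure_image_le_mul_image
    (fun _ hy _ hy' => (C.edist_apply_mk_zero_le hK (hs hy) (hs hy')).1) _

lemma surface_le_image (hK : 1 ≤ (K : ℝ) * (1 - c)) {s : Set (ℝ ∙ unitGrad ψ z₀)ᗮ}
    (hs : s ⊆ Metric.ball 0 C.r) :
    volume s ≤ K ^ (Module.finrank ℝ E - 1) *
      (μHE[Module.finrank ℝ E - 1] : Measure E) ((fun y => C.Ψ (y, 0)) '' s) := by
  rw [← euclideanHausdorffMeasure_orthogonal_singleton (unitGrad_ne_zero h0)]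
  nth_rw 1 [← image_id s]
  exact euclideanHausdorffMeasure_image_le_mul_image
    (fun _ hy _ hy' => (C.edist_apply_mk_zero_le hK (hs hy) (hs hy')).2) _

end NormalChart

end NormalChart

section CollarChart

variable {E : Type*} [NormedAddCommGroup E] [InnerProductSpace ℝ E] [CompleteSpace E]

/-- Near `z₀` the set `Ω` is the sublevel set of a `C²` function, whose gradient is non-zero and
points, at the points of the boundary, in the direction of the unit vector field `ν`. -/
def HasC2BoundaryAt (Ω : Set E) (ν : E → E) (z₀ : E) : Prop :=
  ∃ U : Set E, IsOpen U ∧ z₀ ∈ U ∧ ∃ ψ : E → ℝ, ContDiffOn ℝ 2 ψ U ∧ ∇ ψ z₀ ≠ 0 ∧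
    (∀ z ∈ U, z ∈ Ω ↔ ψ z < 0) ∧ ∀ z ∈ U ∩ frontier Ω, ν z = unitGrad ψ z

lemma HasC2BoundaryAt.exists_regular_nhds {Ω : Set E} {ν : E → E} {z₀ : E}
    (h : HasC2BoundaryAt Ω ν z₀) : ∃ U ∈ 𝓝 z₀, ∃ ψ : E → ℝ,
      (∀ z ∈ U, ContDiffAt ℝ 2 ψ z ∧ ∇ ψ z ≠ 0) ∧ (∀ z ∈ U, z ∈ Ω ↔ ψ z < 0) ∧
        ∀ z ∈ U ∩ frontier Ω, ν z = unitGrad ψ z := by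
  obtain ⟨U, hUo, hzU, ψ, hψ, h0, hΩ, hν⟩ := h
  have hψU : ∀ z ∈ U, ContDiffAt ℝ 2 ψ z := fun z hz => (hψ z hz).contDiffAt (hUo.mem_nhds hz)
  have hgrad : ∀ᶠ z in 𝓝 z₀, ∇ ψ z ≠ 0 :=
    (contDiffAt_gradient (m := 1) (hψU z₀ hzU) le_rfl).continuousAt.eventually_ne h0
  exact ⟨U ∩ {z | ∇ ψ z ≠ 0}, inter_mem (hUo.mem_nhds hzU) hgrad, ψ,
    fun z hz => ⟨hψU z hz.1, hz.2⟩, fun z hz => hΩ z hz.1, fun z hz => hν z ⟨hz.1.1, hz.2⟩⟩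

variable [FiniteDimensional ℝ E] [MeasurableSpace E] [BorelSpace E]

/-- Normal coordinates `(y, t) ↦ g(y) - t ν(g(y))` near the boundary point `z₀` of `Ω`, which
change the volume, and the surface measure of the boundary, by a factor in `[(1+η)⁻¹, 1+η]`. -/
structure CollarChart (Ω : Set E) (ν : E → E) (z₀ : E) (η : ℝ) where
  T : Submodule ℝ E
  r : ℝ
  Ψ : OpenPartialHomeomorph (T × ℝ) E
  r_pos : 0 < r
  source_eq : Ψ.source = Metric.ball 0 r ×ˢ Ioo (-r) r
  map_zero : Ψ 0 = z₀
  apply_eq : ∀ p ∈ Ψ.source, Ψ p = Ψ (p.1, 0) - p.2 • ν (Ψ (p.1, 0))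
  mem_iff : ∀ p ∈ Ψ.source, Ψ p ∈ Ω ↔ 0 < p.2
  continuousOn_normal : ContinuousOn ν (Ψ.target ∩ frontier Ω)
  contDiffOn_symm : ContDiffOn ℝ 1 Ψ.symm Ψ.target
  gradient_snd_symm : ∀ p ∈ Ψ.source, ∇ (fun x => (Ψ.symm x).2) (Ψ p) = -ν (Ψ (p.1, 0))
  volume_image_le : ∀ s ⊆ Ψ.source, volume (Ψ '' s) ≤ ENNReal.ofReal (1 + η) * volume s
  volume_le_image : ∀ s ⊆ Ψ.source, volume s ≤ ENNReal.ofReal (1 + η) * volume (Ψ '' s)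
  surface_image_le : ∀ s ⊆ Metric.ball (0 : T) r,
    (μHE[Module.finrank ℝ E - 1] : Measure E) ((fun y => Ψ (y, 0)) '' s)
      ≤ ENNReal.ofReal (1 + η) * volume s
  surface_le_image : ∀ s ⊆ Metric.ball (0 : T) r,
    volume s ≤ ENNReal.ofReal (1 + η) *
      (μHE[Module.finrank ℝ E - 1] : Measure E) ((fun y => Ψ (y, 0)) '' s)

lemma exists_one_le_mul_one_sub_pow_le (d : ℕ) {η : ℝ} (hη : 0 < η) :
    ∃ K c : NNReal, 1 ≤ K ∧ 0 < c ∧ 1 ≤ (K : ℝ) * (1 - c) ∧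
      (K : ENNReal) ^ d ≤ ENNReal.ofReal (1 + η) := by
  have hlim : ∀ᶠ x : NNReal in 𝓝[>] 1, x ^ d < Real.toNNReal (1 + η) := by
    refine Tendsto.eventually_lt_const ?_
      (((continuous_pow d).tendsto 1).mono_left nhdsWithin_le_nhds)
    rw [one_pow, Real.one_lt_toNNReal]
    exact lt_add_of_pos_right 1 hη
  obtain ⟨K, hK, hK1⟩ := (hlim.and self_mem_nhdsWithin).exists
  refine ⟨K, 1 - K⁻¹, hK1.le, tsub_pos_of_lt (inv_lt_one_of_one_lt₀ hK1), ?_, ?_⟩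
  · rw [NNReal.coe_sub (inv_le_one_of_one_le₀ hK1.le)]
    simp [(zero_lt_one.trans hK1).ne']
  · rw [← ENNReal.coe_pow]
    exact ENNReal.coe_le_coe.2 hK.le

theorem exists_collarChart {Ω : Set E} {ν : E → E} {z₀ : E} (hz₀ : z₀ ∈ frontier Ω)
    (h : HasC2BoundaryAt Ω ν z₀) {η : ℝ} (hη : 0 < η) {δ : ℝ} (hδ : 0 < δ) :
    ∃ C : CollarChart Ω ν z₀ η, C.r ≤ δ := by
  obtain ⟨U, hU, ψ, hψ, hΩ, hν⟩ := h.exists_regular_nhds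
  obtain ⟨hψ₀, h0⟩ := hψ z₀ (mem_of_mem_nhds hU)
  have hzero : ψ z₀ = 0 := eq_zero_of_mem_frontier hψ₀.continuousAt (eventually_of_mem hU hΩ) hz₀
  obtain ⟨K, c, hK1, hc, hK, hKη⟩ := exists_one_le_mul_one_sub_pow_le (Module.finrank ℝ E) hη
  have hKη' : (K : ENNReal) ^ (Module.finrank ℝ E - 1) ≤ ENNReal.ofReal (1 + η) :=
    (pow_le_pow_right₀ (mod_cast hK1) (Nat.sub_le _ _)).trans hKη
  obtain ⟨C, hCδ⟩ := exists_normalChart hψ₀ h0 hU hc hδ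
  have hmem : ∀ p ∈ C.Ψ.source, C.Ψ p ∈ Ω ↔ 0 < p.2 := fun p hp => by
    rw [hΩ _ (C.mem p hp), ← C.lt_iff p hp, hzero]
  have hfrontier : ∀ p ∈ C.Ψ.source, C.Ψ (p.1, 0) ∈ U ∩ frontier Ω := fun p hp =>
    ⟨C.mem _ (C.mk_zero_mem hp), (mem_frontier_iff_snd_eq_zero hmem (C.mk_zero_mem hp)).2 rfl⟩
  have hνγ : ∀ p ∈ C.Ψ.source, ν (C.Ψ (p.1, 0)) = unitGrad ψ (C.γ p.1) := fun p hp => by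
    rw [hν _ (hfrontier p hp), C.apply_mk_zero hp]
  have hν' : ∀ z ∈ C.Ψ.target ∩ frontier Ω, z ∈ U ∧ ν z = unitGrad ψ z := fun z hz => by
    have hzU : z ∈ U := C.Ψ.right_inv hz.1 ▸ C.mem _ (C.Ψ.map_target hz.1)
    exact ⟨hzU, hν z ⟨hzU, hz.2⟩⟩
  exact ⟨{
    T := _, r := C.r, Ψ := C.Ψ, r_pos := C.r_pos, source_eq := C.source_eq
    map_zero := C.map_zero
    apply_eq := fun p hp => by
      rw [hνγ p hp, C.apply_mk_zero hp, C.apply_eq p hp, normalMap]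
    mem_iff := hmem
    continuousOn_normal := fun z hz =>
      ((contDiffAt_unitGrad (m := 1) (hψ z (hν' z hz).1).1 le_rfl
        (hψ z (hν' z hz).1).2).continuousAt.continuousWithinAt).congr
        (fun x hx => (hν' x hx).2) (hν' z hz).2
    contDiffOn_symm := C.contDiffOn_symm
    gradient_snd_symm := fun p hp => by
      rw [hνγ p hp, (C.hasGradientAt_snd_symm hψ hp).gradient]
    volume_image_le := fun s hs => (C.volume_image_le hK hs).trans (by gcongr)
    volume_le_image := fun s hs => (C.volume_le_image hK hs).trans (by gcongr)
    surface_image_le := fun s hs => (C.surface_image_le hK hs).trans (by gcongr)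
    surface_le_image := fun s hs => (C.surface_le_image hK hs).trans (by gcongr) }, hCδ⟩

end CollarChart

section Layer

/-- A smooth monotone function, equal to `0` on `(-∞, δ]` and to `1` on `[2δ, ∞)`. -/
def layerCut (δ t : ℝ) : ℝ := Real.smoothTransition (t / δ - 1)

/-- The derivative of `layerCut δ`, an approximate identity supported in `[δ, 2δ]`. -/
def layerKernel (δ t : ℝ) : ℝ := deriv (layerCut δ) t

variable {δ r B L t : ℝ} {g : ℝ → ℝ}

lemma contDiff_layerCut (δ : ℝ) : ContDiff ℝ 1 (layerCut δ) :=
  Real.smoothTransition.contDiff.comp ((contDiff_id.div_const δ).sub contDiff_const)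

lemma hasDerivAt_layerCut (δ t : ℝ) : HasDerivAt (layerCut δ) (layerKernel δ t) t :=
  ((contDiff_layerCut δ).differentiable one_ne_zero t).hasDerivAt

lemma continuous_layerKernel (δ : ℝ) : Continuous (layerKernel δ) :=
  (contDiff_layerCut δ).continuous_deriv le_rfl

lemma layerCut_eq_zero (hδ : 0 < δ) (ht : t ≤ δ) : layerCut δ t = 0 :=
  Real.smoothTransition.zero_of_nonpos (sub_nonpos.2 ((div_le_one hδ).2 ht))

lemma layerCut_eq_one (hδ : 0 < δ) (ht : 2 * δ ≤ t) : layerCut δ t = 1 := by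
  refine Real.smoothTransition.one_of_one_le ?_
  rw [le_sub_iff_add_le, le_div_iff₀ hδ]
  linarith

lemma abs_layerCut_le (δ t : ℝ) : |layerCut δ t| ≤ 1 := by
  rw [layerCut, abs_of_nonneg (Real.smoothTransition.nonneg _)]
  exact Real.smoothTransition.le_one _

lemma layerKernel_nonneg (hδ : 0 < δ) (t : ℝ) : 0 ≤ layerKernel δ t := by
  have hmono : Monotone (layerCut δ) := fun a b hab =>
    Real.smoothTransition.monotone (by gcongr)
  exact hmono.deriv_nonneg

lemma layerKernel_eq_zero (hδ : 0 < δ) (ht : 2 * δ < t) : layerKernel δ t = 0 := by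
  have hone : layerCut δ =ᶠ[𝓝 t] fun _ => 1 := by
    filter_upwards [lt_mem_nhds ht] with s hs using layerCut_eq_one hδ hs.le
  rw [layerKernel, hone.deriv_eq, deriv_const]

lemma integral_layerKernel (hδ : 0 < δ) (hr : 2 * δ ≤ r) :
    ∫ t in Ioo 0 r, layerKernel δ t = 1 := by
  rw [← integral_Ioc_eq_integral_Ioo, ← intervalIntegral.integral_of_le (by linarith),
    intervalIntegral.integral_eq_sub_of_hasDerivAt (fun t _ => hasDerivAt_layerCut δ t)
      ((continuous_layerKernel δ).intervalIntegrable _ _),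
    layerCut_eq_one hδ hr, layerCut_eq_zero hδ hδ.le, sub_zero]

lemma integrableOn_layerKernel (δ r : ℝ) : IntegrableOn (layerKernel δ) (Ioo 0 r) :=
  ((continuous_layerKernel δ).continuousOn.integrableOn_compact isCompact_Icc).mono_set
    Ioo_subset_Icc_self

lemma abs_integral_layerKernel_mul_le (hδ : 0 < δ) (hr : 2 * δ ≤ r)
    (hB : ∀ᵐ t ∂volume.restrict (Ioo 0 r), t ≤ 2 * δ → |g t| ≤ B) :
    |∫ t in Ioo 0 r, layerKernel δ t * g t| ≤ B := by
  have hle : ∀ᵐ t ∂volume.restrict (Ioo 0 r), ‖layerKernel δ t * g t‖ ≤ layerKernel δ t * B := by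
    filter_upwards [hB] with t ht
    rcases le_or_gt t (2 * δ) with h | h
    · rw [norm_mul, Real.norm_of_nonneg (layerKernel_nonneg hδ t)]
      exact mul_le_mul_of_nonneg_left (ht h) (layerKernel_nonneg hδ t)
    · simp [layerKernel_eq_zero hδ h]
  have hint := norm_integral_le_of_norm_le ((integrableOn_layerKernel δ r).mul_const B) hle
  rwa [integral_mul_const, integral_layerKernel hδ hr, one_mul] at hint

lemma tendsto_integral_layerKernel_mul (hr : 0 < r)
    (hg : AEStronglyMeasurable g (volume.restrict (Ioo 0 r)))
    (hB : ∀ᵐ t ∂volume.restrict (Ioo 0 r), |g t| ≤ B) (hL : Tendsto g (𝓝[>] 0) (𝓝 L)) :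
    Tendsto (fun δ => ∫ t in Ioo 0 r, layerKernel δ t * g t) (𝓝[>] 0) (𝓝 L) := by
  rw [Metric.tendsto_nhds]
  intro e he
  obtain ⟨a, ha, hclose⟩ :=
    mem_nhdsGT_iff_exists_Ioo_subset.1 (Metric.tendsto_nhds.1 hL (e / 2) (half_pos he))
  filter_upwards [Ioo_mem_nhdsGT (lt_min (half_pos ha) (half_pos hr))] with δ hδ
  have hδa : 2 * δ < a := by linarith [hδ.2.trans_le (min_le_left _ _)]
  have hδr : 2 * δ ≤ r := by linarith [hδ.2.trans_le (min_le_right _ _)]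
  have hint : Integrable (fun t => layerKernel δ t * g t) (volume.restrict (Ioo 0 r)) :=
    (integrableOn_layerKernel δ r).mul_bdd hg hB
  have hsub : ∫ t in Ioo 0 r, layerKernel δ t * (g t - L)
      = (∫ t in Ioo 0 r, layerKernel δ t * g t) - L := by
    simp_rw [mul_sub]
    rw [integral_sub hint ((integrableOn_layerKernel δ r).mul_const L), integral_mul_const,
      integral_layerKernel hδ.1 hδr, one_mul]
  rw [Real.dist_eq, ← hsub]
  refine (abs_integral_layerKernel_mul_le hδ.1 hδr ?_).trans_lt (half_lt_self he)
  filter_upwards [ae_restrict_mem measurableSet_Ioo] with t ht h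
  exact (show dist (g t) L < e / 2 from hclose ⟨ht.1, h.trans_lt hδa⟩).le

variable {Y : Type*} [MeasurableSpace Y] {μ : Measure Y} [IsFiniteMeasure μ] {G : Y × ℝ → ℝ}
  {G₀ : Y → ℝ}

lemma integrable_layerKernel_mul
    (hG : AEStronglyMeasurable G (μ.prod (volume.restrict (Ioo 0 r))))
    (hB : ∀ᵐ p ∂μ.prod (volume.restrict (Ioo 0 r)), |G p| ≤ B) (δ : ℝ) :
    Integrable (fun p => layerKernel δ p.2 * G p) (μ.prod (volume.restrict (Ioo 0 r))) := by
  have hkernel : Integrable (fun p : Y × ℝ => layerKernel δ p.2)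
      (μ.prod (volume.restrict (Ioo 0 r))) := by
    simpa only [one_mul] using
      (integrable_const (1 : ℝ) (μ := μ)).mul_prod (integrableOn_layerKernel δ r)
  exact hkernel.mul_bdd hG hB

lemma tendsto_integral_prod_layerKernel_mul (hr : 0 < r)
    (hG : AEStronglyMeasurable G (μ.prod (volume.restrict (Ioo 0 r))))
    (hB : ∀ᵐ p ∂μ.prod (volume.restrict (Ioo 0 r)), |G p| ≤ B)
    (hlim : ∀ᵐ y ∂μ, Tendsto (fun t => G (y, t)) (𝓝[>] 0) (𝓝 (G₀ y))) :
    Tendsto (fun δ => ∫ p, layerKernel δ p.2 * G p ∂μ.prod (volume.restrict (Ioo 0 r)))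
      (𝓝[>] 0) (𝓝 (∫ y, G₀ y ∂μ)) := by
  have hint := integrable_layerKernel_mul hG hB
  have hB' := Measure.ae_ae_of_ae_prod hB
  simp_rw [fun δ => integral_prod _ (hint δ)]
  refine tendsto_integral_filter_of_dominated_convergence (fun _ => B)
    (.of_forall fun δ => (hint δ).aestronglyMeasurable.integral_prod_right') ?_
    (integrable_const B) ?_
  · filter_upwards [Ioo_mem_nhdsGT (half_pos hr)] with δ hδ
    filter_upwards [hB'] with y hy
    exact abs_integral_layerKernel_mul_le hδ.1 (by linarith [hδ.2]) (hy.mono fun t ht _ => ht)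
  · filter_upwards [hB', hlim, hG.prodMk_left] with y hyB hy hym
    exact tendsto_integral_layerKernel_mul hr hym hyB hy

end Layer

namespace CollarChart

variable {E : Type*} [NormedAddCommGroup E] [InnerProductSpace ℝ E] [CompleteSpace E]
  [FiniteDimensional ℝ E] [MeasurableSpace E] [BorelSpace E]
  {Ω : Set E} {ν : E → E} {z₀ : E} {η : ℝ} (C : CollarChart Ω ν z₀ η)

lemma mem_frontier_iff {p : C.T × ℝ} (hp : p ∈ C.Ψ.source) : C.Ψ p ∈ frontier Ω ↔ p.2 = 0 :=
  mem_frontier_iff_snd_eq_zero C.mem_iff hp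

lemma prod_Ioo_subset_source : Metric.ball 0 C.r ×ˢ Ioo 0 C.r ⊆ C.Ψ.source := by
  rw [C.source_eq]
  exact prod_mono_right (Ioo_subset_Ioo_left (neg_nonpos.2 C.r_pos.le))

lemma mk_zero_mem_source {y : C.T} (hy : y ∈ Metric.ball 0 C.r) : (y, 0) ∈ C.Ψ.source := by
  rw [C.source_eq]
  exact ⟨hy, neg_lt_zero.2 C.r_pos, C.r_pos⟩

lemma center_mem_target : z₀ ∈ C.Ψ.target :=
  mem_of_eq_of_mem C.map_zero.symm
    (C.Ψ.map_source (C.mk_zero_mem_source (Metric.mem_ball_self C.r_pos)))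

lemma target_inter_eq : C.Ψ.target ∩ Ω = C.Ψ '' (Metric.ball 0 C.r ×ˢ Ioo 0 C.r) := by
  have himage : C.Ψ.IsImage (Prod.snd ⁻¹' Ioi 0) Ω := fun p hp => C.mem_iff p hp
  rw [← himage.image_eq, C.source_eq, ← univ_prod, prod_inter_prod, inter_univ, Ioo_inter_Ioi,
    max_eq_right (neg_nonpos.2 C.r_pos.le)]

lemma target_inter_frontier_eq :
    C.Ψ.target ∩ frontier Ω = (fun y => C.Ψ (y, 0)) '' Metric.ball 0 C.r := by
  ext x
  refine ⟨fun ⟨hx, hxΩ⟩ => ?_, ?_⟩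
  · have hsource := C.Ψ.map_target hx
    rw [← C.Ψ.right_inv hx, C.mem_frontier_iff hsource] at hxΩ
    have hbase : ((C.Ψ.symm x).1, 0) = C.Ψ.symm x := Prod.ext rfl hxΩ.symm
    exact ⟨(C.Ψ.symm x).1, (C.source_eq ▸ hsource).1,
      (congrArg C.Ψ hbase).trans (C.Ψ.right_inv hx)⟩
  · rintro ⟨y, hy, rfl⟩
    exact ⟨C.Ψ.map_source (C.mk_zero_mem_source hy),
      (C.mem_frontier_iff (C.mk_zero_mem_source hy)).2 rfl⟩

lemma continuousOn_base : ContinuousOn (fun y => C.Ψ (y, 0)) (Metric.ball 0 C.r) :=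
  C.Ψ.continuousOn.comp (by fun_prop) fun _ hy => C.mk_zero_mem_source hy

/-- The surface measure of the flat model of the boundary. -/
def baseModel : Measure C.T := volume.restrict (Metric.ball 0 C.r)

/-- The Lebesgue measure of the flat model of the inner collar. -/
def model : Measure (C.T × ℝ) := C.baseModel.prod (volume.restrict (Ioo 0 C.r))

instance : IsFiniteMeasure C.baseModel :=
  isFiniteMeasure_restrict.2 measure_ball_lt_top.ne

lemma model_eq : C.model = volume.restrict (Metric.ball 0 C.r ×ˢ Ioo 0 C.r) :=
  Measure.prod_restrict _ _

lemma measurableSet_prod_Ioo : MeasurableSet (Metric.ball (0 : C.T) C.r ×ˢ Ioo 0 C.r) :=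
  measurableSet_ball.prod measurableSet_Ioo

lemma aemeasurable_model : AEMeasurable C.Ψ C.model := by
  rw [C.model_eq]
  exact (C.Ψ.continuousOn.mono C.prod_Ioo_subset_source).aemeasurable C.measurableSet_prod_Ioo

lemma aemeasurable_base : AEMeasurable (fun y => C.Ψ (y, 0)) C.baseModel :=
  C.continuousOn_base.aemeasurable measurableSet_ball

lemma map_model_apply {s : Set E} (hs : MeasurableSet s) :
    C.model.map C.Ψ s = volume (Metric.ball 0 C.r ×ˢ Ioo 0 C.r ∩ C.Ψ ⁻¹' s) := by
  rw [Measure.map_apply_of_aemeasurable C.aemeasurable_model hs, C.model_eq,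
    Measure.restrict_apply' C.measurableSet_prod_Ioo, inter_comm]

lemma map_base_apply {s : Set E} (hs : MeasurableSet s) :
    C.baseModel.map (fun y => C.Ψ (y, 0)) s
      = volume (Metric.ball 0 C.r ∩ (fun y => C.Ψ (y, 0)) ⁻¹' s) := by
  rw [Measure.map_apply_of_aemeasurable C.aemeasurable_base hs, baseModel,
    Measure.restrict_apply' measurableSet_ball, inter_comm]

lemma volume_le_map :
    volume.restrict (C.Ψ.target ∩ Ω) ≤ ENNReal.ofReal (1 + η) • C.model.map C.Ψ := by
  refine Measure.le_iff.2 fun s hs => ?_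
  rw [Measure.restrict_apply hs, Measure.smul_apply, C.map_model_apply hs, C.target_inter_eq,
    inter_comm, ← image_inter_preimage]
  exact C.volume_image_le _ (inter_subset_left.trans C.prod_Ioo_subset_source)

lemma map_le_volume :
    C.model.map C.Ψ ≤ ENNReal.ofReal (1 + η) • volume.restrict (C.Ψ.target ∩ Ω) := by
  refine Measure.le_iff.2 fun s hs => ?_
  rw [Measure.smul_apply, Measure.restrict_apply hs, C.map_model_apply hs, C.target_inter_eq,
    inter_comm s, ← image_inter_preimage]
  exact C.volume_le_image _ (inter_subset_left.trans C.prod_Ioo_subset_source)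

lemma surface_le_map :
    (μHE[Module.finrank ℝ E - 1] : Measure E).restrict (C.Ψ.target ∩ frontier Ω)
      ≤ ENNReal.ofReal (1 + η) • C.baseModel.map (fun y => C.Ψ (y, 0)) := by
  refine Measure.le_iff.2 fun s hs => ?_
  rw [Measure.restrict_apply hs, Measure.smul_apply, C.map_base_apply hs,
    C.target_inter_frontier_eq, inter_comm, ← image_inter_preimage]
  exact C.surface_image_le _ inter_subset_left

lemma map_le_surface :
    C.baseModel.map (fun y => C.Ψ (y, 0)) ≤ ENNReal.ofReal (1 + η) •
      (μHE[Module.finrank ℝ E - 1] : Measure E).restrict (C.Ψ.target ∩ frontier Ω) := by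
  refine Measure.le_iff.2 fun s hs => ?_
  rw [Measure.smul_apply, Measure.restrict_apply hs, C.map_base_apply hs,
    C.target_inter_frontier_eq, inter_comm s, ← image_inter_preimage]
  exact C.surface_le_image _ inter_subset_left

lemma surface_lt_top :
    (μHE[Module.finrank ℝ E - 1] : Measure E) (C.Ψ.target ∩ frontier Ω) < ⊤ := by
  rw [C.target_inter_frontier_eq]
  exact (C.surface_image_le _ Subset.rfl).trans_lt
    (ENNReal.mul_lt_top ENNReal.ofReal_lt_top measure_ball_lt_top)

end CollarChart

section Gradient

variable {E : Type*} [NormedAddCommGroup E] [InnerProductSpace ℝ E] [CompleteSpace E]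
  {φ u v : E → ℝ} {s : Set E} {x : E}

lemma continuousOn_gradient (hs : IsOpen s) (hφ : ContDiffOn ℝ 1 φ s) : ContinuousOn (∇ φ) s :=
  fun x hx => (contDiffAt_gradient (m := 0) ((hφ x hx).contDiffAt (hs.mem_nhds hx))
    (zero_add 1).le).continuousAt.continuousWithinAt

lemma continuous_gradient (hφ : ContDiff ℝ 1 φ) : Continuous (∇ φ) :=
  continuousOn_univ.1 (continuousOn_gradient isOpen_univ hφ.contDiffOn)

lemma gradient_eq_zero_of_notMem_tsupport (hx : x ∉ tsupport φ) : ∇ φ x = 0 := by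
  rw [gradient, fderiv_of_notMem_tsupport ℝ hx, map_zero]

lemma gradient_mul (hu : DifferentiableAt ℝ u x) (hv : DifferentiableAt ℝ v x) :
    ∇ (fun y => u y * v y) x = u x • ∇ v x + v x • ∇ u x := by
  rw [gradient, fderiv_fun_mul hu hv]
  simp only [gradient, map_add, map_smulₛₗ, conj_trivial]

lemma gradient_fun_sub (hu : DifferentiableAt ℝ u x) (hv : DifferentiableAt ℝ v x) :
    ∇ (fun y => u y - v y) x = ∇ u x - ∇ v x := by
  simp only [gradient, fderiv_fun_sub hu hv, map_sub]

lemma gradient_comp {g : ℝ → ℝ} {g' : ℝ} (hg : HasDerivAt g g' (u x))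
    (hu : DifferentiableAt ℝ u x) : ∇ (fun y => g (u y)) x = g' • ∇ u x := by
  have hcomp : HasFDerivAt (fun y => g (u y)) (g' • fderiv ℝ u x) x :=
    hg.comp_hasFDerivAt x hu.hasFDerivAt
  rw [gradient, hcomp.fderiv, map_smulₛₗ, conj_trivial, gradient]

omit [CompleteSpace E] in
lemma contDiff_mul_of_tsupport_subset (hs : IsOpen s) (hφ : ContDiff ℝ 1 φ)
    (hsupp : tsupport φ ⊆ s) (hu : ContDiffOn ℝ 1 u s) : ContDiff ℝ 1 fun x => φ x * u x := by
  refine contDiff_iff_contDiffAt.2 fun x => ?_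
  by_cases hx : x ∈ tsupport φ
  · exact hφ.contDiffAt.mul ((hu x (hsupp hx)).contDiffAt (hs.mem_nhds (hsupp hx)))
  · have hzero : (fun x => φ x * u x) =ᶠ[𝓝 x] fun _ => 0 := by
      filter_upwards [notMem_tsupport_iff_eventuallyEq.1 hx] with y hy
      rw [hy, Pi.zero_apply, zero_mul]
    exact contDiffAt_const.congr_of_eventuallyEq hzero

lemma gradient_mul_of_tsupport_subset (hs : IsOpen s) (hφ : ContDiff ℝ 1 φ)
    (hsupp : tsupport φ ⊆ s) (hu : ContDiffOn ℝ 1 u s) (x : E) :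
    ∇ (fun x => φ x * u x) x = φ x • ∇ u x + u x • ∇ φ x := by
  by_cases hx : x ∈ tsupport φ
  · exact gradient_mul (hφ.differentiable one_ne_zero x)
      (((hu x (hsupp hx)).contDiffAt (hs.mem_nhds (hsupp hx))).differentiableAt one_ne_zero)
  · have hprod : x ∉ tsupport fun x => φ x * u x :=
      fun h => hx (tsupport_mul_subset_left h)
    rw [gradient_eq_zero_of_notMem_tsupport hx, gradient_eq_zero_of_notMem_tsupport hprod,
      image_eq_zero_of_notMem_tsupport hx, zero_smul, smul_zero, add_zero]

end Gradient

lemma integrable_mul_of_hasCompactSupport {α : Type*} [TopologicalSpace α] [MeasurableSpace α]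
    [OpensMeasurableSpace α] {μ : Measure α} {f φ : α → ℝ} (hf : Integrable f μ)
    (hφ : Continuous φ) (hc : HasCompactSupport φ) : Integrable (fun x => f x * φ x) μ := by
  obtain ⟨B, hB⟩ := hφ.bounded_above_of_compact_support hc
  exact hf.mul_bdd hφ.aestronglyMeasurable (ae_of_all _ hB)

lemma integrable_hasCompactSupport_mul {α : Type*} [TopologicalSpace α] [MeasurableSpace α]
    [OpensMeasurableSpace α] {μ : Measure α} {f φ : α → ℝ} (hf : Integrable f μ)
    (hφ : Continuous φ) (hc : HasCompactSupport φ) : Integrable (fun x => φ x * f x) μ := by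
  simpa only [mul_comm] using integrable_mul_of_hasCompactSupport hf hφ hc

section NormalTrace

variable {E : Type*} [NormedAddCommGroup E] [InnerProductSpace ℝ E] [CompleteSpace E]
  [FiniteDimensional ℝ E] [MeasurableSpace E] [BorelSpace E]
  {Ω : Set E} {ν X : E → E} {q f φ : E → ℝ}

/-- The vector field `X`, continuous in the open set `Ω`, has the normal trace `q` on the boundary
of `Ω`, as a bounded pointwise limit along the normals. -/
structure HasNormalTrace (Ω : Set E) (ν : E → E) (X : E → E) (q : E → ℝ) : Prop where
  continuousOn : ContinuousOn X Ω
  integrableOn : ∀ K, IsCompact K → IntegrableOn X (Ω ∩ K)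
  tendsto : ∀ z ∈ frontier Ω,
    Tendsto (fun δ : ℝ => inner ℝ (X (z - δ • ν z)) (ν z)) (𝓝[>] 0) (𝓝 (q z))
  bounded : ∃ M δ₀ : ℝ, 0 < δ₀ ∧ ∀ z ∈ frontier Ω, ∀ δ ∈ Ioo 0 δ₀,
    |inner ℝ (X (z - δ • ν z)) (ν z)| ≤ M

/-- The divergence of `φ X`, for a vector field `X` of divergence `f`. -/
def weakDivIntegrand (X : E → E) (f φ : E → ℝ) (x : E) : ℝ := inner ℝ (X x) (∇ φ x) + f x * φ x

/-- The divergence of `X` in the open set `Ω` is `f`, in the weak sense. -/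
def HasWeakDiv (Ω : Set E) (X : E → E) (f : E → ℝ) : Prop :=
  ∀ φ : E → ℝ, ContDiff ℝ 1 φ → HasCompactSupport φ → tsupport φ ⊆ Ω →
    ∫ x in Ω, weakDivIntegrand X f φ x = 0

lemma HasNormalTrace.integrableOn_inner (hX : HasNormalTrace Ω ν X q) (hΩ : IsOpen Ω)
    (hφ : ContDiff ℝ 1 φ) (hc : HasCompactSupport φ) :
    IntegrableOn (fun x => inner ℝ (X x) (∇ φ x)) Ω := by
  have hzero : ∀ x ∈ Ω \ (Ω ∩ tsupport φ), inner ℝ (X x) (∇ φ x) = 0 := fun x hx => by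
    rw [gradient_eq_zero_of_notMem_tsupport fun h => hx.2 ⟨hx.1, h⟩, inner_zero_right]
  have hgrad := continuous_gradient hφ
  obtain ⟨B, hB⟩ := hc.exists_bound_of_continuousOn hgrad.continuousOn
  have hX' := hX.integrableOn _ hc
  refine IntegrableOn.of_forall_sdiff_eq_zero (s := Ω ∩ tsupport φ) ?_ hΩ.measurableSet hzero
  refine (hX'.norm.mul_const B).mono'
    (hX'.aestronglyMeasurable.inner hgrad.aestronglyMeasurable) ?_
  filter_upwards [ae_restrict_mem
    (hΩ.measurableSet.inter (isClosed_tsupport φ).measurableSet)] with x hx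
  exact (norm_inner_le_norm _ _).trans (by gcongr; exact hB x hx.2)

lemma HasNormalTrace.integrableOn_weakDivIntegrand (hX : HasNormalTrace Ω ν X q) (hΩ : IsOpen Ω)
    (hf : IntegrableOn f Ω) (hφ : ContDiff ℝ 1 φ) (hc : HasCompactSupport φ) :
    IntegrableOn (weakDivIntegrand X f φ) Ω :=
  (hX.integrableOn_inner hΩ hφ hc).add (integrable_mul_of_hasCompactSupport hf hφ.continuous hc)

omit [FiniteDimensional ℝ E] [MeasurableSpace E] [BorelSpace E] in
lemma weakDivIntegrand_eq_zero_of_notMem_tsupport {x : E} (hx : x ∉ tsupport φ) :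
    weakDivIntegrand X f φ x = 0 := by
  rw [weakDivIntegrand, gradient_eq_zero_of_notMem_tsupport hx,
    image_eq_zero_of_notMem_tsupport hx, inner_zero_right, mul_zero, add_zero]

lemma setIntegral_weakDivIntegrand_inter {s : Set E} (hΩ : IsOpen Ω) (hφ : tsupport φ ⊆ s) :
    ∫ x in s ∩ Ω, weakDivIntegrand X f φ x = ∫ x in Ω, weakDivIntegrand X f φ x :=
  (setIntegral_eq_of_subset_of_forall_sdiff_eq_zero hΩ.measurableSet inter_subset_right
    fun _ hx => weakDivIntegrand_eq_zero_of_notMem_tsupport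
      fun h => hx.2 ⟨hφ h, hx.1⟩).symm

omit [CompleteSpace E] in
lemma HasNormalTrace.abs_le (hX : HasNormalTrace Ω ν X q) {z : E} (hz : z ∈ frontier Ω)
    {M r : ℝ} (hr : 0 < r) (hM : ∀ δ ∈ Ioo 0 r, |inner ℝ (X (z - δ • ν z)) (ν z)| ≤ M) :
    |q z| ≤ M :=
  le_of_tendsto (hX.tendsto z hz).abs (eventually_of_mem (Ioo_mem_nhdsGT hr) hM)

end NormalTrace

namespace CollarChart

variable {E : Type*} [NormedAddCommGroup E] [InnerProductSpace ℝ E] [CompleteSpace E]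
  [FiniteDimensional ℝ E] [MeasurableSpace E] [BorelSpace E]
  {Ω : Set E} {ν X : E → E} {q f φ : E → ℝ} {z₀ : E} {η δ M : ℝ} (C : CollarChart Ω ν z₀ η)

/-- The distance to the boundary in the normal coordinates, negative outside `Ω`. -/
def depth (x : E) : ℝ := (C.Ψ.symm x).2

lemma contDiffOn_depth : ContDiffOn ℝ 1 C.depth C.Ψ.target := C.contDiffOn_symm.snd

lemma depth_apply {p : C.T × ℝ} (hp : p ∈ C.Ψ.source) : C.depth (C.Ψ p) = p.2 :=
  congrArg Prod.snd (C.Ψ.left_inv hp)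

lemma depth_pos_iff {x : E} (hx : x ∈ C.Ψ.target) : 0 < C.depth x ↔ x ∈ Ω := by
  rw [depth, ← C.mem_iff _ (C.Ψ.map_target hx), C.Ψ.right_inv hx]

lemma measurableSet_target_inter (hΩ : IsOpen Ω) : MeasurableSet (C.Ψ.target ∩ Ω) :=
  (C.Ψ.open_target.inter hΩ).measurableSet

lemma measurableSet_target_inter_frontier : MeasurableSet (C.Ψ.target ∩ frontier Ω) :=
  C.Ψ.open_target.measurableSet.inter isClosed_frontier.measurableSet

lemma contDiffOn_layerCut_depth (δ : ℝ) :
    ContDiffOn ℝ 1 (fun x => layerCut δ (C.depth x)) C.Ψ.target :=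
  (contDiff_layerCut δ).comp_contDiffOn C.contDiffOn_depth

lemma integrableOn_mul_layerCut_depth {H : E → ℝ} (hΩ : IsOpen Ω)
    (hH : IntegrableOn H (C.Ψ.target ∩ Ω)) (δ : ℝ) :
    IntegrableOn (fun x => H x * layerCut δ (C.depth x)) (C.Ψ.target ∩ Ω) :=
  have hcut : ContinuousOn (fun x => layerCut δ (C.depth x)) (C.Ψ.target ∩ Ω) :=
    (C.contDiffOn_layerCut_depth δ).continuousOn.mono inter_subset_left
  hH.mul_bdd (hcut.aestronglyMeasurable (C.measurableSet_target_inter hΩ))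
    (ae_of_all _ fun _ => abs_layerCut_le δ _)

lemma tendsto_setIntegral_mul_layerCut_depth {H : E → ℝ} (hΩ : IsOpen Ω)
    (hH : IntegrableOn H (C.Ψ.target ∩ Ω)) :
    Tendsto (fun δ => ∫ x in C.Ψ.target ∩ Ω, H x * layerCut δ (C.depth x)) (𝓝[>] 0)
      (𝓝 (∫ x in C.Ψ.target ∩ Ω, H x)) := by
  refine tendsto_integral_filter_of_dominated_convergence (fun x => ‖H x‖)
    (.of_forall fun δ => (C.integrableOn_mul_layerCut_depth hΩ hH δ).aestronglyMeasurable)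
    (.of_forall fun δ => ae_of_all _ fun x => ?_) hH.norm ?_
  · rw [norm_mul]
    exact mul_le_of_le_one_right (norm_nonneg _) (abs_layerCut_le δ _)
  · filter_upwards [ae_restrict_mem (C.measurableSet_target_inter hΩ)] with x hx
    refine tendsto_const_nhds.congr' ?_
    filter_upwards [Ioo_mem_nhdsGT (half_pos ((C.depth_pos_iff hx.1).2 hx.2))] with δ hδ
    rw [layerCut_eq_one hδ.1 (by linarith [hδ.2]), mul_one]

lemma tsupport_mul_layerCut_depth_subset (hδ : 0 < δ) (hs : tsupport φ ⊆ C.Ψ.target) :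
    (tsupport fun x => φ x * layerCut δ (C.depth x)) ⊆ tsupport φ ∩ Ω := by
  have hclosed : IsClosed (tsupport φ ∩ C.depth ⁻¹' Ici δ) :=
    (C.contDiffOn_depth.continuousOn.mono hs).preimage_isClosed_of_isClosed
      (isClosed_tsupport φ) isClosed_Ici
  have hsub : Function.support (fun x => φ x * layerCut δ (C.depth x))
      ⊆ tsupport φ ∩ C.depth ⁻¹' Ici δ := by
    refine fun x hx => ⟨subset_tsupport φ (left_ne_zero_of_mul hx), ?_⟩
    by_contra h
    exact hx (by simp only [layerCut_eq_zero hδ (not_le.1 h).le, mul_zero])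
  exact (closure_minimal hsub hclosed).trans fun x hx =>
    ⟨hx.1, (C.depth_pos_iff (hs hx.1)).1 (hδ.trans_le hx.2)⟩

/-- The contribution of the cut-off to the divergence of `φ X`: a density concentrated in the
layer of depth between `δ` and `2δ`. -/
def layerFlux (X : E → E) (φ : E → ℝ) (δ : ℝ) (x : E) : ℝ :=
  layerKernel δ (C.depth x) * (φ x * inner ℝ (X x) (-∇ C.depth x))

lemma layerFlux_eq (hφ : ContDiff ℝ 1 φ) (hs : tsupport φ ⊆ C.Ψ.target) {x : E}
    (hx : x ∈ C.Ψ.target) :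
    C.layerFlux X φ δ x = weakDivIntegrand X f φ x * layerCut δ (C.depth x)
      - weakDivIntegrand X f (fun x => φ x * layerCut δ (C.depth x)) x := by
  have hdepth : DifferentiableAt ℝ C.depth x :=
    ((C.contDiffOn_depth x hx).contDiffAt (C.Ψ.open_target.mem_nhds hx)).differentiableAt
      one_ne_zero
  rw [layerFlux, weakDivIntegrand, weakDivIntegrand,
    gradient_mul_of_tsupport_subset C.Ψ.open_target hφ hs
      (C.contDiffOn_layerCut_depth δ),
    gradient_comp (hasDerivAt_layerCut δ _) hdepth]
  simp only [inner_add_right, inner_smul_right, inner_neg_right]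
  ring

lemma integrableOn_layerFlux_and_integral_eq (hδ : 0 < δ) (hΩ : IsOpen Ω)
    (hX : HasNormalTrace Ω ν X q) (hf : IntegrableOn f Ω) (hdiv : HasWeakDiv Ω X f)
    (hφ : ContDiff ℝ 1 φ) (hc : HasCompactSupport φ) (hs : tsupport φ ⊆ C.Ψ.target) :
    IntegrableOn (C.layerFlux X φ δ) (C.Ψ.target ∩ Ω) ∧
      ∫ x in C.Ψ.target ∩ Ω, C.layerFlux X φ δ x
        = ∫ x in C.Ψ.target ∩ Ω, weakDivIntegrand X f φ x * layerCut δ (C.depth x) := by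
  set φδ : E → ℝ := fun x => φ x * layerCut δ (C.depth x)
  have hφδ : ContDiff ℝ 1 φδ := contDiff_mul_of_tsupport_subset C.Ψ.open_target hφ hs
    (C.contDiffOn_layerCut_depth δ)
  have hsδ := C.tsupport_mul_layerCut_depth_subset hδ hs
  have hcδ : HasCompactSupport φδ :=
    hc.of_isClosed_subset (isClosed_tsupport _) (hsδ.trans inter_subset_left)
  have hzero : ∫ x in C.Ψ.target ∩ Ω, weakDivIntegrand X f φδ x = 0 :=
    (setIntegral_weakDivIntegrand_inter hΩ ((hsδ.trans inter_subset_left).trans hs)).trans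
      (hdiv φδ hφδ hcδ (hsδ.trans inter_subset_right))
  have hint := C.integrableOn_mul_layerCut_depth hΩ
    ((hX.integrableOn_weakDivIntegrand hΩ hf hφ hc).mono_set inter_subset_right) δ
  have hintδ : IntegrableOn (weakDivIntegrand X f φδ) (C.Ψ.target ∩ Ω) :=
    (hX.integrableOn_weakDivIntegrand hΩ hf hφδ hcδ).mono_set inter_subset_right
  have heq : EqOn (C.layerFlux X φ δ) _ (C.Ψ.target ∩ Ω) := fun x hx =>
    C.layerFlux_eq (f := f) hφ hs hx.1
  have hm := C.measurableSet_target_inter hΩ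
  exact ⟨(integrableOn_congr_fun heq hm).2 (hint.sub hintδ), by
    rw [setIntegral_congr_fun hm heq, integral_sub hint hintδ, hzero, sub_zero]⟩

/-- The flux of `φ X` through the surfaces parallel to the boundary, in normal coordinates. -/
def modelFlux (X : E → E) (φ : E → ℝ) (p : C.T × ℝ) : ℝ :=
  φ (C.Ψ p) * inner ℝ (X (C.Ψ p)) (ν (C.Ψ (p.1, 0)))

lemma base_mem {y : C.T} (hy : y ∈ Metric.ball 0 C.r) :
    C.Ψ (y, 0) ∈ C.Ψ.target ∩ frontier Ω :=
  C.target_inter_frontier_eq ▸ mem_image_of_mem _ hy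

lemma aestronglyMeasurable_modelFlux (hX : ContinuousOn X Ω) (hφ : Continuous φ) :
    AEStronglyMeasurable (C.modelFlux X φ) C.model := by
  have hΨ := C.Ψ.continuousOn.mono C.prod_Ioo_subset_source
  rw [C.model_eq]
  refine ContinuousOn.aestronglyMeasurable ((hφ.comp_continuousOn hΨ).mul (ContinuousOn.inner
    (hX.comp hΨ fun p hp => (C.mem_iff p (C.prod_Ioo_subset_source hp)).2 hp.2.1) ?_))
    C.measurableSet_prod_Ioo
  exact (C.continuousOn_normal.comp C.continuousOn_base fun _ hy => C.base_mem hy).comp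
    continuousOn_fst fun _ hp => hp.1

lemma modelFlux_mk {y : C.T} {t : ℝ} (hy : y ∈ Metric.ball 0 C.r) (ht : t ∈ Ioo 0 C.r) :
    C.modelFlux X φ (y, t) = φ (C.Ψ (y, t)) *
      inner ℝ (X (C.Ψ (y, 0) - t • ν (C.Ψ (y, 0)))) (ν (C.Ψ (y, 0))) := by
  rw [modelFlux, C.apply_eq _ (C.prod_Ioo_subset_source ⟨hy, ht⟩)]

lemma ae_abs_modelFlux_le {S : ℝ} (hS : ∀ x, |φ x| ≤ S)
    (hM : ∀ z ∈ frontier Ω, ∀ t ∈ Ioo 0 C.r, |inner ℝ (X (z - t • ν z)) (ν z)| ≤ M) :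
    ∀ᵐ p ∂C.model, |C.modelFlux X φ p| ≤ S * M := by
  rw [C.model_eq]
  filter_upwards [ae_restrict_mem C.measurableSet_prod_Ioo] with p hp
  rw [C.modelFlux_mk hp.1 hp.2, abs_mul]
  exact mul_le_mul (hS _) (hM _ (C.base_mem hp.1).2 _ hp.2) (abs_nonneg _)
    ((abs_nonneg _).trans (hS 0))

lemma ae_tendsto_modelFlux (hX : HasNormalTrace Ω ν X q) (hφ : Continuous φ) :
    ∀ᵐ y ∂C.baseModel, Tendsto (fun t => C.modelFlux X φ (y, t)) (𝓝[>] 0)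
      (𝓝 (φ (C.Ψ (y, 0)) * q (C.Ψ (y, 0)))) := by
  filter_upwards [ae_restrict_mem measurableSet_ball] with y hy
  have hline : Tendsto (fun t : ℝ => C.Ψ (y, t)) (𝓝[>] 0) (𝓝 (C.Ψ (y, 0))) := by
    have hmk : ContinuousAt (fun t : ℝ => (y, t)) 0 := by fun_prop
    exact (ContinuousAt.comp (C.Ψ.continuousAt (C.mk_zero_mem_source hy)) hmk).mono_left
      nhdsWithin_le_nhds
  refine (((hφ.tendsto _).comp hline).mul (hX.tendsto _ (C.base_mem hy).2)).congr' ?_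
  filter_upwards [Ioo_mem_nhdsGT C.r_pos] with t ht
  exact (C.modelFlux_mk hy ht).symm

end CollarChart

namespace CollarChart

variable {E : Type*} [NormedAddCommGroup E] [InnerProductSpace ℝ E] [CompleteSpace E]
  [FiniteDimensional ℝ E] [MeasurableSpace E] [BorelSpace E]
  {Ω : Set E} {ν X : E → E} {q f φ F : E → ℝ} {z₀ : E} {η δ M : ℝ} (C : CollarChart Ω ν z₀ η)

lemma layerFlux_apply {p : C.T × ℝ} (hp : p ∈ C.Ψ.source) :
    C.layerFlux X φ δ (C.Ψ p) = layerKernel δ p.2 * C.modelFlux X φ p := by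
  have hgrad : ∇ C.depth (C.Ψ p) = -ν (C.Ψ (p.1, 0)) := C.gradient_snd_symm p hp
  rw [layerFlux, C.depth_apply hp, hgrad, neg_neg, modelFlux]

lemma ae_layerFlux_apply : ∀ᵐ p ∂C.model,
    C.layerFlux X φ δ (C.Ψ p) = layerKernel δ p.2 * C.modelFlux X φ p := by
  rw [C.model_eq]
  filter_upwards [ae_restrict_mem C.measurableSet_prod_Ioo] with p hp
  exact C.layerFlux_apply (C.prod_Ioo_subset_source hp)

lemma abs_setIntegral_layerFlux_sub_le (hη : 0 ≤ η) (hδ : 0 < δ)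
    (hint : IntegrableOn (C.layerFlux X φ δ) (C.Ψ.target ∩ Ω)) :
    |(∫ x in C.Ψ.target ∩ Ω, C.layerFlux X φ δ x)
        - ∫ p, layerKernel δ p.2 * C.modelFlux X φ p ∂C.model|
      ≤ η * ∫ p, layerKernel δ p.2 * |C.modelFlux X φ p| ∂C.model := by
  have hmap : Integrable (C.layerFlux X φ δ) (C.model.map C.Ψ) :=
    hint.integrable.of_measure_le_smul ENNReal.ofReal_ne_top C.map_le_volume
  have h := abs_integral_sub_integral_le hη C.volume_le_map C.map_le_volume hmap
  have habs : ∀ᵐ p ∂C.model, |C.layerFlux X φ δ (C.Ψ p)|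
      = layerKernel δ p.2 * |C.modelFlux X φ p| := by
    filter_upwards [C.ae_layerFlux_apply (X := X) (φ := φ) (δ := δ)] with p hp
    rw [hp, abs_mul, abs_of_nonneg (layerKernel_nonneg hδ _)]
  rwa [integral_map C.aemeasurable_model hmap.aestronglyMeasurable,
    integral_map C.aemeasurable_model hmap.abs.aestronglyMeasurable,
    integral_congr_ae C.ae_layerFlux_apply, integral_congr_ae habs] at h

lemma abs_setIntegral_weakDivIntegrand_sub_le (hη : 0 ≤ η) (hΩ : IsOpen Ω)
    (hX : HasNormalTrace Ω ν X q) (hf : IntegrableOn f Ω) (hdiv : HasWeakDiv Ω X f)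
    (hφ : ContDiff ℝ 1 φ) (hc : HasCompactSupport φ) (hs : tsupport φ ⊆ C.Ψ.target)
    (hM : ∀ z ∈ frontier Ω, ∀ t ∈ Ioo 0 C.r, |inner ℝ (X (z - t • ν z)) (ν z)| ≤ M) :
    |(∫ x in Ω, weakDivIntegrand X f φ x)
        - ∫ y, φ (C.Ψ (y, 0)) * q (C.Ψ (y, 0)) ∂C.baseModel|
      ≤ η * ∫ y, |φ (C.Ψ (y, 0)) * q (C.Ψ (y, 0))| ∂C.baseModel := by
  obtain ⟨S, hS⟩ := hφ.continuous.bounded_above_of_compact_support hc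
  have hmeas := C.aestronglyMeasurable_modelFlux hX.continuousOn hφ.continuous
  have hbound := C.ae_abs_modelFlux_le hS hM
  have hlim := C.ae_tendsto_modelFlux hX hφ.continuous
  have hH := (hX.integrableOn_weakDivIntegrand hΩ hf hφ hc).mono_set
    (inter_subset_right (s := C.Ψ.target))
  rw [← setIntegral_weakDivIntegrand_inter hΩ hs]
  refine le_of_tendsto_of_tendsto
    ((C.tendsto_setIntegral_mul_layerCut_depth hΩ hH).sub
      (tendsto_integral_prod_layerKernel_mul C.r_pos hmeas hbound hlim)).abs
    ((tendsto_integral_prod_layerKernel_mul C.r_pos (continuous_abs.comp_aestronglyMeasurable hmeas)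
      (hbound.mono fun p hp => (abs_abs _).trans_le hp)
      (hlim.mono fun y hy => hy.abs)).const_mul η) ?_
  filter_upwards [self_mem_nhdsWithin] with δ hδ
  obtain ⟨hint, heq⟩ := C.integrableOn_layerFlux_and_integral_eq hδ hΩ hX hf hdiv hφ hc hs
  rw [← heq]
  exact C.abs_setIntegral_layerFlux_sub_le hη hδ hint

lemma integrable_base (hF : IntegrableOn F (C.Ψ.target ∩ frontier Ω)
      μHE[Module.finrank ℝ E - 1]) :
    Integrable F (C.baseModel.map fun y => C.Ψ (y, 0)) :=
  hF.integrable.of_measure_le_smul ENNReal.ofReal_ne_top C.map_le_surface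

lemma abs_setIntegral_frontier_sub_le (hη : 0 ≤ η)
    (hF : IntegrableOn F (C.Ψ.target ∩ frontier Ω) μHE[Module.finrank ℝ E - 1]) :
    |(∫ z in C.Ψ.target ∩ frontier Ω, F z ∂μHE[Module.finrank ℝ E - 1])
        - ∫ y, F (C.Ψ (y, 0)) ∂C.baseModel| ≤ η * ∫ y, |F (C.Ψ (y, 0))| ∂C.baseModel := by
  have hmap := C.integrable_base hF
  have h := abs_integral_sub_integral_le hη C.surface_le_map C.map_le_surface hmap
  rwa [integral_map C.aemeasurable_base hmap.aestronglyMeasurable,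
    integral_map C.aemeasurable_base hmap.abs.aestronglyMeasurable] at h

lemma integral_abs_base_le (hη : 0 ≤ η)
    (hF : IntegrableOn F (C.Ψ.target ∩ frontier Ω) μHE[Module.finrank ℝ E - 1]) :
    ∫ y, |F (C.Ψ (y, 0))| ∂C.baseModel
      ≤ (1 + η) * ∫ z in C.Ψ.target ∩ frontier Ω, |F z| ∂μHE[Module.finrank ℝ E - 1] := by
  rw [← integral_map C.aemeasurable_base (C.integrable_base hF).abs.aestronglyMeasurable]
  exact integral_le_of_le_smul hη C.map_le_surface hF.abs fun _ => abs_nonneg _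

lemma sub_smul_normal_mem {z : E} (hz : z ∈ C.Ψ.target ∩ frontier Ω) {t : ℝ}
    (ht : t ∈ Ioo 0 C.r) : z - t • ν z ∈ Ω := by
  rw [C.target_inter_frontier_eq] at hz
  obtain ⟨y, hy, rfl⟩ := hz
  have hp := C.prod_Ioo_subset_source (mk_mem_prod hy ht)
  rw [← C.apply_eq _ hp]
  exact (C.mem_iff _ hp).2 ht.1

lemma aestronglyMeasurable_trace (hX : HasNormalTrace Ω ν X q) (μ : Measure E) :
    AEStronglyMeasurable q (μ.restrict (C.Ψ.target ∩ frontier Ω)) := by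
  obtain ⟨u, -, hu, hlim⟩ := exists_seq_strictAnti_tendsto' C.r_pos
  have hu0 : Tendsto u atTop (𝓝[>] 0) :=
    tendsto_nhdsWithin_iff.2 ⟨hlim, .of_forall fun k => (hu k).1⟩
  have hm := C.measurableSet_target_inter_frontier
  refine aestronglyMeasurable_of_tendsto_ae atTop
    (f := fun k z => inner ℝ (X (z - u k • ν z)) (ν z)) (fun k => ?_)
    (ae_restrict_of_forall_mem hm fun z hz => (hX.tendsto z hz.2).comp hu0)
  refine ContinuousOn.aestronglyMeasurable (ContinuousOn.inner (hX.continuousOn.comp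
    (continuousOn_id.sub (continuousOn_const.smul C.continuousOn_normal)) ?_)
    C.continuousOn_normal) hm
  exact fun z hz => C.sub_smul_normal_mem hz (hu k)

end CollarChart

section Frontier

variable {E : Type*} [NormedAddCommGroup E] [InnerProductSpace ℝ E] [CompleteSpace E]
  [FiniteDimensional ℝ E] [MeasurableSpace E] [BorelSpace E]
  {Ω : Set E} {ν X : E → E} {q : E → ℝ}

lemma exists_finite_collar_cover (hF : IsCompact (frontier Ω))
    (hbd : ∀ z ∈ frontier Ω, HasC2BoundaryAt Ω ν z) :
    ∃ (t : Finset (frontier Ω)) (C : ∀ z : frontier Ω, CollarChart Ω ν z 1),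
      frontier Ω = ⋃ z : t, ((C z).Ψ.target ∩ frontier Ω) := by
  choose C _ using fun z : frontier Ω => exists_collarChart z.2 (hbd z z.2) one_pos one_pos
  obtain ⟨t, ht⟩ := hF.elim_finite_subcover (fun z => (C z).Ψ.target)
    (fun z => (C z).Ψ.open_target)
    fun z hz => mem_iUnion.2 ⟨⟨z, hz⟩, (C ⟨z, hz⟩).center_mem_target⟩
  refine ⟨t, C, Subset.antisymm (fun z hz => ?_) (iUnion_subset fun z => inter_subset_right)⟩
  obtain ⟨w, hw, hzw⟩ := mem_iUnion₂.1 (ht hz)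
  exact mem_iUnion.2 ⟨⟨w, hw⟩, hzw, hz⟩

lemma isFiniteMeasure_restrict_frontier (hF : IsCompact (frontier Ω))
    (hbd : ∀ z ∈ frontier Ω, HasC2BoundaryAt Ω ν z) :
    IsFiniteMeasure ((μHE[Module.finrank ℝ E - 1] : Measure E).restrict (frontier Ω)) := by
  obtain ⟨t, C, hC⟩ := exists_finite_collar_cover hF hbd
  rw [isFiniteMeasure_restrict, ← lt_top_iff_ne_top, hC]
  exact (measure_iUnion_fintype_le _ _).trans_lt
    (ENNReal.sum_lt_top.2 fun z _ => (C z).surface_lt_top)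

lemma HasNormalTrace.integrableOn_trace (hX : HasNormalTrace Ω ν X q)
    (hF : IsCompact (frontier Ω)) (hbd : ∀ z ∈ frontier Ω, HasC2BoundaryAt Ω ν z) :
    IntegrableOn q (frontier Ω) μHE[Module.finrank ℝ E - 1] := by
  have := isFiniteMeasure_restrict_frontier hF hbd
  obtain ⟨M, δ₀, hδ₀, hM⟩ := hX.bounded
  have hmeas : AEStronglyMeasurable q
      ((μHE[Module.finrank ℝ E - 1] : Measure E).restrict (frontier Ω)) := by
    obtain ⟨t, C, hC⟩ := exists_finite_collar_cover hF hbd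
    rw [hC]
    exact AEStronglyMeasurable.iUnion fun z => (C z).aestronglyMeasurable_trace hX _
  exact Integrable.of_bound hmeas M (ae_restrict_of_forall_mem
    isClosed_frontier.measurableSet fun z hz => hX.abs_le hz hδ₀ (hM z hz))

end Frontier

section GreenFormula

variable {E : Type*} [NormedAddCommGroup E] [InnerProductSpace ℝ E] [CompleteSpace E]
  [FiniteDimensional ℝ E] [MeasurableSpace E] [BorelSpace E]
  {Ω : Set E} {ν X : E → E} {q f φ : E → ℝ} {η M : ℝ}

/-- The error in the Gauss–Green formula for `φ X`, where `X` has divergence `f` in `Ω` and normal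
trace `q` on the boundary. -/
def greenDefect (Ω : Set E) (X : E → E) (f q φ : E → ℝ) : ℝ :=
  (∫ x in Ω, weakDivIntegrand X f φ x) -
    ∫ z in frontier Ω, φ z * q z ∂μHE[Module.finrank ℝ E - 1]

lemma setIntegral_target_inter_frontier {z₀ : E} (C : CollarChart Ω ν z₀ η) {F : E → ℝ}
    (hF : ∀ z ∉ C.Ψ.target, F z = 0) :
    ∫ z in C.Ψ.target ∩ frontier Ω, F z ∂μHE[Module.finrank ℝ E - 1]
      = ∫ z in frontier Ω, F z ∂μHE[Module.finrank ℝ E - 1] :=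
  (setIntegral_eq_of_subset_of_forall_sdiff_eq_zero isClosed_frontier.measurableSet
    inter_subset_right fun _ hz => hF _ fun h => hz.2 ⟨h, hz.1⟩).symm

lemma CollarChart.abs_greenDefect_le {z₀ : E} (C : CollarChart Ω ν z₀ η) (hη : 0 ≤ η)
    (hΩ : IsOpen Ω) (hX : HasNormalTrace Ω ν X q)
    (hq : IntegrableOn q (frontier Ω) μHE[Module.finrank ℝ E - 1]) (hf : IntegrableOn f Ω)
    (hdiv : HasWeakDiv Ω X f)
    (hM : ∀ z ∈ frontier Ω, ∀ t ∈ Ioo 0 C.r, |inner ℝ (X (z - t • ν z)) (ν z)| ≤ M)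
    (hφ : ContDiff ℝ 1 φ) (hc : HasCompactSupport φ) (hs : tsupport φ ⊆ C.Ψ.target) :
    |greenDefect Ω X f q φ| ≤
      2 * η * (1 + η) * ∫ z in frontier Ω, |φ z * q z| ∂μHE[Module.finrank ℝ E - 1] := by
  have hF : IntegrableOn (fun z => φ z * q z) (C.Ψ.target ∩ frontier Ω)
      μHE[Module.finrank ℝ E - 1] :=
    IntegrableOn.mono_set (integrable_hasCompactSupport_mul hq hφ.continuous hc)
      inter_subset_right
  have hzero : ∀ z ∉ C.Ψ.target, φ z * q z = 0 := fun z hz => by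
    rw [image_eq_zero_of_notMem_tsupport fun h => hz (hs h), zero_mul]
  have hvolume := C.abs_setIntegral_weakDivIntegrand_sub_le hη hΩ hX hf hdiv hφ hc hs hM
  have hsurface := C.abs_setIntegral_frontier_sub_le hη hF
  have hbase := C.integral_abs_base_le hη hF
  rw [setIntegral_target_inter_frontier C hzero] at hsurface
  rw [setIntegral_target_inter_frontier C fun z hz => abs_eq_zero.2 (hzero z hz)] at hbase
  rw [greenDefect]
  set I := ∫ y, φ (C.Ψ (y, 0)) * q (C.Ψ (y, 0)) ∂C.baseModel
  set J := ∫ y, |φ (C.Ψ (y, 0)) * q (C.Ψ (y, 0))| ∂C.baseModel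
  calc _ ≤ η * J + η * J := (abs_sub_le _ I _).trans
        (add_le_add hvolume ((abs_sub_comm _ _).trans_le hsurface))
    _ = 2 * η * J := by ring
    _ ≤ _ := by rw [mul_assoc (2 * η)]; gcongr

lemma greenDefect_eq_zero_of_tsupport_subset (hΩ : IsOpen Ω) (hdiv : HasWeakDiv Ω X f)
    (hφ : ContDiff ℝ 1 φ) (hc : HasCompactSupport φ) (hs : tsupport φ ⊆ Ω) :
    greenDefect Ω X f q φ = 0 := by
  rw [greenDefect, hdiv φ hφ hc hs, zero_sub, neg_eq_zero]
  refine setIntegral_eq_zero_of_forall_eq_zero fun z hz => ?_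
  have hzφ : z ∉ tsupport φ := fun h => (hΩ.frontier_eq ▸ hz).2 (hs h)
  rw [image_eq_zero_of_notMem_tsupport hzφ, zero_mul]

lemma greenDefect_eq_zero_of_tsupport_subset_compl (hs : tsupport φ ⊆ (closure Ω)ᶜ) :
    greenDefect Ω X f q φ = 0 := by
  have hout : ∀ z ∈ closure Ω, z ∉ tsupport φ := fun z hz h => hs h hz
  rw [greenDefect, setIntegral_eq_zero_of_forall_eq_zero fun z hz =>
      weakDivIntegrand_eq_zero_of_notMem_tsupport (hout z (subset_closure hz)),
    setIntegral_eq_zero_of_forall_eq_zero fun z hz => ?_, sub_zero]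
  rw [image_eq_zero_of_notMem_tsupport (hout z (frontier_subset_closure hz)), zero_mul]

lemma exists_nhds_abs_greenDefect_le (hΩ : IsOpen Ω)
    (hbd : ∀ z ∈ frontier Ω, HasC2BoundaryAt Ω ν z) (hX : HasNormalTrace Ω ν X q)
    (hq : IntegrableOn q (frontier Ω) μHE[Module.finrank ℝ E - 1]) (hf : IntegrableOn f Ω)
    (hdiv : HasWeakDiv Ω X f) (hη : 0 < η) (x : E) :
    ∃ U : Set E, IsOpen U ∧ x ∈ U ∧ ∀ φ : E → ℝ, ContDiff ℝ 1 φ → HasCompactSupport φ →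
      tsupport φ ⊆ U → |greenDefect Ω X f q φ| ≤
        2 * η * (1 + η) * ∫ z in frontier Ω, |φ z * q z| ∂μHE[Module.finrank ℝ E - 1] := by
  have hnonneg : ∀ φ : E → ℝ, 0 ≤
      2 * η * (1 + η) * ∫ z in frontier Ω, |φ z * q z| ∂μHE[Module.finrank ℝ E - 1] :=
    fun φ => mul_nonneg (by positivity) (integral_nonneg fun _ => abs_nonneg _)
  by_cases hxF : x ∈ frontier Ω
  · obtain ⟨M, δ₀, hδ₀, hM⟩ := hX.bounded
    obtain ⟨C, hC⟩ := exists_collarChart hxF (hbd x hxF) hη hδ₀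
    exact ⟨C.Ψ.target, C.Ψ.open_target, C.center_mem_target, fun φ hφ hc hs =>
      C.abs_greenDefect_le hη.le hΩ hX hq hf hdiv
        (fun z hz t ht => hM z hz t ⟨ht.1, ht.2.trans_le hC⟩) hφ hc hs⟩
  by_cases hxΩ : x ∈ Ω
  · refine ⟨Ω, hΩ, hxΩ, fun φ hφ hc hs => ?_⟩
    rw [greenDefect_eq_zero_of_tsupport_subset hΩ hdiv hφ hc hs, abs_zero]
    exact hnonneg φ
  · have hx : x ∈ (closure Ω)ᶜ := fun h => hxF (hΩ.frontier_eq ▸ ⟨h, hxΩ⟩)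
    refine ⟨(closure Ω)ᶜ, isClosed_closure.isOpen_compl, hx, fun φ _ _ hs => ?_⟩
    rw [greenDefect_eq_zero_of_tsupport_subset_compl hs, abs_zero]
    exact hnonneg φ

open scoped Manifold in
omit [CompleteSpace E] [MeasurableSpace E] [BorelSpace E] in
lemma exists_finset_sum_eq_of_isOpen_nhds (hφ : ContDiff ℝ 1 φ) (hc : HasCompactSupport φ)
    {U : E → Set E} (hU : ∀ x, IsOpen (U x)) (hxU : ∀ x, x ∈ U x) :
    ∃ (t : Finset E) (u : t → E → ℝ), (∀ i, ContDiff ℝ 1 (u i)) ∧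
      (∀ i, HasCompactSupport (u i)) ∧ (∀ i, tsupport (u i) ⊆ U i) ∧
      (∀ x, ∑ i, u i x = φ x) ∧ ∀ x, ∑ i, |u i x| = |φ x| := by
  obtain ⟨t, ht⟩ := hc.isCompact.elim_finite_subcover U hU fun x _ => mem_iUnion.2 ⟨x, hxU x⟩
  obtain ⟨ρ, hρ⟩ := SmoothPartitionOfUnity.exists_isSubordinate 𝓘(ℝ, E) (isClosed_tsupport φ)
    (fun i : t => U i) (fun i => hU i) (ht.trans (iUnion_subtype (· ∈ t) fun i => U i).ge)
  have hsum : ∀ x, ∀ a : ℝ, (x ∉ tsupport φ → a = 0) → ∑ i, ρ i x * a = a := by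
    intro x a ha
    by_cases hx : x ∈ tsupport φ
    · rw [← Finset.sum_mul, ← finsum_eq_sum_of_fintype, ρ.sum_eq_one hx, one_mul]
    · simp only [ha hx, mul_zero, Finset.sum_const_zero]
  refine ⟨t, fun i x => ρ i x * φ x,
    fun i => ((ρ i).contMDiff.contDiff.of_le (by simp)).mul hφ, fun i => hc.mul_left,
    fun i => (tsupport_mul_subset_left).trans (hρ i),
    fun x => hsum x _ image_eq_zero_of_notMem_tsupport, fun x => ?_⟩
  simp only [abs_mul, abs_of_nonneg (ρ.nonneg _ x)]
  exact hsum x _ fun hx => by rw [image_eq_zero_of_notMem_tsupport hx, abs_zero]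

variable {ι : Type*} [Fintype ι] {u : ι → E → ℝ}

omit [FiniteDimensional ℝ E] [MeasurableSpace E] [BorelSpace E] in
lemma weakDivIntegrand_sum (hu : ∀ i, ContDiff ℝ 1 (u i)) (x : E) :
    weakDivIntegrand X f (fun x => ∑ i, u i x) x = ∑ i, weakDivIntegrand X f (u i) x := by
  have hgrad : ∇ (fun x => ∑ i, u i x) x = ∑ i, ∇ (u i) x := by
    simp only [gradient]
    rw [fderiv_fun_sum fun i _ => (hu i).differentiable one_ne_zero x, map_sum]
  simp only [weakDivIntegrand, hgrad, inner_sum, Finset.mul_sum, Finset.sum_add_distrib]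

lemma greenDefect_sum (hΩ : IsOpen Ω) (hX : HasNormalTrace Ω ν X q)
    (hq : IntegrableOn q (frontier Ω) μHE[Module.finrank ℝ E - 1]) (hf : IntegrableOn f Ω)
    (hu : ∀ i, ContDiff ℝ 1 (u i)) (hc : ∀ i, HasCompactSupport (u i)) :
    greenDefect Ω X f q (fun x => ∑ i, u i x) = ∑ i, greenDefect Ω X f q (u i) := by
  have hsurface : ∀ i, IntegrableOn (fun z => u i z * q z) (frontier Ω)
      μHE[Module.finrank ℝ E - 1] := fun i =>
    integrable_hasCompactSupport_mul hq (hu i).continuous (hc i)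
  simp only [greenDefect, weakDivIntegrand_sum hu, Finset.sum_mul]
  rw [integral_finsetSum _ fun i _ => hX.integrableOn_weakDivIntegrand hΩ hf (hu i) (hc i),
    integral_finsetSum _ fun i _ => hsurface i, Finset.sum_sub_distrib]

lemma abs_greenDefect_le (hΩ : IsOpen Ω) (hbd : ∀ z ∈ frontier Ω, HasC2BoundaryAt Ω ν z)
    (hX : HasNormalTrace Ω ν X q)
    (hq : IntegrableOn q (frontier Ω) μHE[Module.finrank ℝ E - 1]) (hf : IntegrableOn f Ω)
    (hdiv : HasWeakDiv Ω X f) (hφ : ContDiff ℝ 1 φ) (hc : HasCompactSupport φ) (hη : 0 < η) :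
    |greenDefect Ω X f q φ| ≤
      2 * η * (1 + η) * ∫ z in frontier Ω, |φ z * q z| ∂μHE[Module.finrank ℝ E - 1] := by
  choose U hU hxU hle using exists_nhds_abs_greenDefect_le hΩ hbd hX hq hf hdiv hη
  obtain ⟨t, u, hu, hcu, hsu, hsum, habs⟩ := exists_finset_sum_eq_of_isOpen_nhds hφ hc hU hxU
  have hint : ∀ i, IntegrableOn (fun z => |u i z * q z|) (frontier Ω)
      μHE[Module.finrank ℝ E - 1] := fun i =>
    (integrable_hasCompactSupport_mul hq (hu i).continuous (hcu i)).abs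
  calc |greenDefect Ω X f q φ| = |∑ i, greenDefect Ω X f q (u i)| := by
        rw [← greenDefect_sum hΩ hX hq hf hu hcu, funext hsum]
    _ ≤ ∑ i, |greenDefect Ω X f q (u i)| := Finset.abs_sum_le_sum_abs _ _
    _ ≤ ∑ i, 2 * η * (1 + η) *
          ∫ z in frontier Ω, |u i z * q z| ∂μHE[Module.finrank ℝ E - 1] :=
        Finset.sum_le_sum fun i _ => hle i (u i) (hu i) (hcu i) (hsu i)
    _ = _ := by
        rw [← Finset.mul_sum, ← integral_finsetSum _ fun i _ => hint i]
        simp only [abs_mul, ← Finset.sum_mul, habs]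

theorem green_formula (hΩ : IsOpen Ω) (hF : IsCompact (frontier Ω))
    (hbd : ∀ z ∈ frontier Ω, HasC2BoundaryAt Ω ν z) (hX : HasNormalTrace Ω ν X q)
    (hf : IntegrableOn f Ω) (hdiv : HasWeakDiv Ω X f) (hφ : ContDiff ℝ 1 φ)
    (hc : HasCompactSupport φ) :
    ∫ x in Ω, weakDivIntegrand X f φ x
      = ∫ z in frontier Ω, φ z * q z ∂μHE[Module.finrank ℝ E - 1] := by
  have hq := hX.integrableOn_trace hF hbd
  have hlim : Tendsto (fun η : ℝ => 2 * η * (1 + η) *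
      ∫ z in frontier Ω, |φ z * q z| ∂μHE[Module.finrank ℝ E - 1]) (𝓝[>] 0) (𝓝 0) := by
    have hcont : Continuous fun η : ℝ => 2 * η * (1 + η) *
      ∫ z in frontier Ω, |φ z * q z| ∂μHE[Module.finrank ℝ E - 1] := by fun_prop
    simpa only [mul_zero, zero_mul] using (hcont.tendsto 0).mono_left nhdsWithin_le_nhds
  have hzero : |greenDefect Ω X f q φ| ≤ 0 := ge_of_tendsto hlim <|
    eventually_nhdsWithin_of_forall fun _ hη => abs_greenDefect_le hΩ hbd hX hq hf hdiv hφ hc hη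
  exact sub_eq_zero.1 (abs_nonpos_iff.1 hzero)

end GreenFormula

section Sublevel

variable {E : Type*} [NormedAddCommGroup E] [InnerProductSpace ℝ E] [CompleteSpace E]
  {D : Set E} {ψ : E → ℝ} {z w : E}

omit [CompleteSpace E] in
lemma tendsto_add_smul (z w : E) : Tendsto (fun s : ℝ => z + s • w) (𝓝[>] 0) (𝓝 z) := by
  have hcont : Continuous fun s : ℝ => z + s • w := by fun_prop
  simpa using (hcont.tendsto 0).mono_left nhdsWithin_le_nhds

lemma gradient_fun_neg (ψ : E → ℝ) (z : E) : ∇ (fun x => -ψ x) z = -∇ ψ z := by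
  simp only [gradient, fderiv_fun_neg, map_neg]

lemma eventually_add_smul_neg (hψ : DifferentiableAt ℝ ψ z) (hz : ψ z = 0)
    (hw : inner ℝ (∇ ψ z) w < 0) : ∀ᶠ s : ℝ in 𝓝[>] 0, ψ (z + s • w) < 0 := by
  have hderiv : HasDerivAt (fun s : ℝ => ψ (z + s • w)) (inner ℝ (∇ ψ z) w) 0 := by
    have hline : HasDerivAt (fun s : ℝ => z + s • w) w 0 := by
      simpa using ((hasDerivAt_id (0 : ℝ)).smul_const w).const_add z
    have hψ' : HasFDerivAt ψ (innerSL ℝ (∇ ψ z)) (z + (0 : ℝ) • w) := by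
      rw [zero_smul, add_zero]
      exact hψ.hasGradientAt.hasFDerivAt
    exact hψ'.comp_hasDerivAt 0 hline
  have hslope := ((hasDerivAt_iff_tendsto_slope.1 hderiv).mono_left
    (nhdsWithin_mono _ fun s (hs : 0 < s) => hs.ne')).eventually_lt_const hw
  filter_upwards [hslope, self_mem_nhdsWithin] with s hs (hpos : 0 < s)
  rw [slope_def_field] at hs
  simp only [zero_smul, add_zero, hz, sub_zero] at hs
  exact neg_of_div_neg_left hs hpos.le

lemma eventually_sub_smul_unitGrad_mem (hψ : DifferentiableAt ℝ ψ z) (h0 : ∇ ψ z ≠ 0)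
    (hz : ψ z = 0) (hD : ∀ᶠ y in 𝓝 z, y ∈ D ↔ ψ y < 0) :
    ∀ᶠ s : ℝ in 𝓝[>] 0, z - s • unitGrad ψ z ∈ D := by
  have hdesc : inner ℝ (∇ ψ z) (-unitGrad ψ z) < 0 := by
    rw [inner_neg_right, inner_gradient_unitGrad h0, neg_lt_zero, norm_pos_iff]
    exact h0
  filter_upwards [eventually_add_smul_neg hψ hz hdesc,
    (tendsto_add_smul z (-unitGrad ψ z)).eventually hD] with s hs hmem
  rw [sub_eq_add_neg, ← smul_neg]
  exact hmem.2 hs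

lemma mem_closure_iff_of_sublevel (hψ : DifferentiableAt ℝ ψ z) (h0 : ∇ ψ z ≠ 0)
    (hD : ∀ᶠ y in 𝓝 z, y ∈ D ↔ ψ y < 0) : z ∈ closure D ↔ ψ z ≤ 0 := by
  refine ⟨fun hz => ?_, fun hz => ?_⟩
  · by_contra hpos
    obtain ⟨y, hyD, hy, hmem⟩ := ((mem_closure_iff_frequently.1 hz).and_eventually
      ((hψ.continuousAt.eventually_const_lt (not_le.1 hpos)).and hD)).exists
    exact (hmem.1 hyD).not_gt hy
  · rcases hz.lt_or_eq with hneg | hzero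
    · exact subset_closure (hD.self_of_nhds.2 hneg)
    · have hline : Tendsto (fun s : ℝ => z - s • unitGrad ψ z) (𝓝[>] 0) (𝓝 z) := by
        simpa [sub_eq_add_neg] using tendsto_add_smul z (-unitGrad ψ z)
      exact mem_closure_of_tendsto hline (eventually_sub_smul_unitGrad_mem hψ h0 hzero hD)

-- If the two normals `a ≠ b` differed, the direction `b - a` would enter the sublevel set of `ψ₁`
-- and leave the one of `ψ₂`.
lemma unitGrad_eq_of_sublevel {ψ₁ ψ₂ : E → ℝ} (hz : z ∈ frontier D)
    (hψ₁ : DifferentiableAt ℝ ψ₁ z) (hψ₂ : DifferentiableAt ℝ ψ₂ z)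
    (hD₁ : ∀ᶠ y in 𝓝 z, y ∈ D ↔ ψ₁ y < 0) (hD₂ : ∀ᶠ y in 𝓝 z, y ∈ D ↔ ψ₂ y < 0)
    (h₁ : ∇ ψ₁ z ≠ 0) (h₂ : ∇ ψ₂ z ≠ 0) : unitGrad ψ₁ z = unitGrad ψ₂ z := by
  by_contra hne
  set a := unitGrad ψ₁ z
  set b := unitGrad ψ₂ z
  have hab : inner ℝ a b < 1 :=
    lt_of_le_of_ne
      (by simpa [a, b, norm_unitGrad h₁, norm_unitGrad h₂] using real_inner_le_norm a b)
      fun h => hne ((inner_eq_one_iff_of_norm_eq_one (norm_unitGrad h₁) (norm_unitGrad h₂)).1 h)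
  have henter : inner ℝ (∇ ψ₁ z) (b - a) < 0 := by
    rw [← norm_smul_unitGrad h₁, real_inner_smul_left, inner_sub_right, inner_unitGrad_self h₁]
    exact mul_neg_of_pos_of_neg (norm_pos_iff.2 h₁) (sub_neg.2 hab)
  have hleave : inner ℝ (∇ (fun x => -ψ₂ x) z) (b - a) < 0 := by
    rw [gradient_fun_neg, inner_neg_left, ← norm_smul_unitGrad h₂, real_inner_smul_left,
      inner_sub_right, inner_unitGrad_self h₂, real_inner_comm]
    exact neg_lt_zero.2 (mul_pos (norm_pos_iff.2 h₂) (sub_pos.2 hab))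
  have hzero₁ := eq_zero_of_mem_frontier hψ₁.continuousAt hD₁ hz
  have hzero₂ := eq_zero_of_mem_frontier hψ₂.continuousAt hD₂ hz
  obtain ⟨s, hs₁, hs₂, hmem₁, hmem₂⟩ := ((eventually_add_smul_neg hψ₁ hzero₁ henter).and
    ((eventually_add_smul_neg hψ₂.neg (by simp [hzero₂]) hleave).and
      ((tendsto_add_smul z (b - a)).eventually (hD₁.and hD₂)))).exists
  exact (neg_neg_iff_pos.1 hs₂).not_gt (hmem₂.1 (hmem₁.2 hs₁))

lemma HasC2BoundaryAt.eventually_mem {ν : E → E} (h : HasC2BoundaryAt D ν z)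
    (hz : z ∈ frontier D) : ∀ᶠ δ : ℝ in 𝓝[>] 0, z - δ • ν z ∈ D := by
  obtain ⟨U, hU, hzU, ψ, hψ, h0, hD, hν⟩ := h
  have hψz := (hψ.contDiffAt (hU.mem_nhds hzU)).differentiableAt two_ne_zero
  have hD' := (hU.eventually_mem hzU).mono hD
  rw [hν z ⟨hzU, hz⟩]
  have hzero := eq_zero_of_mem_frontier hψz.continuousAt hD' hz
  exact eventually_sub_smul_unitGrad_mem hψz h0 hzero hD'

lemma HasC2BoundaryAt.norm_eq_one {ν : E → E} (h : HasC2BoundaryAt D ν z)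
    (hz : z ∈ frontier D) : ‖ν z‖ = 1 := by
  obtain ⟨U, -, hzU, ψ, -, h0, -, hν⟩ := h
  rw [hν z ⟨hzU, hz⟩, norm_unitGrad h0]

end Sublevel

section OuterDomain

variable {κ : ℕ} {n : Fin (κ + 1) → ℕ} {A B D : Set (Space n)} {z : Space n}

/-- The set `D` has a `C²` boundary: near each boundary point it is the sublevel set of a `C²`
function whose gradient does not vanish there. -/
def HasC2Boundary (D : Set (Space n)) : Prop :=
  ∀ z₀ ∈ frontier D, ∃ U : Set (Space n), IsOpen U ∧ z₀ ∈ U ∧ ∃ ψ : Space n → ℝ,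
    ContDiffOn ℝ 2 ψ U ∧ ∇ ψ z₀ ≠ 0 ∧ ∀ z ∈ U, z ∈ D ↔ ψ z < 0

lemma HasC2HolderBoundary.hasC2Boundary {α : ℝ} (h : HasC2HolderBoundary α D) :
    HasC2Boundary D := fun z₀ hz₀ => by
  obtain ⟨U, hU, hzU, ψ, hψ, -, h0, hD⟩ := h z₀ hz₀
  exact ⟨U, hU, hzU, ψ, hψ, h0, hD⟩

/-- The geometric setting of Green's identities on the outer domain: two bounded sets with `C²`
boundaries and disjoint closures. -/
structure IsC2Pair (A B : Set (Space n)) : Prop where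
  bounded_left : Bornology.IsBounded A
  bounded_right : Bornology.IsBounded B
  boundary_left : HasC2Boundary A
  boundary_right : HasC2Boundary B
  disjoint_closure : Disjoint (closure A) (closure B)

lemma AdmissiblePair.isC2Pair (h : AdmissiblePair A B) : IsC2Pair A B := by
  obtain ⟨α, -, -, hA, hB⟩ := h.boundary
  refine ⟨h.bounded_left, h.bounded_right, hA.hasC2Boundary, hB.hasC2Boundary, ?_⟩
  obtain ⟨r, hr, hsep⟩ := h.separated
  rw [Set.disjoint_left]
  intro z hzA hzB
  obtain ⟨a, ha, hza⟩ := Metric.mem_closure_iff.1 hzA (r / 2) (half_pos hr)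
  obtain ⟨b, hb, hzb⟩ := Metric.mem_closure_iff.1 hzB (r / 2) (half_pos hr)
  linarith [hsep a ha b hb, dist_triangle_left a b z]

lemma outerDomain_comm (A B : Set (Space n)) : outerDomain A B = outerDomain B A := by
  rw [outerDomain, outerDomain, union_comm]

lemma isOpen_outerDomain (A B : Set (Space n)) : IsOpen (outerDomain A B) :=
  isClosed_closure.isOpen_compl

lemma IsOutwardNormal.eq_unitGrad {ψ : Space n → ℝ} {ν : Space n} (h : IsOutwardNormal D z ν)
    (hψ : DifferentiableAt ℝ ψ z) (h0 : ∇ ψ z ≠ 0) (hD : ∀ᶠ y in 𝓝 z, y ∈ D ↔ ψ y < 0) :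
    ν = unitGrad ψ z := by
  obtain ⟨hz, hν, V, hV, hzV, χ, hχ, hDχ, t, ht, hgrad⟩ := h
  have hχ0 : ∇ χ z ≠ 0 := by
    rw [hgrad]
    exact smul_ne_zero ht.ne' (norm_ne_zero_iff.1 (hν ▸ one_ne_zero))
  have hχν : unitGrad χ z = ν := by
    rw [unitGrad, hgrad, norm_smul, hν, mul_one, Real.norm_of_nonneg ht.le,
      inv_smul_smul₀ ht.ne']
  rw [← hχν]
  exact unitGrad_eq_of_sublevel hz ((hχ.contDiffAt (hV.mem_nhds hzV)).differentiableAt one_ne_zero)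
    hψ ((hV.eventually_mem hzV).mono hDχ) hD hχ0 h0

lemma outwardNormal_eq_unitGrad {U : Set (Space n)} {ψ : Space n → ℝ} (hz : z ∈ frontier D)
    (hU : IsOpen U) (hzU : z ∈ U) (hψ : ContDiffOn ℝ 1 ψ U) (h0 : ∇ ψ z ≠ 0)
    (hD : ∀ y ∈ U, y ∈ D ↔ ψ y < 0) : outwardNormal D z = unitGrad ψ z := by
  have hex : ∃ ν, IsOutwardNormal D z ν :=
    ⟨unitGrad ψ z, hz, norm_unitGrad h0, U, hU, hzU, ψ, hψ, hD, ‖∇ ψ z‖, norm_pos_iff.2 h0,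
      (norm_smul_unitGrad h0).symm⟩
  rw [outwardNormal, dif_pos hex]
  exact hex.choose_spec.eq_unitGrad
    ((hψ.contDiffAt (hU.mem_nhds hzU)).differentiableAt one_ne_zero) h0
    ((hU.eventually_mem hzU).mono hD)

lemma HasC2Boundary.exists_outerDomain_chart (hA : HasC2Boundary A) (hz : z ∈ frontier A)
    (hB : z ∉ closure B) :
    ∃ U : Set (Space n), IsOpen U ∧ z ∈ U ∧ ∃ ψ : Space n → ℝ, ContDiffOn ℝ 2 ψ U ∧
      (∀ y ∈ U, ∇ ψ y ≠ 0) ∧ ψ z = 0 ∧ ∀ y ∈ U, y ∈ outerDomain A B ↔ ψ y < 0 := by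
  obtain ⟨V, hV, hzV, χ, hχ, hχ0, hAχ⟩ := hA z hz
  have hdiff : ∀ y ∈ V, DifferentiableAt ℝ χ y := fun y hy =>
    (hχ.contDiffAt (hV.mem_nhds hy)).differentiableAt two_ne_zero
  have hopen : IsOpen (V ∩ ∇ χ ⁻¹' {0}ᶜ ∩ (closure B)ᶜ) :=
    ((continuousOn_gradient hV (hχ.of_le one_le_two)).isOpen_inter_preimage hV
      isOpen_compl_singleton).inter isClosed_closure.isOpen_compl
  refine ⟨_, hopen, ⟨⟨hzV, hχ0⟩, hB⟩, fun y => -χ y,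
    (hχ.mono (inter_subset_left.trans inter_subset_left)).neg, fun y hy => ?_, ?_, ?_⟩
  · rw [gradient_fun_neg]
    exact neg_ne_zero.2 hy.1.2
  · exact neg_eq_zero.2 (eq_zero_of_mem_frontier (hdiff z hzV).continuousAt
      ((hV.eventually_mem hzV).mono hAχ) hz)
  · rintro y ⟨⟨hyV, hy0⟩, hyB⟩
    rw [outerDomain, closure_union, mem_compl_iff, mem_union, or_iff_left hyB, neg_lt_zero,
      mem_closure_iff_of_sublevel (hdiff y hyV) hy0 ((hV.eventually_mem hyV).mono hAχ), not_le]

lemma HasC2Boundary.mem_frontier_outerDomain (hA : HasC2Boundary A) (hz : z ∈ frontier A)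
    (hB : z ∉ closure B) : z ∈ frontier (outerDomain A B) := by
  obtain ⟨U, hU, hzU, ψ, hψ, hψ0, hψz, hΩ⟩ := hA.exists_outerDomain_chart hz hB
  rw [(isOpen_outerDomain A B).frontier_eq, Set.mem_sdiff, hΩ z hzU, hψz,
    mem_closure_iff_of_sublevel ((hψ.contDiffAt (hU.mem_nhds hzU)).differentiableAt two_ne_zero)
      (hψ0 z hzU) ((hU.eventually_mem hzU).mono hΩ)]
  exact ⟨hψz.le, lt_irrefl 0⟩

lemma HasC2Boundary.hasC2BoundaryAt_outerDomain (hA : HasC2Boundary A) (hz : z ∈ frontier A)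
    (hB : z ∉ closure B) :
    HasC2BoundaryAt (outerDomain A B) (outwardNormal (outerDomain A B)) z := by
  obtain ⟨U, hU, hzU, ψ, hψ, hψ0, -, hΩ⟩ := hA.exists_outerDomain_chart hz hB
  exact ⟨U, hU, hzU, ψ, hψ, hψ0 z hzU, hΩ, fun y hy =>
    outwardNormal_eq_unitGrad hy.2 hU hy.1 (hψ.of_le one_le_two) (hψ0 y hy.1) hΩ⟩

lemma frontier_outerDomain_subset (A B : Set (Space n)) :
    frontier (outerDomain A B) ⊆ frontier A ∪ frontier B := by
  rw [outerDomain, frontier_compl]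
  exact frontier_closure_subset.trans ((frontier_union_subset A B).trans
    (union_subset_union inter_subset_left inter_subset_right))

namespace IsC2Pair

lemma symm (h : IsC2Pair A B) : IsC2Pair B A :=
  ⟨h.bounded_right, h.bounded_left, h.boundary_right, h.boundary_left, h.disjoint_closure.symm⟩

lemma frontier_left_subset (h : IsC2Pair A B) : frontier A ⊆ frontier (outerDomain A B) :=
  fun _ hz => h.boundary_left.mem_frontier_outerDomain hz
    (h.disjoint_closure.notMem_of_mem_left (frontier_subset_closure hz))

lemma frontier_right_subset (h : IsC2Pair A B) : frontier B ⊆ frontier (outerDomain A B) :=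
  outerDomain_comm B A ▸ h.symm.frontier_left_subset

lemma hasC2BoundaryAt (h : IsC2Pair A B) : ∀ z ∈ frontier (outerDomain A B),
    HasC2BoundaryAt (outerDomain A B) (outwardNormal (outerDomain A B)) z := by
  intro z hz
  rcases frontier_outerDomain_subset A B hz with hzA | hzB
  · exact h.boundary_left.hasC2BoundaryAt_outerDomain hzA
      (h.disjoint_closure.notMem_of_mem_left (frontier_subset_closure hzA))
  · rw [outerDomain_comm]
    exact h.boundary_right.hasC2BoundaryAt_outerDomain hzB
      (h.disjoint_closure.notMem_of_mem_right (frontier_subset_closure hzB))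

lemma isCompact_frontier (h : IsC2Pair A B) : IsCompact (frontier (outerDomain A B)) :=
  (h.bounded_left.isCompact_closure.union h.bounded_right.isCompact_closure).of_isClosed_subset
    isClosed_frontier ((frontier_outerDomain_subset A B).trans
      (union_subset_union frontier_subset_closure frontier_subset_closure))

end IsC2Pair

lemma surfaceMeasure_eq : surfaceMeasure n = μHE[Module.finrank ℝ (Space n) - 1] := by
  simp [surfaceMeasure]

end OuterDomain

section ExponentialIntegrability

variable {E : Type*} [NormedAddCommGroup E] [NormedSpace ℝ E] [FiniteDimensional ℝ E]
  [MeasurableSpace E] [BorelSpace E]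

lemma exp_neg_le_factorial_mul_rpow {x : ℝ} (hx : 0 < x) (N : ℕ) :
    Real.exp (-x) ≤ N.factorial * x ^ (-(N : ℝ)) := by
  rw [Real.exp_neg, Real.rpow_neg hx.le, Real.rpow_natCast, ← div_eq_mul_inv, ← inv_div]
  exact inv_anti₀ (by positivity) (Real.pow_div_factorial_le_exp x hx.le N)

lemma integrable_exp_neg_mul_norm (μ : Measure E) [μ.IsAddHaarMeasure] {a : ℝ} (ha : 0 < a) :
    Integrable (fun x => Real.exp (-(a * ‖x‖))) μ := by
  set N := Module.finrank ℝ E + 1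
  have hN : (Module.finrank ℝ E : ℝ) < N := by exact_mod_cast Nat.lt_succ_self _
  refine ((integrable_one_add_norm (μ := μ) hN).const_mul
    (Real.exp a * (N.factorial * a ^ (-(N : ℝ))))).mono'
    (by fun_prop : Continuous fun x : E => Real.exp (-(a * ‖x‖))).aestronglyMeasurable
    (ae_of_all _ fun x => ?_)
  have hpos : 0 < 1 + ‖x‖ := by positivity
  calc ‖Real.exp (-(a * ‖x‖))‖ = Real.exp a * Real.exp (-(a * (1 + ‖x‖))) := by
        rw [Real.norm_eq_abs, Real.abs_exp, ← Real.exp_add]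
        ring_nf
    _ ≤ Real.exp a * (N.factorial * (a * (1 + ‖x‖)) ^ (-(N : ℝ))) := by
        gcongr
        exact exp_neg_le_factorial_mul_rpow (mul_pos ha hpos) N
    _ = _ := by rw [Real.mul_rpow ha.le hpos.le, ← mul_assoc, ← mul_assoc, ← mul_assoc]

end ExponentialIntegrability

section Coefficients

variable {κ : ℕ} {n : Fin (κ + 1) → ℕ}

/-- The projection `hat` onto the diffusive block, as a continuous linear map. -/
def hatCLM : Space n →L[ℝ] EuclideanSpace ℝ (Fin (n 0)) :=
  LinearMap.toContinuousLinearMap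
    { toFun := hat
      map_add' := fun _ _ => rfl
      map_smul' := fun _ _ => rfl }

/-- The inclusion of the diffusive block, as the adjoint of the projection. -/
def unhat : EuclideanSpace ℝ (Fin (n 0)) →L[ℝ] Space n := hatCLM.adjoint

lemma inner_unhat (u : EuclideanSpace ℝ (Fin (n 0))) (v : Space n) :
    inner ℝ (unhat u) v = inner ℝ u (hat v) :=
  hatCLM.adjoint_inner_left v u

namespace Coefficients

variable (c : Coefficients κ n)

lemma inner_b (z v : Space n) : inner ℝ (c.b z) v = inner ℝ (c.bhat z) (hat v) := by
  simp [PiLp.inner_apply, Fintype.sum_sigma, Fin.sum_univ_succ, b, hat]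

lemma b_eq_unhat (z : Space n) : c.b z = unhat (c.bhat z) :=
  ext_inner_right ℝ fun v => by rw [inner_b, inner_unhat]

/-- The matrix `B`, as a continuous linear map. -/
def BmulCLM : Space n →L[ℝ] Space n :=
  LinearMap.toContinuousLinearMap
    { toFun := c.Bmul
      map_add' := fun u v => by
        ext ⟨j, i⟩
        induction j using Fin.cases with
        | zero => simp [Bmul]
        | succ j => exact congrFun ((c.Bblock j).mulVec_add (fun k => u ⟨_, k⟩) fun k => v ⟨_, k⟩) i
      map_smul' := fun a u => by
        ext ⟨j, i⟩
        induction j using Fin.cases with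
        | zero => simp [Bmul]
        | succ j => exact congrFun ((c.Bblock j).mulVec_smul a fun k => u ⟨_, k⟩) i }

lemma adjoint_b (z : Space n) : c.adjoint.b z = -c.b z := by
  rw [b_eq_unhat, b_eq_unhat, ← map_neg]
  rfl

lemma adjoint_Bmul (z : Space n) : c.adjoint.Bmul z = -c.Bmul z := by
  ext ⟨j, i⟩
  induction j using Fin.cases with
  | zero => simp [Bmul]
  | succ j => simp [Bmul, adjoint, Matrix.neg_mulVec]

lemma adjoint_drift (z : Space n) : c.adjoint.drift z = -c.drift z := by
  rw [drift, drift, adjoint_b, adjoint_Bmul, neg_add]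

lemma inner_Amul (z : Space n) (u v : EuclideanSpace ℝ (Fin (n 0))) :
    inner ℝ (c.Amul z u) v = ∑ i, ∑ j, c.Ahat z i j * u j * v i := by
  simp only [Amul, PiLp.inner_apply, Matrix.mulVec, dotProduct, RCLike.inner_apply, conj_trivial,
    Finset.sum_mul, mul_comm (v _)]

lemma inner_adjoint_Amul (z : Space n) (u v : EuclideanSpace ℝ (Fin (n 0))) :
    inner ℝ (c.adjoint.Amul z u) v = inner ℝ (c.Amul z v) u := by
  rw [inner_Amul, inner_Amul, Finset.sum_comm]
  simp only [adjoint, Matrix.transpose_apply, mul_right_comm]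

/-- The density of `ρ_ε` with respect to the Lebesgue measure. -/
def weight (ε : ℝ) (z : Space n) : ℝ := Real.exp (-(c.W z) / ε) / c.Z ε

lemma adjoint_weight (ε : ℝ) : c.adjoint.weight ε = c.weight ε := rfl

/-- The properties of the coefficients that enter the integrations by parts, for a fixed `ε`. -/
structure Regular (c : Coefficients κ n) (ε : ℝ) : Prop where
  A_continuous : ∀ i j, Continuous fun z => c.Ahat z i j
  A_bounded : ∃ M : ℝ, ∀ z i j, |c.Ahat z i j| ≤ M
  b_continuous : Continuous c.bhat
  W_continuous : Continuous c.W
  integrable_exp : Integrable fun z => Real.exp (-(c.W z) / ε)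
  divFree : c.WeightedDivFree ε
  b_memLp : MemLp c.b 2 (c.rho ε)

variable {c} {ε : ℝ}

lemma Admissible.integrable_exp (hc : c.Admissible) (hε : 0 < ε) :
    Integrable fun z => Real.exp (-(c.W z) / ε) := by
  obtain ⟨q, c₁, c₂, hq, hc₁, -, hW⟩ := hc.W_growth
  refine ((integrable_exp_neg_mul_norm volume (div_pos hc₁ hε)).const_mul
    (Real.exp ((c₁ + c₂) / ε))).mono'
    (Real.continuous_exp.comp (hc.W_differentiable.continuous.neg.div_const ε)).aestronglyMeasurable
    (ae_of_all _ fun z => ?_)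
  have hrpow : ‖z‖ - 1 ≤ ‖z‖ ^ q := by
    rcases le_total 1 ‖z‖ with hz | hz
    · exact (sub_le_self _ zero_le_one).trans (Real.self_le_rpow_of_one_le hz hq.le)
    · exact (sub_nonpos.2 hz).trans (by positivity)
  rw [Real.norm_eq_abs, Real.abs_exp, ← Real.exp_add, Real.exp_le_exp, div_mul_eq_mul_div,
    ← sub_eq_add_neg, ← sub_div]
  gcongr
  nlinarith [hW z]

lemma Admissible.A_continuous (hc : c.Admissible) (i j : Fin (n 0)) :
    Continuous fun z => c.Ahat z i j := by
  obtain ⟨α, hα, -, M, hM⟩ := hc.A_holder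
  refine continuous_iff_continuousAt.2 fun z => ?_
  rw [ContinuousAt, tendsto_iff_dist_tendsto_zero]
  have hmodulus : Continuous fun z' : Space n => M * ‖z' - z‖ ^ α :=
    continuous_const.mul ((continuous_id.sub continuous_const).norm.rpow_const
      fun _ => Or.inr hα.le)
  have hzero := hmodulus.tendsto z
  simp only [sub_self, norm_zero, Real.zero_rpow hα.ne', mul_zero] at hzero
  exact squeeze_zero (fun _ => dist_nonneg) (fun z' => hM z' z i j) hzero

lemma Admissible.regular (hc : c.Admissible) (hε : 0 < ε) (hdiv : c.WeightedDivFree ε)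
    (hb : MemLp c.b 2 (c.rho ε)) : c.Regular ε where
  A_continuous := hc.A_continuous
  A_bounded := hc.A_bounded
  b_continuous := hc.b_continuous
  W_continuous := hc.W_differentiable.continuous
  integrable_exp := hc.integrable_exp hε
  divFree := hdiv
  b_memLp := hb

lemma Regular.adjoint (hc : c.Regular ε) : c.adjoint.Regular ε where
  A_continuous i j := hc.A_continuous j i
  A_bounded := hc.A_bounded.imp fun _ hM z i j => hM z j i
  b_continuous := hc.b_continuous.neg
  W_continuous := hc.W_continuous
  integrable_exp := hc.integrable_exp
  divFree φ hφ hφc := by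
    simp only [adjoint_drift, inner_neg_left, integral_neg, neg_eq_zero]
    exact hc.divFree φ hφ hφc
  b_memLp := by
    rw [funext c.adjoint_b]
    exact hc.b_memLp.neg

end Coefficients

end Coefficients

section Exterior

variable {E : Type*} [NormedAddCommGroup E] [InnerProductSpace ℝ E] [FiniteDimensional ℝ E]
  {z : E}

/-- Smooth cut-offs of growing balls, with gradients of order `1 / (1 + ‖z‖)`. -/
def ballCutoff (k : ℕ) (z : E) : ℝ :=
  (⟨1, 2, one_pos, one_lt_two⟩ : ContDiffBump (0 : E)) ((k + 1 : ℝ)⁻¹ • z)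

lemma contDiff_ballCutoff (k : ℕ) : ContDiff ℝ 1 (ballCutoff (E := E) k) :=
  (ContDiffBump.contDiff _).comp (contDiff_const_smul _)

lemma hasCompactSupport_ballCutoff (k : ℕ) : HasCompactSupport (ballCutoff (E := E) k) :=
  (ContDiffBump.hasCompactSupport _).comp_smul (inv_ne_zero (Nat.cast_add_one_ne_zero k))

lemma abs_ballCutoff_le_one (k : ℕ) (z : E) : |ballCutoff k z| ≤ 1 := by
  rw [ballCutoff, abs_of_nonneg (ContDiffBump.nonneg _)]
  exact ContDiffBump.le_one _

lemma ballCutoff_eventuallyEq_one {k : ℕ} (hz : ‖z‖ < k) : ballCutoff k =ᶠ[𝓝 z] 1 := by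
  filter_upwards [continuous_norm.continuousAt.eventually_lt_const hz] with y hy
  refine ContDiffBump.one_of_mem_closedBall _ ?_
  rw [mem_closedBall_zero_iff, norm_smul, norm_inv, Real.norm_of_nonneg (by positivity),
    inv_mul_le_iff₀ (by positivity)]
  linarith

lemma ballCutoff_eq_one {k : ℕ} (hz : ‖z‖ < k) : ballCutoff k z = 1 :=
  (ballCutoff_eventuallyEq_one hz).self_of_nhds

lemma gradient_ballCutoff_eq_zero {k : ℕ} (hz : ‖z‖ < k) : ∇ (ballCutoff k) z = 0 := by
  rw [(ballCutoff_eventuallyEq_one hz).gradient_eq]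
  exact gradient_const z 1

lemma gradient_comp_smul {φ : E → ℝ} (hφ : Differentiable ℝ φ) (a : ℝ) (z : E) :
    ∇ (fun z => φ (a • z)) z = a • ∇ φ (a • z) := by
  refine HasGradientAt.gradient (hasGradientAt_iff_hasFDerivAt.2 ?_)
  have hscale : HasFDerivAt (fun z : E => a • z) (a • ContinuousLinearMap.id ℝ E) z :=
    (hasFDerivAt_id z).const_smul a
  refine ((hφ (a • z)).hasGradientAt.hasFDerivAt.comp z hscale).congr_fderiv ?_
  ext v
  simp

lemma exists_one_add_norm_mul_norm_gradient_le {φ : E → ℝ} (hφ : ContDiff ℝ 1 φ)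
    (hc : HasCompactSupport φ) : ∃ G : ℝ, ∀ y, (1 + ‖y‖) * ‖∇ φ y‖ ≤ G := by
  have hsupp : HasCompactSupport fun y => (1 + ‖y‖) * ‖∇ φ y‖ :=
    hc.mono' fun y hy => by
      by_contra hy'
      simp [gradient_eq_zero_of_notMem_tsupport hy'] at hy
  obtain ⟨G, hG⟩ := hsupp.exists_bound_of_continuous
    ((continuous_const.add continuous_norm).mul (continuous_gradient hφ).norm)
  exact ⟨G, fun y => (le_abs_self _).trans (hG y)⟩

lemma exists_one_add_norm_mul_norm_gradient_ballCutoff_le :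
    ∃ G : ℝ, ∀ (k : ℕ) (z : E), (1 + ‖z‖) * ‖∇ (ballCutoff k) z‖ ≤ G := by
  let χ : ContDiffBump (0 : E) := ⟨1, 2, one_pos, one_lt_two⟩
  obtain ⟨G, hG⟩ := exists_one_add_norm_mul_norm_gradient_le χ.contDiff χ.hasCompactSupport
  refine ⟨G, fun k z => le_trans ?_ (hG ((k + 1 : ℝ)⁻¹ • z))⟩
  have hk : (k + 1 : ℝ)⁻¹ ≤ 1 := inv_le_one_of_one_le₀ (by linarith [k.cast_nonneg (α := ℝ)])
  have hgrad : ∇ (ballCutoff k) z = (k + 1 : ℝ)⁻¹ • ∇ χ ((k + 1 : ℝ)⁻¹ • z) :=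
    gradient_comp_smul (χ.contDiff.differentiable one_ne_zero) _ z
  rw [hgrad, norm_smul, norm_smul, norm_inv, Real.norm_of_nonneg (by positivity), ← mul_assoc]
  gcongr
  linarith

variable [MeasurableSpace E] [BorelSpace E] {Ω : Set E} {ν : E → E} {X : E → E} {q f : E → ℝ}

lemma HasNormalTrace.tendsto_setIntegral_weakDivIntegrand_ballCutoff (hX : HasNormalTrace Ω ν X q)
    (hΩ : IsOpen Ω) (hf : IntegrableOn f Ω)
    (hgrowth : IntegrableOn (fun z => (1 + ‖z‖)⁻¹ • X z) Ω) :
    Tendsto (fun k => ∫ x in Ω, weakDivIntegrand X f (ballCutoff k) x) atTop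
      (𝓝 (∫ x in Ω, f x)) := by
  obtain ⟨G, hG⟩ := exists_one_add_norm_mul_norm_gradient_ballCutoff_le (E := E)
  refine tendsto_integral_of_dominated_convergence (fun x => ‖(1 + ‖x‖)⁻¹ • X x‖ * G + ‖f x‖)
    (fun k => (hX.integrableOn_weakDivIntegrand hΩ hf (contDiff_ballCutoff k)
      (hasCompactSupport_ballCutoff k)).aestronglyMeasurable)
    ((hgrowth.norm.mul_const G).add hf.norm) (fun k => ae_of_all _ fun x => ?_)
    (ae_of_all _ fun x => ?_)
  · refine (norm_add_le _ _).trans (add_le_add ?_ ?_)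
    · have hpos : 0 < 1 + ‖x‖ := by positivity
      calc ‖inner ℝ (X x) (∇ (ballCutoff k) x)‖ ≤ ‖X x‖ * ‖∇ (ballCutoff k) x‖ :=
            norm_inner_le_norm _ _
        _ = ‖(1 + ‖x‖)⁻¹ • X x‖ * ((1 + ‖x‖) * ‖∇ (ballCutoff k) x‖) := by
            rw [norm_smul, norm_inv, Real.norm_of_nonneg hpos.le]
            field_simp
        _ ≤ ‖(1 + ‖x‖)⁻¹ • X x‖ * G := by gcongr; exact hG k x
    · rw [norm_mul]
      exact mul_le_of_le_one_right (norm_nonneg _) (abs_ballCutoff_le_one k x)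
  · refine tendsto_const_nhds.congr' ?_
    filter_upwards [tendsto_natCast_atTop_atTop.eventually_gt_atTop ‖x‖] with k hk
    rw [weakDivIntegrand, ballCutoff_eq_one hk, gradient_ballCutoff_eq_zero hk, inner_zero_right,
      zero_add, mul_one]

theorem setIntegral_eq_integral_trace (hΩ : IsOpen Ω) (hF : IsCompact (frontier Ω))
    (hbd : ∀ z ∈ frontier Ω, HasC2BoundaryAt Ω ν z) (hX : HasNormalTrace Ω ν X q)
    (hf : IntegrableOn f Ω) (hdiv : HasWeakDiv Ω X f)
    (hgrowth : IntegrableOn (fun z => (1 + ‖z‖)⁻¹ • X z) Ω) :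
    ∫ x in Ω, f x = ∫ z in frontier Ω, q z ∂μHE[Module.finrank ℝ E - 1] := by
  obtain ⟨R, hR⟩ := hF.isBounded.exists_norm_le
  refine tendsto_nhds_unique
    (hX.tendsto_setIntegral_weakDivIntegrand_ballCutoff hΩ hf hgrowth)
    (tendsto_const_nhds.congr' ?_)
  filter_upwards [tendsto_natCast_atTop_atTop.eventually_gt_atTop R] with k hk
  rw [green_formula hΩ hF hbd hX hf hdiv (contDiff_ballCutoff k) (hasCompactSupport_ballCutoff k)]
  refine setIntegral_congr_fun isClosed_frontier.measurableSet fun z hz => ?_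
  rw [ballCutoff_eq_one ((hR z hz).trans_lt hk), one_mul]

end Exterior

section

section Growth

variable {E F : Type*} [NormedAddCommGroup E] [NormedAddCommGroup F] [NormedSpace ℝ F]

lemma continuous_inv_one_add_norm : Continuous fun z : E => (1 + ‖z‖)⁻¹ :=
  (continuous_const.add continuous_norm).inv₀ fun z =>
    (add_pos_of_pos_of_nonneg one_pos (norm_nonneg z)).ne'

lemma inv_one_add_norm_le_one (z : E) : (1 + ‖z‖)⁻¹ ≤ 1 :=
  inv_le_one_of_one_le₀ (le_add_of_nonneg_right (norm_nonneg z))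

lemma integrableOn_inter_of_inv_one_add_norm_smul [MeasurableSpace E] [BorelSpace E]
    {μ : Measure E} {s K : Set E} {X : E → F}
    (hX : IntegrableOn (fun z => (1 + ‖z‖)⁻¹ • X z) s μ) (hK : IsCompact K) :
    IntegrableOn X (s ∩ K) μ := by
  obtain ⟨R, hR⟩ := hK.isBounded.exists_norm_le
  have hbound : ∀ᵐ z ∂μ.restrict (s ∩ K), ‖1 + ‖z‖‖ ≤ 1 + R := by
    filter_upwards [ae_restrict_of_ae_restrict_of_subset inter_subset_right
      (ae_restrict_mem hK.isClosed.measurableSet)] with z hz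
    rw [Real.norm_of_nonneg (by positivity)]
    linarith [hR z hz]
  refine ((hX.mono_set inter_subset_left).bdd_smul (1 + R)
    (by fun_prop : Measurable fun z : E => 1 + ‖z‖).aestronglyMeasurable hbound).congr
    (ae_of_all _ fun z => ?_)
  exact smul_inv_smul₀ (add_pos_of_pos_of_nonneg one_pos (norm_nonneg z)).ne' (X z)

end Growth

section WeakDivergence

variable {E : Type*} [NormedAddCommGroup E] [InnerProductSpace ℝ E] [FiniteDimensional ℝ E]
  [MeasurableSpace E] [BorelSpace E] {Ω : Set E} {X Y ν : E → E} {f g p q φ : E → ℝ}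

lemma integrableOn_weakDivIntegrand_of_continuousOn (hΩ : IsOpen Ω) (hX : ContinuousOn X Ω)
    (hf : ContinuousOn f Ω) (hφ : ContDiff ℝ 1 φ) (hc : HasCompactSupport φ)
    (hs : tsupport φ ⊆ Ω) : IntegrableOn (weakDivIntegrand X f φ) Ω := by
  have hcont : ContinuousOn (weakDivIntegrand X f φ) Ω :=
    (hX.inner (continuous_gradient hφ).continuousOn).add (hf.mul hφ.continuous.continuousOn)
  exact ((hcont.mono hs).integrableOn_compact hc).of_forall_sdiff_eq_zero hΩ.measurableSet
    fun _ hx => weakDivIntegrand_eq_zero_of_notMem_tsupport hx.2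

lemma HasWeakDiv.congr (h : HasWeakDiv Ω X f) (hΩ : IsOpen Ω) (hXY : EqOn X Y Ω)
    (hfg : EqOn f g Ω) : HasWeakDiv Ω Y g := fun φ hφ hc hs => by
  rw [← h φ hφ hc hs]
  refine setIntegral_congr_fun hΩ.measurableSet fun x hx => ?_
  simp only [weakDivIntegrand, hXY hx, hfg hx]

lemma HasWeakDiv.add (hX : HasWeakDiv Ω X f) (hY : HasWeakDiv Ω Y g) (hΩ : IsOpen Ω)
    (hXc : ContinuousOn X Ω) (hfc : ContinuousOn f Ω) (hYc : ContinuousOn Y Ω)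
    (hgc : ContinuousOn g Ω) : HasWeakDiv Ω (X + Y) (f + g) := fun φ hφ hc hs => by
  have h := integral_add (integrableOn_weakDivIntegrand_of_continuousOn hΩ hXc hfc hφ hc hs)
    (integrableOn_weakDivIntegrand_of_continuousOn hΩ hYc hgc hφ hc hs)
  rw [hX φ hφ hc hs, hY φ hφ hc hs, add_zero] at h
  rw [← h]
  congr with x
  simp only [weakDivIntegrand, Pi.add_apply, inner_add_left]
  ring

lemma HasWeakDiv.smul {a : E → ℝ} (h : HasWeakDiv Ω X f) (hΩ : IsOpen Ω)
    (ha : ContDiffOn ℝ 1 a Ω) :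
    HasWeakDiv Ω (fun x => a x • X x) (fun x => a x * f x + inner ℝ (X x) (∇ a x)) :=
  fun φ hφ hc hs => by
    have hsub : (tsupport fun x => φ x * a x) ⊆ tsupport φ := tsupport_mul_subset_left
    rw [← h _ (contDiff_mul_of_tsupport_subset hΩ hφ hs ha)
      (hc.of_isClosed_subset (isClosed_tsupport _) hsub) (hsub.trans hs)]
    congr with x
    simp only [weakDivIntegrand, gradient_mul_of_tsupport_subset hΩ hφ hs ha, inner_add_right,
      real_inner_smul_left, real_inner_smul_right]
    ring

lemma HasNormalTrace.add (hX : HasNormalTrace Ω ν X p) (hY : HasNormalTrace Ω ν Y q) :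
    HasNormalTrace Ω ν (X + Y) (p + q) where
  continuousOn := hX.continuousOn.add hY.continuousOn
  integrableOn K hK := (hX.integrableOn K hK).add (hY.integrableOn K hK)
  tendsto z hz := by
    simp only [Pi.add_apply, inner_add_left]
    exact (hX.tendsto z hz).add (hY.tendsto z hz)
  bounded := by
    obtain ⟨M, r, hr, hM⟩ := hX.bounded
    obtain ⟨M', r', hr', hM'⟩ := hY.bounded
    refine ⟨M + M', min r r', lt_min hr hr', fun z hz δ hδ => ?_⟩
    rw [Pi.add_apply, inner_add_left]
    exact (abs_add_le _ _).trans (add_le_add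
      (hM z hz δ ⟨hδ.1, hδ.2.trans_le (min_le_left _ _)⟩)
      (hM' z hz δ ⟨hδ.1, hδ.2.trans_le (min_le_right _ _)⟩))

omit [FiniteDimensional ℝ E] [MeasurableSpace E] [BorelSpace E] in
lemma sub_smul_mem_cthickening {s : Set E} {z v : E} {δ : ℝ} (hz : z ∈ s) (hv : ‖v‖ = 1)
    (hδ : δ ∈ Ioo (0 : ℝ) 1) : z - δ • v ∈ Metric.cthickening 1 s := by
  refine Metric.mem_cthickening_of_dist_le _ z _ _ hz ?_
  rw [dist_eq_norm, sub_sub_cancel_left, norm_neg, norm_smul, hv, mul_one,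
    Real.norm_of_nonneg hδ.1.le]
  exact hδ.2.le

lemma hasNormalTrace_of_continuous (hX : Continuous X) (hF : IsCompact (frontier Ω))
    (hν : ∀ z ∈ frontier Ω, ‖ν z‖ = 1) :
    HasNormalTrace Ω ν X fun z => inner ℝ (X z) (ν z) where
  continuousOn := hX.continuousOn
  integrableOn K hK := (hX.continuousOn.integrableOn_compact hK).mono_set inter_subset_right
  tendsto z _ := by
    have hlim : Tendsto (fun δ : ℝ => z - δ • ν z) (𝓝[>] 0) (𝓝 z) := by
      simpa only [smul_neg, ← sub_eq_add_neg] using tendsto_add_smul z (-ν z)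
    exact ((hX.tendsto z).comp hlim).inner tendsto_const_nhds
  bounded := by
    obtain ⟨M, hM⟩ := (hF.cthickening (r := 1)).exists_bound_of_continuousOn hX.continuousOn
    refine ⟨M, 1, one_pos, fun z hz δ hδ => (abs_real_inner_le_norm _ _).trans ?_⟩
    rw [hν z hz, mul_one]
    exact hM _ (sub_smul_mem_cthickening hz (hν z hz) hδ)

end WeakDivergence

variable {κ : ℕ} {n : Fin (κ + 1) → ℕ}

namespace Coefficients

variable (c : Coefficients κ n)

/-- The vector `(0, Â ∇̂u)`. -/
def diffFlux (u : Space n → ℝ) (z : Space n) : Space n := unhat (c.Amul z (hat (∇ u z)))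

lemma inner_diffFlux (u : Space n → ℝ) (z v : Space n) :
    inner ℝ (c.diffFlux u z) v = inner ℝ (c.Amul z (hat (∇ u z))) (hat v) := inner_unhat _ _

lemma inner_adjoint_diffFlux (u v : Space n → ℝ) (z : Space n) :
    inner ℝ (c.adjoint.diffFlux u z) (∇ v z) = inner ℝ (c.diffFlux v z) (∇ u z) := by
  rw [inner_diffFlux, inner_diffFlux, inner_adjoint_Amul]

/-- The field `ε a Â ∇̂u + g (b + B z)` with respect to `ρ_ε`, that is, multiplied by the density
of `ρ_ε`. A solution `u` has the divergence-free flux with `a = 1` and `g = u`; the multipliers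
`a` and `g` turn it into the fields to which Green's formula is applied. -/
def flux (ε : ℝ) (u a g : Space n → ℝ) (z : Space n) : Space n :=
  c.weight ε z • ((ε * a z) • c.diffFlux u z + g z • c.drift z)

/-- The normal component of the field `flux` on the boundary. -/
def fluxTrace (ε : ℝ) (D : Set (Space n)) (u a g : Space n → ℝ) (z : Space n) : ℝ :=
  c.weight ε z *
    (ε * a z * c.conormalDeriv D u z + g z * inner ℝ (c.drift z) (outwardNormal D z))

/-- The divergence of the field `flux` of a solution `u`. -/
def fluxDiv (ε : ℝ) (u a g : Space n → ℝ) (z : Space n) : ℝ :=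
  c.weight ε z *
    (ε * inner ℝ (c.diffFlux u z) (∇ a z) + inner ℝ (c.drift z) (∇ g z - a z • ∇ u z))

lemma inner_flux_sub_smul_outwardNormal (ε : ℝ) (D : Set (Space n)) (u a g : Space n → ℝ)
    (z : Space n) (δ : ℝ) :
    inner ℝ (c.flux ε u a g (z - δ • outwardNormal D z)) (outwardNormal D z)
      = c.weight ε (z - δ • outwardNormal D z) *
        (ε * a (z - δ • outwardNormal D z) * c.conormalQuotient D u z δ
          + g (z - δ • outwardNormal D z)
            * inner ℝ (c.drift (z - δ • outwardNormal D z)) (outwardNormal D z)) := by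
  rw [flux, real_inner_smul_left, inner_add_left, real_inner_smul_left, real_inner_smul_left,
    inner_diffFlux, conormalQuotient]

namespace Regular

variable {c} {ε : ℝ} {D : Set (Space n)} {u a g : Space n → ℝ} {K : ℝ}

lemma Z_pos (hc : c.Regular ε) : 0 < c.Z ε := integral_exp_pos hc.integrable_exp

lemma weight_pos (hc : c.Regular ε) (z : Space n) : 0 < c.weight ε z :=
  div_pos (Real.exp_pos _) hc.Z_pos

lemma continuous_weight (hc : c.Regular ε) : Continuous (c.weight ε) :=
  (Real.continuous_exp.comp (hc.W_continuous.neg.div_const ε)).div_const _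

lemma integrable_weight (hc : c.Regular ε) : Integrable (c.weight ε) :=
  hc.integrable_exp.div_const _

lemma isFiniteMeasure_rho (hc : c.Regular ε) : IsFiniteMeasure (c.rho ε) :=
  isFiniteMeasure_withDensity_ofReal hc.integrable_weight.2

lemma measurable_density (hc : c.Regular ε) :
    Measurable fun z => ENNReal.ofReal (c.weight ε z) :=
  hc.continuous_weight.measurable.ennreal_ofReal

lemma setIntegral_rho (hc : c.Regular ε) (hD : MeasurableSet D) (f : Space n → ℝ) :
    ∫ z in D, f z ∂(c.rho ε) = ∫ z in D, c.weight ε z * f z := by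
  have h := setIntegral_withDensity_eq_setIntegral_toReal_smul (μ := volume) (s := D)
    hc.measurable_density (ae_of_all _ fun _ => ENNReal.ofReal_lt_top) f hD
  simp only [ENNReal.toReal_ofReal (hc.weight_pos _).le, smul_eq_mul] at h
  exact h

lemma integrableOn_rho_iff (hc : c.Regular ε) {F : Type*} [NormedAddCommGroup F]
    [NormedSpace ℝ F] (hD : MeasurableSet D) (f : Space n → F) :
    IntegrableOn f D (c.rho ε) ↔ IntegrableOn (fun z => c.weight ε z • f z) D := by
  have h := integrable_withDensity_iff_integrable_smul' (μ := volume.restrict D)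
    hc.measurable_density (ae_of_all _ fun _ => ENNReal.ofReal_lt_top) (g := f)
  rw [← restrict_withDensity hD] at h
  simp only [ENNReal.toReal_ofReal (hc.weight_pos _).le] at h
  exact h

lemma exists_inner_Amul_le (hc : c.Regular ε) : ∃ C : ℝ, 0 ≤ C ∧
    ∀ z u v, |inner ℝ (c.Amul z u) v| ≤ C * ‖u‖ * ‖v‖ := by
  obtain ⟨M, hM⟩ := hc.A_bounded
  refine ⟨(n 0 : ℝ) * ((n 0 : ℝ) * max M 0), by positivity, fun z u v => ?_⟩
  have hterm : ∀ i j, |c.Ahat z i j * u j * v i| ≤ max M 0 * ‖u‖ * ‖v‖ := by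
    intro i j
    rw [abs_mul, abs_mul]
    gcongr
    · exact (hM z i j).trans (le_max_left M 0)
    · exact PiLp.norm_apply_le u j
    · exact PiLp.norm_apply_le v i
  rw [inner_Amul]
  calc |∑ i, ∑ j, c.Ahat z i j * u j * v i|
      ≤ ∑ i, ∑ j, |c.Ahat z i j * u j * v i| := (Finset.abs_sum_le_sum_abs _ _).trans
        (Finset.sum_le_sum fun _ _ => Finset.abs_sum_le_sum_abs _ _)
    _ ≤ ∑ _i : Fin (n 0), ∑ _j : Fin (n 0), max M 0 * ‖u‖ * ‖v‖ := by
        gcongr with i _ j _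
        exact hterm i j
    _ = (n 0 : ℝ) * ((n 0 : ℝ) * max M 0) * ‖u‖ * ‖v‖ := by
        simp only [Finset.sum_const, Finset.card_univ, Fintype.card_fin, nsmul_eq_mul]
        ring

lemma exists_norm_Amul_le (hc : c.Regular ε) : ∃ C : ℝ, ∀ z u, ‖c.Amul z u‖ ≤ C * ‖u‖ := by
  obtain ⟨C, hC, h⟩ := hc.exists_inner_Amul_le
  refine ⟨C, fun z u => ?_⟩
  have hself := h z u (c.Amul z u)
  rw [real_inner_self_eq_norm_sq, abs_of_nonneg (by positivity), sq] at hself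
  rcases (norm_nonneg (c.Amul z u)).eq_or_lt with h0 | h0
  · rw [← h0]; positivity
  · exact le_of_mul_le_mul_right hself h0

lemma continuous_Amul (hc : c.Regular ε) :
    Continuous fun p : Space n × EuclideanSpace ℝ (Fin (n 0)) => c.Amul p.1 p.2 := by
  refine (PiLp.continuous_toLp 2 _).comp (continuous_pi fun i => ?_)
  simp only [Matrix.mulVec, dotProduct]
  refine continuous_finsetSum _ fun j _ => ((hc.A_continuous i j).comp continuous_fst).mul ?_
  exact (EuclideanSpace.proj (𝕜 := ℝ) j).continuous.comp continuous_snd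

lemma continuousOn_diffFlux (hc : c.Regular ε) (hD : IsOpen D) (hu : ContDiffOn ℝ 1 u D) :
    ContinuousOn (c.diffFlux u) D :=
  unhat.continuous.comp_continuousOn (hc.continuous_Amul.comp_continuousOn
    (continuousOn_id.prodMk (hatCLM.continuous.comp_continuousOn (continuousOn_gradient hD hu))))

lemma continuous_b (hc : c.Regular ε) : Continuous c.b := by
  rw [funext c.b_eq_unhat]
  exact unhat.continuous.comp hc.b_continuous

lemma continuous_drift (hc : c.Regular ε) : Continuous c.drift :=
  hc.continuous_b.add c.BmulCLM.continuous

lemma continuousOn_flux (hc : c.Regular ε) (hD : IsOpen D) (hu : ContDiffOn ℝ 1 u D)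
    (ha : ContinuousOn a D) (hg : ContinuousOn g D) : ContinuousOn (c.flux ε u a g) D :=
  hc.continuous_weight.continuousOn.smul (((continuousOn_const.mul ha).smul
    (hc.continuousOn_diffFlux hD hu)).add (hg.smul hc.continuous_drift.continuousOn))

lemma continuousOn_fluxDiv (hc : c.Regular ε) (hD : IsOpen D) (hu : ContDiffOn ℝ 1 u D)
    (ha : ContDiffOn ℝ 1 a D) (hg : ContDiffOn ℝ 1 g D) :
    ContinuousOn (c.fluxDiv ε u a g) D :=
  hc.continuous_weight.continuousOn.mul ((continuousOn_const.mul
    ((hc.continuousOn_diffFlux hD hu).inner (continuousOn_gradient hD ha))).add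
      (hc.continuous_drift.continuousOn.inner ((continuousOn_gradient hD hg).sub
        (ha.continuousOn.smul (continuousOn_gradient hD hu)))))

lemma integrable_weight_smul_b (hc : c.Regular ε) :
    Integrable fun z => c.weight ε z • c.b z := by
  have := hc.isFiniteMeasure_rho
  have h := (hc.integrableOn_rho_iff MeasurableSet.univ c.b).1
    (hc.b_memLp.integrable one_le_two).integrableOn
  rwa [integrableOn_univ] at h

lemma integrable_inv_one_add_norm_smul_weight_smul_drift (hc : c.Regular ε) :
    Integrable fun z => (1 + ‖z‖)⁻¹ • c.weight ε z • c.drift z := by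
  refine Integrable.mono' (hc.integrable_weight_smul_b.norm.add
    (hc.integrable_weight.mul_const ‖c.BmulCLM‖))
    (continuous_inv_one_add_norm.smul
      (hc.continuous_weight.smul hc.continuous_drift)).aestronglyMeasurable
    (ae_of_all _ fun z => ?_)
  have hw := (hc.weight_pos z).le
  have hz : 0 < 1 + ‖z‖ := by positivity
  have hdrift : ‖c.drift z‖ ≤ (1 + ‖z‖) * (‖c.b z‖ + ‖c.BmulCLM‖) := by
    refine (norm_add_le _ _).trans ((add_le_add le_rfl (c.BmulCLM.le_opNorm z)).trans ?_)
    nlinarith [norm_nonneg z, norm_nonneg (c.b z), norm_nonneg c.BmulCLM,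
      mul_nonneg (norm_nonneg z) (norm_nonneg (c.b z))]
  rw [Pi.add_apply, norm_smul, norm_smul, norm_smul, norm_inv, Real.norm_of_nonneg hz.le,
    Real.norm_of_nonneg hw, inv_mul_le_iff₀ hz, ← mul_add, mul_left_comm]
  gcongr

lemma integrableOn_weight_smul_diffFlux (hc : c.Regular ε) (hD : IsOpen D)
    (hu : c.IsWeakSolution ε D u) :
    IntegrableOn (fun z => c.weight ε z • c.diffFlux u z) D := by
  have := hc.isFiniteMeasure_rho
  have h := (hc.integrableOn_rho_iff hD.measurableSet _).1 (hu.memLp_grad.integrable one_le_two)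
  obtain ⟨C, hA⟩ := hc.exists_norm_Amul_le
  refine Integrable.mono' (h.norm.const_mul (‖(unhat : _ →L[ℝ] Space n)‖ * C))
    ((hc.continuous_weight.continuousOn.smul
      (hc.continuousOn_diffFlux hD hu.contDiffOn)).aestronglyMeasurable hD.measurableSet)
    (ae_of_all _ fun z => ?_)
  rw [norm_smul, norm_smul]
  have hflux : ‖c.diffFlux u z‖ ≤ ‖(unhat : _ →L[ℝ] Space n)‖ * (C * ‖hat (∇ u z)‖) :=
    (unhat.le_opNorm _).trans (by gcongr; exact hA _ _)
  calc _ ≤ ‖c.weight ε z‖ * (‖(unhat : _ →L[ℝ] Space n)‖ * (C * ‖hat (∇ u z)‖)) := by gcongr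
    _ = _ := by ring

lemma integrableOn_weight_mul_inner_diffFlux_gradient (hc : c.Regular ε) (hD : IsOpen D)
    (hu : c.IsWeakSolution ε D u) :
    IntegrableOn (fun z => c.weight ε z * inner ℝ (c.diffFlux u z) (∇ u z)) D := by
  have := hc.isFiniteMeasure_rho
  have h := (hc.integrableOn_rho_iff hD.measurableSet _).1 hu.memLp_grad.integrable_norm_pow'
  obtain ⟨C, -, hA⟩ := hc.exists_inner_Amul_le
  refine Integrable.mono' (h.norm.const_mul C)
    ((hc.continuous_weight.continuousOn.mul ((hc.continuousOn_diffFlux hD hu.contDiffOn).inner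
      (continuousOn_gradient hD hu.contDiffOn))).aestronglyMeasurable hD.measurableSet)
    (ae_of_all _ fun z => ?_)
  rw [norm_mul, norm_smul, inner_diffFlux]
  calc _ ≤ ‖c.weight ε z‖ * (C * ‖hat (∇ u z)‖ * ‖hat (∇ u z)‖) := by gcongr; exact hA _ _ _
    _ = _ := by
      simp only [norm_pow, norm_norm]
      ring

lemma integrableOn_inv_one_add_norm_smul_flux (hc : c.Regular ε) (hD : IsOpen D)
    (hu : c.IsWeakSolution ε D u) (ha : ContinuousOn a D) (hg : ContinuousOn g D)
    (hKa : ∀ z, |a z| ≤ K) (hKg : ∀ z, |g z| ≤ K) :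
    IntegrableOn (fun z => (1 + ‖z‖)⁻¹ • c.flux ε u a g z) D := by
  have hbound : ∀ z : Space n, ‖(1 + ‖z‖)⁻¹ * (ε * a z)‖ ≤ |ε| * K := fun z => by
    rw [norm_mul, Real.norm_of_nonneg (by positivity), norm_mul]
    exact (mul_le_of_le_one_left (by positivity) (inv_one_add_norm_le_one z)).trans
      (mul_le_mul_of_nonneg_left (hKa z) (abs_nonneg ε))
  have hdiff := (hc.integrableOn_weight_smul_diffFlux hD hu).bdd_smul (|ε| * K)
    ((continuous_inv_one_add_norm.continuousOn.mul
      (continuousOn_const.mul ha)).aestronglyMeasurable hD.measurableSet) (ae_of_all _ hbound)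
  have hdrift := hc.integrable_inv_one_add_norm_smul_weight_smul_drift.integrableOn.bdd_smul K
    (hg.aestronglyMeasurable hD.measurableSet) (ae_of_all _ hKg)
  refine (hdiff.add hdrift).congr (ae_of_all _ fun z => ?_)
  simp only [flux, Pi.add_apply, Pi.smul_apply', Pi.mul_apply, smul_add, smul_smul]
  congr 2 <;> ring

lemma hasWeakDiv_weight_smul_drift (hc : c.Regular ε) (D : Set (Space n)) :
    HasWeakDiv D (fun z => c.weight ε z • c.drift z) 0 := fun φ hφ hφc hs => by
  have h := hc.divFree φ hφ hφc
  rw [← setIntegral_univ, hc.setIntegral_rho MeasurableSet.univ, setIntegral_univ] at h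
  rw [setIntegral_eq_integral_of_forall_compl_eq_zero fun z hz =>
    weakDivIntegrand_eq_zero_of_notMem_tsupport fun hz' => hz (hs hz'), ← h]
  simp only [weakDivIntegrand, real_inner_smul_left, Pi.zero_apply, zero_mul, add_zero]

lemma hasWeakDiv_flux_one_self (hc : c.Regular ε) (hD : IsOpen D)
    (hu : c.IsWeakSolution ε D u) : HasWeakDiv D (c.flux ε u 1 u) 0 := fun φ hφ hφc hs => by
  rw [← hu.eqn φ hφ hφc hs, hc.setIntegral_rho hD.measurableSet]
  simp only [weakDivIntegrand, flux, Pi.one_apply, Pi.zero_apply, inner_add_left,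
    real_inner_smul_left, inner_diffFlux, mul_one, zero_mul, add_zero]

lemma hasWeakDiv_flux (hc : c.Regular ε) (hD : IsOpen D) (hu : c.IsWeakSolution ε D u)
    (ha : ContDiffOn ℝ 1 a D) (hg : ContDiffOn ℝ 1 g D) :
    HasWeakDiv D (c.flux ε u a g) (c.fluxDiv ε u a g) := by
  have hcu := hu.contDiffOn
  have hcdrift : ContinuousOn (fun z => c.weight ε z • c.drift z) D :=
    (hc.continuous_weight.smul hc.continuous_drift).continuousOn
  -- The multiplier `g - a u` removes the drift part of `a` times the flux of the solution.
  have hau : ContDiffOn ℝ 1 (fun z => g z - a z * u z) D := hg.sub (ha.mul hcu)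
  refine (((hc.hasWeakDiv_flux_one_self hD hu).smul hD ha).add
    ((hc.hasWeakDiv_weight_smul_drift D).smul hD hau) hD
    (ha.continuousOn.smul (hc.continuousOn_flux hD hcu continuousOn_const hcu.continuousOn))
    ((ha.continuousOn.mul continuousOn_const).add
      ((hc.continuousOn_flux hD hcu continuousOn_const hcu.continuousOn).inner
        (continuousOn_gradient hD ha)))
    (hau.continuousOn.smul hcdrift)
    ((hau.continuousOn.mul continuousOn_const).add
      (hcdrift.inner (continuousOn_gradient hD hau)))).congr hD (fun z _ => ?_) (fun z hz => ?_)
  · simp only [flux, Pi.add_apply, Pi.one_apply]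
    module
  · have hdiff {v : Space n → ℝ} (hv : ContDiffOn ℝ 1 v D) : DifferentiableAt ℝ v z :=
      ((hv z hz).contDiffAt (hD.mem_nhds hz)).differentiableAt one_ne_zero
    have hgrad : ∇ (fun z => g z - a z * u z) z = ∇ g z - (a z • ∇ u z + u z • ∇ a z) := by
      rw [← gradient_mul (hdiff ha) (hdiff hcu)]
      exact gradient_fun_sub (hdiff hg) ((hdiff ha).mul (hdiff hcu))
    simp only [Pi.add_apply, Pi.zero_apply, Pi.one_apply, flux, fluxDiv, hgrad, inner_add_left,
      inner_add_right, inner_sub_right, real_inner_smul_left, real_inner_smul_right]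
    ring

lemma tendsto_inner_flux (hc : c.Regular ε)
    (hbd : ∀ z ∈ frontier D, HasC2BoundaryAt D (outwardNormal D) z)
    (hcon : c.HasBoundedConormalDeriv D u) (ha : ContinuousOn a (closure D))
    (hg : ContinuousOn g (closure D)) {z : Space n} (hz : z ∈ frontier D) :
    Tendsto (fun δ : ℝ =>
        inner ℝ (c.flux ε u a g (z - δ • outwardNormal D z)) (outwardNormal D z))
      (𝓝[>] 0) (𝓝 (c.fluxTrace ε D u a g z)) := by
  have hlim : Tendsto (fun δ : ℝ => z - δ • outwardNormal D z) (𝓝[>] 0) (𝓝 z) := by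
    simpa only [smul_neg, ← sub_eq_add_neg] using tendsto_add_smul z (-outwardNormal D z)
  have hlim' : Tendsto (fun δ : ℝ => z - δ • outwardNormal D z) (𝓝[>] 0) (𝓝[closure D] z) :=
    tendsto_nhdsWithin_iff.2 ⟨hlim, ((hbd z hz).eventually_mem hz).mono
      fun δ h => subset_closure h⟩
  have hzc : z ∈ closure D := frontier_subset_closure hz
  simp only [inner_flux_sub_smul_outwardNormal]
  exact ((hc.continuous_weight.tendsto z).comp hlim).mul
    (((tendsto_const_nhds.mul ((ha z hzc).tendsto.comp hlim')).mul
      (tendsto_nhds_limUnder (hcon.1 z hz))).add (((hg z hzc).tendsto.comp hlim').mul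
        (((hc.continuous_drift.tendsto z).comp hlim).inner tendsto_const_nhds)))

lemma exists_abs_inner_flux_le (hc : c.Regular ε) (hF : IsCompact (frontier D))
    (hbd : ∀ z ∈ frontier D, HasC2BoundaryAt D (outwardNormal D) z)
    (hcon : c.HasBoundedConormalDeriv D u) (hKa : ∀ z, |a z| ≤ K) (hKg : ∀ z, |g z| ≤ K) :
    ∃ M r : ℝ, 0 < r ∧ ∀ z ∈ frontier D, ∀ δ ∈ Ioo 0 r,
      |inner ℝ (c.flux ε u a g (z - δ • outwardNormal D z)) (outwardNormal D z)| ≤ M := by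
  obtain ⟨M, r, hr, hM⟩ := hcon.2
  have hcollar : IsCompact (Metric.cthickening 1 (frontier D)) := hF.cthickening
  obtain ⟨w, hw⟩ := hcollar.exists_bound_of_continuousOn hc.continuous_weight.continuousOn
  obtain ⟨v, hv⟩ := hcollar.exists_bound_of_continuousOn hc.continuous_drift.continuousOn
  refine ⟨w * (|ε| * K * M + K * v), min r 1, lt_min hr one_pos, fun z hz δ hδ => ?_⟩
  rw [inner_flux_sub_smul_outwardNormal]
  set y := z - δ • outwardNormal D z
  have hν : ‖outwardNormal D z‖ = 1 := (hbd z hz).norm_eq_one hz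
  have hyT : y ∈ Metric.cthickening 1 (frontier D) :=
    sub_smul_mem_cthickening hz hν ⟨hδ.1, hδ.2.trans_le (min_le_right _ _)⟩
  have hweight : |c.weight ε y| ≤ w := hw y hyT
  have hdrift : |inner ℝ (c.drift y) (outwardNormal D z)| ≤ v :=
    (abs_real_inner_le_norm _ _).trans (by rw [hν, mul_one]; exact hv y hyT)
  have hquot := hM z hz δ hδ.1 (hδ.2.trans_le (min_le_left _ _))
  have hK : 0 ≤ K := (abs_nonneg _).trans (hKa y)
  rw [abs_mul]
  refine mul_le_mul hweight ((abs_add_le _ _).trans ?_) (abs_nonneg _)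
    ((abs_nonneg _).trans hweight)
  rw [abs_mul, abs_mul, abs_mul]
  gcongr
  exacts [hKa y, hKg y]

lemma hasNormalTrace_flux (hc : c.Regular ε) (hD : IsOpen D) (hF : IsCompact (frontier D))
    (hbd : ∀ z ∈ frontier D, HasC2BoundaryAt D (outwardNormal D) z)
    (hu : c.IsWeakSolution ε D u) (hcon : c.HasBoundedConormalDeriv D u)
    (ha : ContinuousOn a (closure D)) (hg : ContinuousOn g (closure D))
    (hKa : ∀ z, |a z| ≤ K) (hKg : ∀ z, |g z| ≤ K) :
    HasNormalTrace D (outwardNormal D) (c.flux ε u a g) (c.fluxTrace ε D u a g) where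
  continuousOn := hc.continuousOn_flux hD hu.contDiffOn (ha.mono subset_closure)
    (hg.mono subset_closure)
  integrableOn _ hL := integrableOn_inter_of_inv_one_add_norm_smul
    (hc.integrableOn_inv_one_add_norm_smul_flux hD hu (ha.mono subset_closure)
      (hg.mono subset_closure) hKa hKg) hL
  tendsto _ hz := hc.tendsto_inner_flux hbd hcon ha hg hz
  bounded := hc.exists_abs_inner_flux_le hF hbd hcon hKa hKg

end Regular

end Coefficients

end

section

section Truncation

/-- The derivative of the truncation at height `1`. -/
def truncationBump : ContDiffBump (0 : ℝ) := ⟨1, 2, one_pos, one_lt_two⟩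

/-- A smooth truncation at height `k > 0`: the identity on `[-k, k]`, constant on each of
`[2k, ∞)` and `(-∞, -2k]`, with derivative in `[0, 1]`. -/
def truncation (k s : ℝ) : ℝ := k * ∫ t in (0 : ℝ)..s / k, truncationBump t

variable {k s : ℝ}

lemma hasDerivAt_truncation (hk : k ≠ 0) (s : ℝ) :
    HasDerivAt (truncation k) (truncationBump (s / k)) s := by
  have hprim : HasDerivAt (fun s => ∫ t in (0 : ℝ)..s, truncationBump t)
      (truncationBump (s / k)) (s / k) :=
    intervalIntegral.integral_hasDerivAt_right
      (truncationBump.continuous.intervalIntegrable _ _)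
      truncationBump.continuous.stronglyMeasurable.stronglyMeasurableAtFilter
      truncationBump.continuous.continuousAt
  refine ((hprim.comp s ((hasDerivAt_id s).div_const k)).const_mul k).congr_deriv ?_
  field_simp

lemma deriv_truncation (hk : k ≠ 0) : deriv (truncation k) = fun s => truncationBump (s / k) :=
  funext fun s => (hasDerivAt_truncation hk s).deriv

lemma contDiff_deriv_truncation (hk : k ≠ 0) : ContDiff ℝ 1 (deriv (truncation k)) := by
  rw [deriv_truncation hk]
  exact truncationBump.contDiff.comp (contDiff_id.div_const k)

lemma contDiff_truncation (hk : k ≠ 0) : ContDiff ℝ 1 (truncation k) :=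
  contDiff_one_iff_deriv.2 ⟨fun s => (hasDerivAt_truncation hk s).differentiableAt,
    (contDiff_deriv_truncation hk).continuous⟩

lemma abs_deriv_truncation_le_one (hk : k ≠ 0) (s : ℝ) : |deriv (truncation k) s| ≤ 1 := by
  rw [deriv_truncation hk, abs_of_nonneg truncationBump.nonneg]
  exact truncationBump.le_one

lemma truncation_eq_self (hs : |s| < k) : truncation k s = s := by
  have hk : 0 < k := (abs_nonneg s).trans_lt hs
  have hone : ∫ t in (0 : ℝ)..s / k, truncationBump t = ∫ _ in (0 : ℝ)..s / k, (1 : ℝ) := by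
    refine intervalIntegral.integral_congr fun t ht => truncationBump.one_of_mem_closedBall ?_
    rw [mem_closedBall_zero_iff, Real.norm_eq_abs]
    have hts : |t| ≤ |s / k| := by simpa only [sub_zero] using abs_sub_left_of_mem_uIcc ht
    refine hts.trans ?_
    rw [abs_div, abs_of_pos hk]
    exact ((div_lt_one hk).2 hs).le
  rw [truncation, hone, intervalIntegral.integral_const, sub_zero, smul_eq_mul, mul_one,
    mul_div_cancel₀ s hk.ne']

lemma truncation_eventuallyEq_id (hs : |s| < k) : truncation k =ᶠ[𝓝 s] id := by
  filter_upwards [(continuous_abs.tendsto s).eventually_lt_const hs] with t ht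
  exact truncation_eq_self ht

lemma deriv_truncation_eventuallyEq_one (hs : |s| < k) : deriv (truncation k) =ᶠ[𝓝 s] 1 := by
  filter_upwards [(truncation_eventuallyEq_id hs).deriv] with t ht
  rw [ht, deriv_id, Pi.one_apply]

lemma deriv_deriv_truncation_eq_zero (hs : |s| < k) : deriv (deriv (truncation k)) s = 0 := by
  rw [(deriv_truncation_eventuallyEq_one hs).deriv_eq]
  exact deriv_const s 1

lemma abs_truncation_le (hk : 0 ≤ k) (s : ℝ) :
    |truncation k s| ≤ k * ∫ t, ‖truncationBump t‖ := by
  have hint : Integrable fun t => ‖truncationBump t‖ :=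
    (truncationBump.continuous.integrable_of_hasCompactSupport
      truncationBump.hasCompactSupport).norm
  rw [truncation, abs_mul, abs_of_nonneg hk]
  exact mul_le_mul_of_nonneg_left (intervalIntegral.norm_integral_le_integral_norm_uIoc.trans
    (setIntegral_le_integral hint (ae_of_all _ fun t => norm_nonneg _))) hk

lemma exists_abs_truncation_le (hk : 0 < k) : ∃ K, ∀ s t : ℝ,
    |deriv (truncation k) s * truncation k t| ≤ K ∧ |truncation k s * truncation k t| ≤ K := by
  set L := k * ∫ t, ‖truncationBump t‖
  have hL : ∀ s, |truncation k s| ≤ L := abs_truncation_le hk.le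
  refine ⟨max L (L * L), fun s t => ⟨le_max_of_le_left ?_, le_max_of_le_right ?_⟩⟩
  · rw [abs_mul]
    exact (mul_le_of_le_one_left (abs_nonneg _) (abs_deriv_truncation_le_one hk.ne' s)).trans
      (hL t)
  · rw [abs_mul]
    exact mul_le_mul (hL s) (hL t) (abs_nonneg _) ((abs_nonneg _).trans (hL s))

lemma exists_abs_deriv_deriv_truncation_mul_le : ∃ C, ∀ k : ℝ, 0 < k → ∀ s t,
    |deriv (deriv (truncation k)) s * truncation k t| ≤ C := by
  have hbump : ContDiff ℝ 1 truncationBump := truncationBump.contDiff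
  obtain ⟨M, hM⟩ := (hbump.continuous_deriv le_rfl).bounded_above_of_compact_support
    truncationBump.hasCompactSupport.deriv
  refine ⟨M * ∫ t, ‖truncationBump t‖, fun k hk s t => ?_⟩
  have hderiv : deriv (deriv (truncation k)) s = deriv truncationBump (s / k) / k := by
    rw [deriv_truncation hk.ne']
    refine (((hbump.differentiable one_ne_zero (s / k)).hasDerivAt.comp s
      ((hasDerivAt_id s).div_const k)).congr_deriv ?_).deriv
    ring
  -- The factor `1 / k` of the second derivative compensates the height `k` of the truncation.
  rw [hderiv, abs_mul, abs_div, abs_of_pos hk]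
  calc |deriv truncationBump (s / k)| / k * |truncation k t|
      ≤ M / k * (k * ∫ t, ‖truncationBump t‖) := by
        have hM₀ : 0 ≤ M := (norm_nonneg _).trans (hM 0)
        gcongr
        exacts [hM _, abs_truncation_le hk.le t]
    _ = M * ∫ t, ‖truncationBump t‖ := by field_simp

end Truncation

variable {κ : ℕ} {n : Fin (κ + 1) → ℕ}

namespace Coefficients

variable (c : Coefficients κ n)

/-- The field of Green's second identity for `h` and `w`, with both functions truncated at height
`k` so that all multipliers of the fluxes are bounded. -/
def truncatedGreenField (ε k : ℝ) (h w : Space n → ℝ) : Space n → Space n :=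
  c.flux ε h (fun z => deriv (truncation k) (h z) * truncation k (w z))
      (fun z => truncation k (h z) * truncation k (w z))
    + c.adjoint.flux ε w (fun z => -(deriv (truncation k) (w z) * truncation k (h z))) 0

/-- The normal component of `truncatedGreenField` on the boundary. -/
def truncatedGreenTrace (ε : ℝ) (D : Set (Space n)) (k : ℝ) (h w : Space n → ℝ) : Space n → ℝ :=
  c.fluxTrace ε D h (fun z => deriv (truncation k) (h z) * truncation k (w z))
      (fun z => truncation k (h z) * truncation k (w z))
    + c.adjoint.fluxTrace ε D w
      (fun z => -(deriv (truncation k) (w z) * truncation k (h z))) 0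

/-- The divergence of `truncatedGreenField` for a solution `h` and an adjoint solution `w`. -/
def truncationDefect (ε k : ℝ) (h w : Space n → ℝ) (z : Space n) : ℝ :=
  ε * (deriv (deriv (truncation k)) (h z) * truncation k (w z)
      * (c.weight ε z * inner ℝ (c.diffFlux h z) (∇ h z))
    - deriv (deriv (truncation k)) (w z) * truncation k (h z)
      * (c.weight ε z * inner ℝ (c.adjoint.diffFlux w z) (∇ w z)))

/-- The boundary integrand of Green's second identity. -/
def greenTrace (ε : ℝ) (D : Set (Space n)) (h w : Space n → ℝ) (z : Space n) : ℝ :=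
  c.weight ε z * (ε * (w z * c.conormalDeriv D h z - h z * c.adjoint.conormalDeriv D w z)
    + h z * w z * inner ℝ (c.drift z) (outwardNormal D z))

variable {c} {ε k C : ℝ} {D : Set (Space n)} {h w : Space n → ℝ} {z : Space n}

lemma truncatedGreenTrace_eq_greenTrace (hh : |h z| < k) (hw : |w z| < k) :
    c.truncatedGreenTrace ε D k h w z = c.greenTrace ε D h w z := by
  simp only [truncatedGreenTrace, greenTrace, Pi.add_apply, Pi.zero_apply, fluxTrace,
    adjoint_weight, truncation_eq_self hh, truncation_eq_self hw,
    (deriv_truncation_eventuallyEq_one hh).eq_of_nhds,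
    (deriv_truncation_eventuallyEq_one hw).eq_of_nhds, Pi.one_apply]
  ring

lemma truncationDefect_eq_zero (hh : |h z| < k) (hw : |w z| < k) :
    c.truncationDefect ε k h w z = 0 := by
  simp only [truncationDefect, deriv_deriv_truncation_eq_zero hh,
    deriv_deriv_truncation_eq_zero hw, zero_mul, sub_zero, mul_zero]

lemma abs_truncationDefect_le
    (hC : ∀ s t, |deriv (deriv (truncation k)) s * truncation k t| ≤ C) (z : Space n) :
    |c.truncationDefect ε k h w z| ≤ |ε| *
      (C * |c.weight ε z * inner ℝ (c.diffFlux h z) (∇ h z)|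
        + C * |c.weight ε z * inner ℝ (c.adjoint.diffFlux w z) (∇ w z)|) := by
  rw [truncationDefect, abs_mul]
  refine mul_le_mul_of_nonneg_left ((abs_sub _ _).trans ?_) (abs_nonneg _)
  rw [abs_mul, abs_mul (_ * truncation k (h z))]
  gcongr
  exacts [hC _ _, hC _ _]

lemma fluxDiv_add_adjoint_fluxDiv (hk : k ≠ 0) (hh : DifferentiableAt ℝ h z)
    (hw : DifferentiableAt ℝ w z) :
    c.fluxDiv ε h (fun z => deriv (truncation k) (h z) * truncation k (w z))
        (fun z => truncation k (h z) * truncation k (w z)) z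
      + c.adjoint.fluxDiv ε w (fun z => -(deriv (truncation k) (w z) * truncation k (h z))) 0 z
      = c.truncationDefect ε k h w z := by
  have hT : Differentiable ℝ (truncation k) := (contDiff_truncation hk).differentiable one_ne_zero
  have hT' : Differentiable ℝ (deriv (truncation k)) :=
    (contDiff_deriv_truncation hk).differentiable one_ne_zero
  have hdT {v : Space n → ℝ} (hv : DifferentiableAt ℝ v z) :
      DifferentiableAt ℝ (fun y => truncation k (v y)) z := (hT _).comp z hv
  have hdT' {v : Space n → ℝ} (hv : DifferentiableAt ℝ v z) :
      DifferentiableAt ℝ (fun y => deriv (truncation k) (v y)) z := (hT' _).comp z hv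
  simp only [fluxDiv, truncationDefect, adjoint_weight, adjoint_drift, Pi.zero_def,
    gradient_fun_neg, gradient_fun_const, gradient_mul (hdT' hh) (hdT hw),
    gradient_mul (hdT' hw) (hdT hh), gradient_mul (hdT hh) (hdT hw),
    gradient_comp (hT _).hasDerivAt hh, gradient_comp (hT _).hasDerivAt hw,
    gradient_comp (hT' _).hasDerivAt hh, gradient_comp (hT' _).hasDerivAt hw,
    inner_add_right, inner_sub_right, inner_neg_left, inner_neg_right, inner_zero_right,
    real_inner_smul_right, neg_smul, c.inner_adjoint_diffFlux w h]
  ring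

namespace Regular

lemma hasWeakDiv_truncatedGreenField (hc : c.Regular ε) (hD : IsOpen D) (hk : k ≠ 0)
    (hh : c.IsWeakSolution ε D h) (hw : c.adjoint.IsWeakSolution ε D w) :
    HasWeakDiv D (c.truncatedGreenField ε k h w) (c.truncationDefect ε k h w) := by
  have hhd := hh.contDiffOn
  have hwd := hw.contDiffOn
  have hT := contDiff_truncation hk
  have hT' := contDiff_deriv_truncation hk
  have ha := (hT'.comp_contDiffOn hhd).mul (hT.comp_contDiffOn hwd)
  have hg := (hT.comp_contDiffOn hhd).mul (hT.comp_contDiffOn hwd)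
  have hb := ((hT'.comp_contDiffOn hwd).mul (hT.comp_contDiffOn hhd)).neg
  have hzero : ContDiffOn ℝ 1 (0 : Space n → ℝ) D := contDiffOn_const
  refine ((hc.hasWeakDiv_flux hD hh ha hg).add (hc.adjoint.hasWeakDiv_flux hD hw hb hzero) hD
    (hc.continuousOn_flux hD hhd ha.continuousOn hg.continuousOn)
    (hc.continuousOn_fluxDiv hD hhd ha hg)
    (hc.adjoint.continuousOn_flux hD hwd hb.continuousOn hzero.continuousOn)
    (hc.adjoint.continuousOn_fluxDiv hD hwd hb hzero)).congr hD (fun _ _ => rfl) fun z hz => ?_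
  exact fluxDiv_add_adjoint_fluxDiv hk
    (((hhd z hz).contDiffAt (hD.mem_nhds hz)).differentiableAt one_ne_zero)
    (((hwd z hz).contDiffAt (hD.mem_nhds hz)).differentiableAt one_ne_zero)

lemma integrableOn_truncationDefect (hc : c.Regular ε) (hD : IsOpen D) (hk : 0 < k)
    (hh : c.IsWeakSolution ε D h) (hw : c.adjoint.IsWeakSolution ε D w) :
    IntegrableOn (c.truncationDefect ε k h w) D := by
  obtain ⟨C, hC⟩ := exists_abs_deriv_deriv_truncation_mul_le
  have hmeas {u v : Space n → ℝ} (hu : ContinuousOn u D) (hv : ContinuousOn v D) :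
      AEStronglyMeasurable (fun z => deriv (deriv (truncation k)) (u z) * truncation k (v z))
        (volume.restrict D) :=
    ((((contDiff_deriv_truncation hk.ne').continuous_deriv le_rfl).comp_continuousOn hu).mul
      ((contDiff_truncation hk.ne').continuous.comp_continuousOn hv)).aestronglyMeasurable
        hD.measurableSet
  have hch := hh.contDiffOn.continuousOn
  have hcw := hw.contDiffOn.continuousOn
  exact (((hc.integrableOn_weight_mul_inner_diffFlux_gradient hD hh).bdd_mul (c := C)
    (hmeas hch hcw) (ae_of_all _ fun z => hC k hk _ _)).sub
    ((hc.adjoint.integrableOn_weight_mul_inner_diffFlux_gradient hD hw).bdd_mul (c := C)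
      (hmeas hcw hch) (ae_of_all _ fun z => hC k hk _ _))).const_mul ε

lemma tendsto_setIntegral_truncationDefect (hc : c.Regular ε) (hD : IsOpen D)
    (hh : c.IsWeakSolution ε D h) (hw : c.adjoint.IsWeakSolution ε D w) :
    Tendsto (fun k => ∫ z in D, c.truncationDefect ε k h w z) atTop (𝓝 0) := by
  obtain ⟨C, hC⟩ := exists_abs_deriv_deriv_truncation_mul_le
  rw [← integral_zero (Space n) ℝ (μ := volume.restrict D)]
  refine tendsto_integral_filter_of_dominated_convergence (fun z => |ε| *
      (C * |c.weight ε z * inner ℝ (c.diffFlux h z) (∇ h z)|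
        + C * |c.weight ε z * inner ℝ (c.adjoint.diffFlux w z) (∇ w z)|)) ?_ ?_ ?_
    (ae_of_all _ fun z => tendsto_const_nhds.congr' ?_)
  · filter_upwards [eventually_gt_atTop 0] with k hk
    exact (hc.integrableOn_truncationDefect hD hk hh hw).aestronglyMeasurable
  · filter_upwards [eventually_gt_atTop 0] with k hk
    exact ae_of_all _ (abs_truncationDefect_le (hC k hk))
  · exact (((hc.integrableOn_weight_mul_inner_diffFlux_gradient hD hh).norm.const_mul C).add
      ((hc.adjoint.integrableOn_weight_mul_inner_diffFlux_gradient hD hw).norm.const_mul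
        C)).const_mul |ε|
  · filter_upwards [eventually_gt_atTop |h z|, eventually_gt_atTop |w z|] with k hhk hwk
    exact (truncationDefect_eq_zero hhk hwk).symm

lemma setIntegral_truncationDefect (hc : c.Regular ε) (hD : IsOpen D)
    (hF : IsCompact (frontier D)) (hbd : ∀ z ∈ frontier D, HasC2BoundaryAt D (outwardNormal D) z)
    (hk : 0 < k) (hh : c.IsWeakSolution ε D h) (hw : c.adjoint.IsWeakSolution ε D w)
    (hhc : ContinuousOn h (closure D)) (hwc : ContinuousOn w (closure D))
    (hhn : c.HasBoundedConormalDeriv D h) (hwn : c.adjoint.HasBoundedConormalDeriv D w) :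
    ∫ z in D, c.truncationDefect ε k h w z
      = ∫ z in frontier D, c.truncatedGreenTrace ε D k h w z ∂surfaceMeasure n := by
  obtain ⟨K, hK⟩ := exists_abs_truncation_le hk
  have hT := (contDiff_truncation hk.ne').continuous
  have hT' := (contDiff_deriv_truncation hk.ne').continuous
  have ha := (hT'.comp_continuousOn hhc).mul (hT.comp_continuousOn hwc)
  have hg := (hT.comp_continuousOn hhc).mul (hT.comp_continuousOn hwc)
  have hb := ((hT'.comp_continuousOn hwc).mul (hT.comp_continuousOn hhc)).neg
  have hKa (z : Space n) := (hK (h z) (w z)).1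
  have hKg (z : Space n) := (hK (h z) (w z)).2
  have hKb (z : Space n) : |-(deriv (truncation k) (w z) * truncation k (h z))| ≤ K :=
    (abs_neg _).trans_le (hK (w z) (h z)).1
  have hKzero (z : Space n) : |(0 : Space n → ℝ) z| ≤ K := by
    simpa only [Pi.zero_apply, abs_zero] using (abs_nonneg _).trans (hKa z)
  rw [surfaceMeasure_eq]
  refine setIntegral_eq_integral_trace hD hF hbd
    ((hc.hasNormalTrace_flux hD hF hbd hh hhn ha hg hKa hKg).add
      (hc.adjoint.hasNormalTrace_flux hD hF hbd hw hwn hb continuousOn_const hKb hKzero))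
    (hc.integrableOn_truncationDefect hD hk hh hw)
    (hc.hasWeakDiv_truncatedGreenField hD hk.ne' hh hw) ?_
  simp only [Pi.add_apply, smul_add]
  exact (hc.integrableOn_inv_one_add_norm_smul_flux hD hh (ha.mono subset_closure)
    (hg.mono subset_closure) hKa hKg).add
    (hc.adjoint.integrableOn_inv_one_add_norm_smul_flux hD hw (hb.mono subset_closure)
      continuousOn_const hKb hKzero)

theorem integral_greenTrace_eq_zero (hc : c.Regular ε) (hD : IsOpen D)
    (hF : IsCompact (frontier D)) (hbd : ∀ z ∈ frontier D, HasC2BoundaryAt D (outwardNormal D) z)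
    (hh : c.IsWeakSolution ε D h) (hw : c.adjoint.IsWeakSolution ε D w)
    (hhc : ContinuousOn h (closure D)) (hwc : ContinuousOn w (closure D))
    (hhn : c.HasBoundedConormalDeriv D h) (hwn : c.adjoint.HasBoundedConormalDeriv D w) :
    ∫ z in frontier D, c.greenTrace ε D h w z ∂surfaceMeasure n = 0 := by
  obtain ⟨R, hR⟩ := hF.exists_bound_of_continuousOn (hhc.mono frontier_subset_closure)
  obtain ⟨S, hS⟩ := hF.exists_bound_of_continuousOn (hwc.mono frontier_subset_closure)
  refine tendsto_nhds_unique (tendsto_const_nhds.congr' ?_)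
    (hc.tendsto_setIntegral_truncationDefect hD hh hw)
  filter_upwards [eventually_gt_atTop 0, eventually_gt_atTop R, eventually_gt_atTop S]
    with k hk hRk hSk
  rw [hc.setIntegral_truncationDefect hD hF hbd hk hh hw hhc hwc hhn hwn]
  exact (setIntegral_congr_fun isClosed_frontier.measurableSet fun z hz =>
    truncatedGreenTrace_eq_greenTrace ((hR z hz).trans_lt hRk) ((hS z hz).trans_lt hSk)).symm

end Regular

end Coefficients

end

section

section Separation

variable {E : Type*} [NormedAddCommGroup E] [InnerProductSpace ℝ E] [FiniteDimensional ℝ E]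
  {K F : Set E}

open scoped Manifold in
lemma exists_contDiff_one_nhds_zero_nhds (hK : IsCompact K) (hF : IsClosed F)
    (hd : Disjoint K F) : ∃ φ : E → ℝ, ContDiff ℝ 1 φ ∧ HasCompactSupport φ ∧
      (∀ z ∈ K, φ =ᶠ[𝓝 z] fun _ => 1) ∧ ∀ z ∈ F, φ =ᶠ[𝓝 z] fun _ => 0 := by
  obtain ⟨R, hR⟩ := hK.isBounded.exists_norm_le
  have hfar : Disjoint (F ∪ (Metric.ball (0 : E) (R + 1))ᶜ) K := by
    refine hd.symm.union_left (Set.disjoint_left.2 fun z hz hzK => hz ?_)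
    exact mem_ball_zero_iff.2 ((hR z hzK).trans_lt (lt_add_one R))
  obtain ⟨φ, h0, h1, -⟩ := exists_contMDiffMap_zero_one_nhds_of_isClosed (n := 1) 𝓘(ℝ, E)
    (hF.union Metric.isOpen_ball.isClosed_compl) hK.isClosed hfar
  rw [eventually_nhdsSet_iff_forall] at h0 h1
  refine ⟨φ, φ.contMDiff.contDiff, ?_, h1, fun z hz => h0 z (Or.inl hz)⟩
  refine HasCompactSupport.of_support_subset_isCompact (isCompact_closedBall (0 : E) (R + 1))
    fun z hz => Metric.ball_subset_closedBall ?_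
  by_contra hzR
  exact hz (h0 z (Or.inr hzR)).self_of_nhds

end Separation

variable {κ : ℕ} {n : Fin (κ + 1) → ℕ} {A B D : Set (Space n)} {h w : Space n → ℝ}
  {z : Space n}

lemma IsC2Pair.exists_separating (hAB : IsC2Pair A B) :
    ∃ φ : Space n → ℝ, ContDiff ℝ 1 φ ∧ HasCompactSupport φ ∧ (∀ z ∈ frontier A, φ z = 1) ∧
      (∀ z ∈ frontier B, φ z = 0) ∧ ∀ z ∉ outerDomain A B, ∇ φ z = 0 := by
  obtain ⟨φ, hφ, hφc, hA, hB⟩ := exists_contDiff_one_nhds_zero_nhds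
    hAB.bounded_left.isCompact_closure isClosed_closure hAB.disjoint_closure
  have hconst {e : ℝ} {z : Space n} (hz : φ =ᶠ[𝓝 z] fun _ => e) : ∇ φ z = 0 := by
    rw [gradient, hz.fderiv_eq, fderiv_fun_const, Pi.zero_apply, map_zero]
  refine ⟨φ, hφ, hφc, fun z hz => (hA z (frontier_subset_closure hz)).self_of_nhds,
    fun z hz => (hB z (frontier_subset_closure hz)).self_of_nhds, fun z hz => ?_⟩
  rw [outerDomain, closure_union, notMem_compl_iff] at hz
  exact hz.elim (fun hz => hconst (hA z hz)) fun hz => hconst (hB z hz)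

lemma IsC2Pair.setIntegral_frontier_outerDomain (hAB : IsC2Pair A B) {f : Space n → ℝ}
    (hf : ∀ z ∈ frontier B, f z = 0) :
    ∫ z in frontier (outerDomain A B), f z ∂surfaceMeasure n
      = ∫ z in frontier A, f z ∂surfaceMeasure n :=
  setIntegral_eq_of_subset_of_forall_sdiff_eq_zero isClosed_frontier.measurableSet
    hAB.frontier_left_subset fun z hz =>
      hf z ((frontier_outerDomain_subset A B hz.1).resolve_left hz.2)

namespace Coefficients

variable {c : Coefficients κ n} {ε : ℝ}

lemma conormalDeriv_eq_zero (u : Space n → ℝ) (hν : hat (outwardNormal D z) = 0) :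
    c.conormalDeriv D u z = 0 := by
  have hzero : c.conormalQuotient D u z = fun _ => 0 :=
    funext fun δ => by rw [conormalQuotient, hν, inner_zero_right]
  rw [conormalDeriv, hzero]
  exact tendsto_const_nhds.limUnder_eq

lemma inner_drift_of_hat_eq_zero {ν : Space n} (hν : hat ν = 0) (z : Space n) :
    inner ℝ (c.drift z) ν = inner ℝ (c.Bmul z) ν := by
  rw [drift, inner_add_left, inner_b, hν, inner_zero_right, zero_add]

lemma boundary_terms_eq_zero {e : ℝ} (hz : z ∈ frontier D)
    (hh : z ∈ c.regularBoundary D → h z = e)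
    (hw : z ∈ c.adjoint.regularBoundary D → w z = e) :
    (w z - e) * c.conormalDeriv D h z = 0 ∧ (h z - e) * c.adjoint.conormalDeriv D w z = 0 ∧
      (h z - e) * (w z - e) * inner ℝ (c.drift z) (outwardNormal D z) = 0 := by
  by_cases hν : hat (outwardNormal D z) = 0
  · rw [conormalDeriv_eq_zero h hν, conormalDeriv_eq_zero w hν, inner_drift_of_hat_eq_zero hν]
    refine ⟨mul_zero _, mul_zero _, ?_⟩
    rcases lt_trichotomy (inner ℝ (c.Bmul z) (outwardNormal D z)) 0 with hneg | hzero | hpos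
    · rw [hw ⟨hz, Or.inr (by rw [adjoint_Bmul, inner_neg_left]; exact neg_pos.2 hneg)⟩, sub_self,
        mul_zero, zero_mul]
    · rw [hzero, mul_zero]
    · rw [hh ⟨hz, Or.inr hpos⟩, sub_self, zero_mul, zero_mul]
  · simp only [hh ⟨hz, Or.inl hν⟩, hw ⟨hz, Or.inl hν⟩, sub_self, zero_mul, and_self]

lemma greenTrace_eq_zero_of_mem_frontier_right (hAB : IsC2Pair A B)
    (hh : c.IsEquilibriumPotential ε A B h) (hw : c.adjoint.IsEquilibriumPotential ε A B w)
    (hz : z ∈ frontier B) : c.greenTrace ε (outerDomain A B) h w z = 0 := by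
  obtain ⟨hdh, hdw, hdrift⟩ := boundary_terms_eq_zero (c := c) (hAB.frontier_right_subset hz)
    (fun hr => hh.eq_zero z ⟨hr, hz⟩) (fun hr => hw.eq_zero z ⟨hr, hz⟩)
  rw [sub_zero] at hdh hdw
  rw [sub_zero, sub_zero] at hdrift
  rw [greenTrace, hdh, hdw, hdrift, sub_self, mul_zero, add_zero, mul_zero]

namespace Regular

lemma greenTrace_eq_of_mem_frontier_left (hc : c.Regular ε) (hAB : IsC2Pair A B)
    (hh : c.IsEquilibriumPotential ε A B h) (hw : c.adjoint.IsEquilibriumPotential ε A B w)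
    (hz : z ∈ frontier A) :
    c.greenTrace ε (outerDomain A B) h w z
      = 1 / c.Z ε * c.capIntegrand ε A B h z - 1 / c.Z ε * c.adjoint.capIntegrand ε A B w z
        + c.weight ε z * inner ℝ (c.drift z) (outwardNormal (outerDomain A B) z) := by
  obtain ⟨hdh, hdw, hdrift⟩ := boundary_terms_eq_zero (c := c) (hAB.frontier_left_subset hz)
    (fun hr => hh.eq_one z ⟨hr, hz⟩) (fun hr => hw.eq_one z ⟨hr, hz⟩)
  have hZ := hc.Z_pos.ne'
  have hexp : Real.exp (-(c.W z) / ε) = c.Z ε * c.weight ε z := by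
    rw [weight, mul_div_cancel₀ _ hZ]
  have hexp' : Real.exp (-(c.adjoint.W z) / ε) = c.Z ε * c.weight ε z := hexp
  simp only [greenTrace, capIntegrand, adjoint_drift, inner_neg_left, hexp, hexp']
  field_simp
  -- `h w = (h - 1) + (w - 1) + 1 + (h - 1) (w - 1)`, and the last product is killed by the
  -- boundary conditions.
  linear_combination c.weight ε z * (ε * hdh - ε * hdw + hdrift)

lemma integrableOn_capIntegrand (hc : c.Regular ε) (hAB : IsC2Pair A B)
    (hh : c.IsEquilibriumPotential ε A B h) :
    IntegrableOn (c.capIntegrand ε A B h) (frontier A) (surfaceMeasure n) := by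
  have hF := hAB.isCompact_frontier
  obtain ⟨R, hR⟩ := hF.exists_bound_of_continuousOn (hh.continuousOn.mono frontier_subset_closure)
  set k := |R| + 1
  have hk : 0 < k := by positivity
  set K := k * ∫ t, ‖truncationBump t‖
  have hg (z : Space n) : |truncation k (h z) - 1| ≤ K + 1 :=
    (abs_sub _ _).trans (add_le_add (abs_truncation_le hk.le _) abs_one.le)
  have hK : |(1 : ℝ)| ≤ K + 1 := by
    rw [abs_one, le_add_iff_nonneg_left]
    exact (abs_nonneg _).trans (abs_truncation_le hk.le 0)
  have hcont : ContinuousOn (fun z => truncation k (h z) - 1) (closure (outerDomain A B)) :=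
    ((contDiff_truncation hk.ne').continuous.comp_continuousOn hh.continuousOn).sub
      continuousOn_const
  have htrace := (hc.hasNormalTrace_flux (isOpen_outerDomain A B) hF hAB.hasC2BoundaryAt
    hh.weakSolution hh.conormal continuousOn_const hcont (fun _ => hK) hg).integrableOn_trace hF
      hAB.hasC2BoundaryAt
  rw [← surfaceMeasure_eq] at htrace
  refine IntegrableOn.congr_fun ((htrace.mono_set hAB.frontier_left_subset).const_mul (c.Z ε))
    (fun z hz => ?_) isClosed_frontier.measurableSet
  have hhz : |h z| < k :=
    ((hR z (hAB.frontier_left_subset hz)).trans (le_abs_self R)).trans_lt (lt_add_one _)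
  have hZ := hc.Z_pos.ne'
  simp only [fluxTrace, capIntegrand, weight, truncation_eq_self hhz]
  field_simp

lemma hasNormalTrace_weight_smul_drift (hc : c.Regular ε) (hAB : IsC2Pair A B) :
    HasNormalTrace (outerDomain A B) (outwardNormal (outerDomain A B))
      (fun z => c.weight ε z • c.drift z)
      fun z => c.weight ε z * inner ℝ (c.drift z) (outwardNormal (outerDomain A B) z) := by
  have hcont : Continuous fun z => c.weight ε z • c.drift z :=
    hc.continuous_weight.smul hc.continuous_drift
  simpa only [real_inner_smul_left] using
    hasNormalTrace_of_continuous hcont hAB.isCompact_frontier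
      fun z hz => (hAB.hasC2BoundaryAt z hz).norm_eq_one hz

lemma integrableOn_weight_mul_inner_drift (hc : c.Regular ε) (hAB : IsC2Pair A B) :
    IntegrableOn (fun z => c.weight ε z *
      inner ℝ (c.drift z) (outwardNormal (outerDomain A B) z)) (frontier A)
      (surfaceMeasure n) := by
  rw [surfaceMeasure_eq]
  exact ((hc.hasNormalTrace_weight_smul_drift hAB).integrableOn_trace hAB.isCompact_frontier
    hAB.hasC2BoundaryAt).mono_set hAB.frontier_left_subset

lemma integral_weight_mul_inner_drift_eq_zero (hc : c.Regular ε) (hAB : IsC2Pair A B) :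
    ∫ z in frontier A, c.weight ε z * inner ℝ (c.drift z) (outwardNormal (outerDomain A B) z)
      ∂surfaceMeasure n = 0 := by
  obtain ⟨φ, hφ, hφc, hφA, hφB, hφg⟩ := hAB.exists_separating
  have hgreen := green_formula (isOpen_outerDomain A B) hAB.isCompact_frontier
    hAB.hasC2BoundaryAt (hc.hasNormalTrace_weight_smul_drift hAB) integrableOn_zero
    (hc.hasWeakDiv_weight_smul_drift (outerDomain A B)) hφ hφc
  -- The divergence of `φ` times the field vanishes off `Ω`, where `φ` is locally constant.
  have hdiv : ∫ z in outerDomain A B,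
      weakDivIntegrand (fun z => c.weight ε z • c.drift z) (fun _ => 0) φ z = 0 := by
    rw [setIntegral_eq_integral_of_forall_compl_eq_zero fun z hz => by
      rw [weakDivIntegrand, hφg z hz, inner_zero_right, zero_mul, add_zero],
      ← setIntegral_univ]
    exact hc.hasWeakDiv_weight_smul_drift univ φ hφ hφc (subset_univ _)
  rw [hdiv, ← surfaceMeasure_eq, hAB.setIntegral_frontier_outerDomain fun z hz => by
    rw [hφB z hz, zero_mul]] at hgreen
  rw [hgreen]
  exact setIntegral_congr_fun isClosed_frontier.measurableSet fun z hz => by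
    rw [hφA z hz, one_mul]

theorem cap_eq_cap_adjoint (hc : c.Regular ε) (hAB : IsC2Pair A B)
    (hh : c.IsEquilibriumPotential ε A B h) (hw : c.adjoint.IsEquilibriumPotential ε A B w) :
    c.cap ε A B h = c.adjoint.cap ε A B w := by
  have hcap := (hc.integrableOn_capIntegrand hAB hh).const_mul (1 / c.Z ε)
  have hcap' := (hc.adjoint.integrableOn_capIntegrand hAB hw).const_mul (1 / c.Z ε)
  have hsub : IntegrableOn (fun z => 1 / c.Z ε * c.capIntegrand ε A B h z
      - 1 / c.Z ε * c.adjoint.capIntegrand ε A B w z) (frontier A) (surfaceMeasure n) :=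
    hcap.sub hcap'
  have hgreen := hc.integral_greenTrace_eq_zero (isOpen_outerDomain A B) hAB.isCompact_frontier
    hAB.hasC2BoundaryAt hh.weakSolution hw.weakSolution hh.continuousOn hw.continuousOn
    hh.conormal hw.conormal
  rw [hAB.setIntegral_frontier_outerDomain
      fun z hz => greenTrace_eq_zero_of_mem_frontier_right hAB hh hw hz,
    setIntegral_congr_fun isClosed_frontier.measurableSet
      fun z hz => hc.greenTrace_eq_of_mem_frontier_left hAB hh hw hz,
    integral_add hsub (hc.integrableOn_weight_mul_inner_drift hAB),
    hc.integral_weight_mul_inner_drift_eq_zero hAB, add_zero, integral_sub hcap hcap',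
    integral_const_mul, integral_const_mul] at hgreen
  exact sub_eq_zero.1 hgreen

end Regular

end Coefficients

end

end FokkerPlanck

end

theorem mainTheorem2_general {κ : ℕ} {n : Fin (κ + 1) → ℕ} {c : FokkerPlanck.Coefficients κ n}
    {ε : ℝ} (hc : c.Regular ε) {A B : Set (FokkerPlanck.Space n)}
    (hAB : FokkerPlanck.IsC2Pair A B) {h hadj : FokkerPlanck.Space n → ℝ}
    (hh : c.IsEquilibriumPotential ε A B h)
    (hhadj : c.adjoint.IsEquilibriumPotential ε A B hadj) :
    IntegrableOn (c.capIntegrand ε A B h) (frontier A) (FokkerPlanck.surfaceMeasure n) ∧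
    IntegrableOn (c.adjoint.capIntegrand ε A B hadj) (frontier A)
      (FokkerPlanck.surfaceMeasure n) ∧
    c.cap ε A B h = c.adjoint.cap ε A B hadj :=
  ⟨hc.integrableOn_capIntegrand hAB hh, hc.adjoint.integrableOn_capIntegrand hAB hhadj,
    hc.cap_eq_cap_adjoint hAB hh hhadj⟩

theorem mainTheorem2 {κ : ℕ} {n : Fin (κ + 1) → ℕ} (c : FokkerPlanck.Coefficients κ n)
    (hc : c.Admissible) (ε : ℝ) (hε : 0 < ε) (hdiv : c.WeightedDivFree ε)
    (hb : MemLp c.b 2 (c.rho ε))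
    (A B : Set (FokkerPlanck.Space n)) (hAB : FokkerPlanck.AdmissiblePair A B)
    (h hadj : FokkerPlanck.Space n → ℝ)
    (hh : c.IsEquilibriumPotential ε A B h)
    (hhadj : c.adjoint.IsEquilibriumPotential ε A B hadj) :
    IntegrableOn (c.capIntegrand ε A B h) (frontier A) (FokkerPlanck.surfaceMeasure n) ∧
    IntegrableOn (c.adjoint.capIntegrand ε A B hadj) (frontier A)
      (FokkerPlanck.surfaceMeasure n) ∧
    c.cap ε A B h = c.adjoint.cap ε A B hadj := by
  exact mainTheorem2_general (hc.regular hε hdiv hb) hAB.isC2Pair hh hhadj
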